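/- Let $L^2=L^2(]0,\infty[)$ (complex-valued). For $m\in\mathbb C$ let $\tilde L_m=-\partial_x^2+(m^2-\tfrac14)x^{-2}$, acting on distributions on $]0,\infty[$. Let $L_m^{\max}$ be its restriction to $D(L_m^{\max})=\{f\in L^2 : \tilde L_m f\in L^2\}$, and let $L_m^{\min}$ be the closure of the restriction of $L_m^{\max}$ to $C_c^\infty(]0,\infty[)$. A strict extension of $L_m^{\min}$ is an operator $T$ with $L_m^{\min}\subsetneq T\subsetneq L_m^{\max}$. For a solution $u\ne0$ of $\tilde L_m u=0$, let $L_m^u$ be the restriction of $L_m^{\max}$ to those $f\in D(L_m^{\max})$ with $\lim_{x\to0+}\big(u(x)f'(x)-u'(x)f(x)\big)=0$ (elements of $D(L_m^{\max})$ are of class $C^1$ on $]0,\infty[$). Fix $\xi\in C^\infty$ with $\xi=1$ on $]0,1]$ and $\xi=0$ on $[2,\infty[$. For $\operatorname{Re}m>-1$ let $H_m$ be the restriction of $L_m^{\max}$ to $D(L_m^{\min})+\mathbb C\,\xi\, x^{1/2+m}$. Let $(U_\tau f)(x)=e^{\tau/2}f(e^\tau x)$ for $\tau\in\mathbb R$.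 An operator $T$ is called homogeneous if $U_\tau TU_\tau^{-1}=e^{-2\tau}T$ for all $\tau\in\mathbb R$. Suppose $m\in\mathbb C$ and $m^2$ is real. If $m^2\ge1$, then $L_m^{\min}$ is self-adjoint and homogeneous, and $H_m=L_m^{\min}$ if moreover $\operatorname{Re}m>-1$ (that is, if $m\ge1$). If $m^2<1$, then $L_m^{\min}$ is hermitian (densely defined and symmetric) with deficiency indices $(1,1)$. More precisely: 1. Let $0<m<1$ and, for $0\le\theta<\pi$, $u_\theta(x)=x^{1/2-m}\cos\theta+x^{1/2+m}\sin\theta$. Each $L_m^{u_\theta}$ is a self-adjoint extension of $L_m^{\min}$, and each self-adjoint extension of $L_m^{\min}$ equals $L_m^{u_\theta}$ for a unique $\theta\in[0,\pi)$. There are exactly two homogeneous strict extensions of $L_m^{\min}$, namely the distinct self-adjoint operators $H_m=L_m^{u_{\pi/2}}$ and $H_{-m}=L_m^{u_0}$. 2. Let $m=0$ and, for $0\le\theta<\pi$, $u_\theta(x)=x^{1/2}\ln x\,\cos\theta+x^{1/2}\sin\theta$. Each $L_0^{u_\theta}$ is a self-adjoint extension of $L_0^{\min}$, and each self-adjoint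 extension of $L_0^{\min}$ equals $L_0^{u_\theta}$ for a unique $\theta\in[0,\pi)$. There is exactly one homogeneous strict extension of $L_0^{\min}$, namely the self-adjoint operator $H_0=L_0^{u_{\pi/2}}$. 3. Let $m=i\mu$ with $\mu>0$ and, for $0\le\theta<\pi$, $u_\theta(x)=x^{1/2}\cos(\mu\ln x)\cos\theta+x^{1/2}\sin(\mu\ln x)\sin\theta$. Each $L_m^{u_\theta}$ is a self-adjoint extension of $L_m^{\min}$, and each self-adjoint extension of $L_m^{\min}$ equals $L_m^{u_\theta}$ for a unique $\theta\in[0,\pi)$. None of the self-adjoint extensions of $L_m^{\min}$ is homogeneous, but $L_m^{\min}$ has exactly two homogeneous strict extensions, namely the distinct operators $H_m$ and $H_{-m}$, which are not self-adjoint. -/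

import Mathlib

open MeasureTheory Set Filter Topology
open scoped ContDiff

noncomputable section

namespace HomSchrodinger

/-- Lebesgue measure on the open half-line `]0, ∞[`. -/
abbrev halfLine : Measure ℝ := volume.restrict (Ioi (0 : ℝ))

/-- The complex Hilbert space `L²(]0, ∞[)`. -/
abbrev L2 : Type := Lp ℂ 2 halfLine

/-! ### Test functions and the formal differential expression -/

/-- `φ ∈ C_c^∞(]0, ∞[)` (extended by zero to the real line). -/
structure IsTest (φ : ℝ → ℂ) : Prop where
  smooth : ContDiff ℝ ∞ φ
  compact : HasCompactSupport φ
  supp : tsupport φ ⊆ Ioi 0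

/-- The differential expression `-∂ₓ² + (m² - 1/4) x⁻²` applied to a smooth function. -/
def formalL (m : ℂ) (φ : ℝ → ℂ) (x : ℝ) : ℂ :=
  -(iteratedDeriv 2 φ x) + (m ^ 2 - 1 / 4) / (x : ℂ) ^ 2 * φ x

theorem IsTest.memLp {φ : ℝ → ℂ} (h : IsTest φ) : MemLp φ 2 halfLine :=
  (h.smooth.continuous.memLp_of_hasCompactSupport h.compact).restrict _

theorem IsTest.continuous_formalL {φ : ℝ → ℂ} (h : IsTest φ) (m : ℂ) :
    Continuous (formalL m φ) := by
  have h1 : Continuous (iteratedDeriv 2 φ) :=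
    (contDiff_infty.1 h.smooth 2).continuous_iteratedDeriv 2 le_rfl
  have h2 : Continuous fun x : ℝ => (m ^ 2 - 1 / 4) / (x : ℂ) ^ 2 * φ x := by
    apply continuous_of_tsupport
    intro x hx
    have hx0 : x ∈ Ioi (0 : ℝ) := h.supp (tsupport_mul_subset_right hx)
    have hne : (x : ℂ) ^ 2 ≠ 0 := pow_ne_zero _ (by exact_mod_cast (ne_of_gt hx0))
    exact ((continuousAt_const.div
      ((Complex.continuous_ofReal.pow 2).continuousAt) hne)).mul h.smooth.continuous.continuousAt
  exact h1.neg.add h2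

theorem IsTest.memLp_formalL {φ : ℝ → ℂ} (h : IsTest φ) (m : ℂ) :
    MemLp (formalL m φ) 2 halfLine := by
  refine ((h.continuous_formalL m).memLp_of_hasCompactSupport ?_).restrict _
  refine HasCompactSupport.add ?_ h.compact.mul_left
  have : HasCompactSupport (iteratedDeriv 2 φ) := by
    rw [iteratedDeriv_succ, iteratedDeriv_one]
    exact h.compact.deriv.deriv
  exact this.neg

theorem integrable_pair (f : L2) {g : ℝ → ℂ} (hg : MemLp g 2 halfLine) :
    Integrable (fun x => f x * g x) halfLine :=
  (Lp.memLp f).integrable_mul hg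

/-! ### The maximal and the minimal operator -/

/-- The graph of the maximal operator: the pairs `(f, g)` of elements of `L²` such that
`-f'' + (m² - 1/4) x⁻² f = g` in the sense of distributions on `]0, ∞[`. -/
def maxGraph (m : ℂ) : Submodule ℂ (L2 × L2) where
  carrier := {p | ∀ φ : ℝ → ℂ, IsTest φ →
    ∫ x, p.1 x * formalL m φ x ∂halfLine = ∫ x, p.2 x * φ x ∂halfLine}
  zero_mem' := by
    intro φ _
    change ∫ x, (0 : L2) x * _ ∂halfLine = ∫ x, (0 : L2) x * _ ∂halfLine
    refine integral_congr_ae ?_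
    filter_upwards [Lp.coeFn_zero ℂ 2 halfLine] with x hx
    rw [hx, Pi.zero_apply, zero_mul, zero_mul]
  add_mem' := by
    intro p q hp hq φ hφ
    have key : ∀ (f g : L2) {ψ : ℝ → ℂ}, MemLp ψ 2 halfLine →
        ∫ x, (f + g : L2) x * ψ x ∂halfLine =
          ∫ x, f x * ψ x ∂halfLine + ∫ x, g x * ψ x ∂halfLine := by
      intro f g ψ hψ
      rw [← integral_add (integrable_pair f hψ) (integrable_pair g hψ)]
      refine integral_congr_ae ?_
      filter_upwards [Lp.coeFn_add f g] with x hx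
      rw [hx, Pi.add_apply, add_mul]
    change ∫ x, (p.1 + q.1 : L2) x * _ ∂halfLine = ∫ x, (p.2 + q.2 : L2) x * _ ∂halfLine
    rw [key _ _ (hφ.memLp_formalL m), key _ _ hφ.memLp, hp φ hφ, hq φ hφ]
  smul_mem' := by
    intro c p hp φ hφ
    have key : ∀ (f : L2) (ψ : ℝ → ℂ),
        ∫ x, (c • f : L2) x * ψ x ∂halfLine = c * ∫ x, f x * ψ x ∂halfLine := by
      intro f ψ
      rw [← integral_const_mul]
      refine integral_congr_ae ?_
      filter_upwards [Lp.coeFn_smul c f] with x hx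
      rw [hx, Pi.smul_apply, smul_eq_mul, mul_assoc]
    change ∫ x, (c • p.1 : L2) x * _ ∂halfLine = ∫ x, (c • p.2 : L2) x * _ ∂halfLine
    rw [key, key, hp φ hφ]

/-- The distribution on the left determines the `L²` function on the right. -/
theorem maxGraph_functional (m : ℂ) :
    ∀ p : L2 × L2, p ∈ maxGraph m → p.1 = 0 → p.2 = 0 := by
  rintro ⟨f, g⟩ hp hf
  have hf : f = 0 := hf
  subst hf
  have hz : ∀ φ : ℝ → ℂ, IsTest φ → ∫ x, g x * φ x ∂halfLine = 0 := by
    intro φ hφ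
    have h1 : ∫ x, (0 : L2) x * formalL m φ x ∂halfLine = ∫ x, g x * φ x ∂halfLine := hp φ hφ
    rw [← h1, ← integral_zero ℝ ℂ (μ := halfLine)]
    refine integral_congr_ae ?_
    filter_upwards [Lp.coeFn_zero ℂ 2 halfLine] with x hx
    rw [hx, Pi.zero_apply, zero_mul]
  have hae : ∀ᵐ x ∂(volume : Measure ℝ), x ∈ Ioi (0 : ℝ) → g x = 0 := by
    refine isOpen_Ioi.ae_eq_zero_of_integral_contDiff_smul_eq_zero ?_ ?_
    · rw [locallyIntegrableOn_iff isOpen_Ioi.isLocallyClosed]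
      intro k hk hkc
      have hm : MemLp g 2 (volume.restrict k) :=
        (Lp.memLp g).mono_measure (Measure.restrict_mono_set _ hk)
      have : IsFiniteMeasure (volume.restrict k) := ⟨by simpa using hkc.measure_lt_top⟩
      exact hm.integrable (by norm_num)
    · intro ψ hψ hc hs
      have hsupp : tsupport (fun x => (ψ x : ℂ)) ⊆ tsupport ψ :=
        closure_mono fun x hx => by
          simp only [Function.mem_support] at hx ⊢
          exact_mod_cast hx
      have ht : IsTest fun x => (ψ x : ℂ) :=
        ⟨Complex.ofRealCLM.contDiff.comp hψ, hc.comp_left (g := Complex.ofReal) (by simp),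
          hsupp.trans hs⟩
      have h1 := hz _ ht
      rw [← setIntegral_eq_integral_of_forall_compl_eq_zero (s := Ioi (0 : ℝ))]
      · rw [← h1]
        refine integral_congr_ae (Eventually.of_forall fun x => ?_)
        simp [mul_comm]
      · intro x hx
        have : ψ x = 0 := by
          by_contra hne
          exact hx (hs (subset_tsupport _ hne))
        simp [this]
  change g = 0
  rw [Lp.eq_zero_iff_ae_eq_zero]
  exact (ae_restrict_iff' measurableSet_Ioi).2 hae

/-- The maximal operator `L_m^max`: domain `{f ∈ L² | L̃_m f ∈ L²}`, action `f ↦ L̃_m f`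
(distributional). -/
def LMax (m : ℂ) : L2 →ₗ.[ℂ] L2 := (maxGraph m).toLinearPMap

theorem LMax_graph (m : ℂ) : (LMax m).graph = maxGraph m :=
  Submodule.toLinearPMap_graph_eq _ fun p hp h0 => maxGraph_functional m p hp h0

theorem LMax_isClosed (m : ℂ) : (LMax m).IsClosed := by
  have hcont : ∀ {ψ : ℝ → ℂ}, MemLp ψ 2 halfLine →
      Continuous fun f : L2 => ∫ x, f x * ψ x ∂halfLine := by
    intro ψ hψ
    have hc : Continuous fun f : L2 => inner ℂ (hψ.star.toLp (star ψ)) f :=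
      continuous_const.inner continuous_id
    refine hc.congr fun f => ?_
    rw [L2.inner_def]
    refine integral_congr_ae ?_
    filter_upwards [hψ.star.coeFn_toLp] with x hx
    rw [hx]
    simp
  rw [LinearPMap.IsClosed, LMax_graph]
  have : (maxGraph m : Set (L2 × L2)) = ⋂ (φ : ℝ → ℂ) (_ : IsTest φ),
      {p : L2 × L2 | ∫ x, p.1 x * formalL m φ x ∂halfLine = ∫ x, p.2 x * φ x ∂halfLine} := by
    ext p
    simp only [mem_iInter]
    rfl
  rw [this]
  exact isClosed_iInter fun φ => isClosed_iInter fun hφ => isClosed_eq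
    ((hcont (hφ.memLp_formalL m)).comp continuous_fst) ((hcont hφ.memLp).comp continuous_snd)

/-- `C_c^∞(]0, ∞[)` as a subspace of `L²`. -/
def testSpace : Submodule ℂ L2 where
  carrier := {f | ∃ φ : ℝ → ℂ, IsTest φ ∧ f =ᵐ[halfLine] φ}
  zero_mem' := ⟨fun _ => 0, ⟨contDiff_const, HasCompactSupport.zero, by simp [tsupport]⟩,
    Lp.coeFn_zero ℂ 2 halfLine⟩
  add_mem' := by
    rintro f g ⟨φ, hφ, hf⟩ ⟨ψ, hψ, hg⟩
    refine ⟨φ + ψ, ⟨hφ.smooth.add hψ.smooth, hφ.compact.add hψ.compact, ?_⟩,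
      (Lp.coeFn_add f g).trans (hf.add hg)⟩
    exact (tsupport_add φ ψ).trans (union_subset hφ.supp hψ.supp)
  smul_mem' := by
    rintro c f ⟨φ, hφ, hf⟩
    refine ⟨c • φ, ⟨hφ.smooth.const_smul c, hφ.compact.smul_left (f := fun _ => c), ?_⟩,
      (Lp.coeFn_smul c f).trans (hf.const_smul c)⟩
    exact (closure_mono (Function.support_const_smul_subset c φ)).trans hφ.supp

theorem integral_parts {f g : ℝ → ℂ} (hf : ContDiff ℝ ∞ f) (hg : ContDiff ℝ ∞ g) (hfc : HasCompactSupport f)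
    : ∫ x, f x * deriv g x = - ∫ x, deriv f x * g x := by
  have hf1 := hf.differentiable (by simp)
  have hg1 := hg.differentiable (by simp)
  have cf := hf.continuous_deriv (by simp)
  have cg := hg.continuous_deriv (by simp)
  apply integral_mul_deriv_eq_deriv_mul_of_integrable (fun x _ => (hf1 x).hasDerivAt)
    (fun x _ => (hg1 x).hasDerivAt)
  · exact (hf.continuous.mul cg).integrable_of_hasCompactSupport hfc.mul_right
  · exact (cf.mul hg.continuous).integrable_of_hasCompactSupport hfc.deriv.mul_right
  · exact (hf.continuous.mul hg.continuous).integrable_of_hasCompactSupport hfc.mul_right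

/-- `C_c^∞(]0, ∞[) ⊆ D(L_m^max)`. -/
theorem testSpace_le (m : ℂ) : testSpace ≤ (LMax m).domain := by
  rintro f ⟨φ, hφ, hf⟩
  have hL := hφ.memLp_formalL m
  refine LinearPMap.mem_domain_iff.2 ⟨hL.toLp _, ?_⟩
  rw [LMax_graph]
  intro ψ hψ
  have e1 : ∫ x, f x * formalL m ψ x ∂halfLine = ∫ x, φ x * formalL m ψ x := by
    rw [← setIntegral_eq_integral_of_forall_compl_eq_zero (s := Ioi (0 : ℝ))
      (f := fun x => φ x * formalL m ψ x)]
    · refine integral_congr_ae ?_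
      filter_upwards [hf] with x hx
      rw [hx]
    · intro x hx
      rw [image_eq_zero_of_notMem_tsupport (fun h => hx (hφ.supp h)), zero_mul]
  have e2 : ∫ x, hL.toLp _ x * ψ x ∂halfLine = ∫ x, formalL m φ x * ψ x := by
    rw [← setIntegral_eq_integral_of_forall_compl_eq_zero (s := Ioi (0 : ℝ))
      (f := fun x => formalL m φ x * ψ x)]
    · refine integral_congr_ae ?_
      filter_upwards [hL.coeFn_toLp] with x hx
      rw [hx]
    · intro x hx
      rw [image_eq_zero_of_notMem_tsupport (fun h => hx (hψ.supp h)), mul_zero]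
  change ∫ x, f x * formalL m ψ x ∂halfLine = ∫ x, hL.toLp _ x * ψ x ∂halfLine
  rw [e1, e2]
  have d1 : ContDiff ℝ ∞ (deriv φ) := (contDiff_infty_iff_deriv.1 hφ.smooth).2
  have d2 : ContDiff ℝ ∞ (deriv ψ) := (contDiff_infty_iff_deriv.1 hψ.smooth).2
  have p1 := integral_parts hφ.smooth d2 hφ.compact
  have p2 := integral_parts d1 hψ.smooth hφ.compact.deriv
  have key : ∫ x, φ x * deriv (deriv ψ) x = ∫ x, deriv (deriv φ) x * ψ x := by rw [p1, p2, neg_neg]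
  have hc : ∀ x, φ x * formalL m ψ x = formalL m φ x * ψ x + (deriv (deriv φ) x * ψ x - φ x * deriv (deriv ψ) x) := by
    intro x
    simp only [formalL, iteratedDeriv_succ, iteratedDeriv_zero]
    ring
  simp_rw [hc]
  have c1 := (contDiff_infty_iff_deriv.1 d1).2.continuous
  have c2 := (contDiff_infty_iff_deriv.1 d2).2.continuous
  have i1 : Integrable fun x => formalL m φ x * ψ x :=
    ((hφ.continuous_formalL m).mul hψ.smooth.continuous).integrable_of_hasCompactSupport hψ.compact.mul_left
  have i2 : Integrable fun x => deriv (deriv φ) x * ψ x :=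
    (c1.mul hψ.smooth.continuous).integrable_of_hasCompactSupport hψ.compact.mul_left
  have i3 : Integrable fun x => φ x * deriv (deriv ψ) x :=
    (hφ.smooth.continuous.mul c2).integrable_of_hasCompactSupport hφ.compact.mul_right
  have h1 := integral_add i1 (i2.sub i3)
  have h2 := integral_sub i2 i3
  simp only [Pi.sub_apply] at h1 h2
  rw [h1, h2, key, sub_self, add_zero]

/-- The minimal operator `L_m^min`: the closure of the restriction of `L_m^max`
to `C_c^∞(]0, ∞[)`. -/
def LMin (m : ℂ) : L2 →ₗ.[ℂ] L2 := ((LMax m).domRestrict testSpace).closure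

/-- The operator whose closure is taken in `LMin` is closable. -/
theorem isClosable_domRestrict (m : ℂ) : ((LMax m).domRestrict testSpace).IsClosable :=
  (LMax_isClosed m).isClosable.leIsClosable LinearPMap.domRestrict_le

/-! ### Extensions of the minimal operator -/

/-- A strict extension of `L_m^min`: an operator lying strictly between `L_m^min` and `L_m^max`. -/
def IsStrictExtension (m : ℂ) (T : L2 →ₗ.[ℂ] L2) : Prop := LMin m < T ∧ T < LMax m

/-- A self-adjoint extension of `L_m^min`. -/
def IsSelfAdjointExtension (m : ℂ) (T : L2 →ₗ.[ℂ] L2) : Prop := LMin m ≤ T ∧ IsSelfAdjoint T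

/-- The functions `f ∈ L²` which are of class `C¹` on `]0, ∞[` and for which the Wronskian
`W_x(u, f) = u(x) f'(x) - u'(x) f(x)` tends to `0` as `x → 0+`. -/
def wronskianKernel (u : ℝ → ℂ) : Submodule ℂ L2 where
  carrier := {f | ∃ F : ℝ → ℂ, f =ᵐ[halfLine] F ∧ ContDiffOn ℝ 1 F (Ioi 0) ∧
    Tendsto (fun x => u x * deriv F x - deriv u x * F x) (𝓝[>] 0) (𝓝 0)}
  zero_mem' := ⟨fun _ => 0, Lp.coeFn_zero ℂ 2 halfLine, contDiffOn_const, by simp⟩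
  add_mem' := by
    rintro f g ⟨F, hf, hF, hF0⟩ ⟨G, hg, hG, hG0⟩
    refine ⟨F + G, (Lp.coeFn_add f g).trans (hf.add hg), hF.add hG, ?_⟩
    have h := hF0.add hG0
    rw [add_zero] at h
    refine h.congr' ?_
    filter_upwards [self_mem_nhdsWithin] with x hx
    have hFx := (hF.differentiableOn one_ne_zero).differentiableAt (Ioi_mem_nhds hx)
    have hGx := (hG.differentiableOn one_ne_zero).differentiableAt (Ioi_mem_nhds hx)
    rw [deriv_add hFx hGx, Pi.add_apply]
    ring
  smul_mem' := by
    rintro c f ⟨F, hf, hF, hF0⟩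
    refine ⟨c • F, (Lp.coeFn_smul c f).trans (hf.const_smul c), hF.const_smul c, ?_⟩
    have h := hF0.const_mul c
    rw [mul_zero] at h
    refine h.congr' ?_
    filter_upwards [self_mem_nhdsWithin] with x hx
    have hFx := (hF.differentiableOn one_ne_zero).differentiableAt (Ioi_mem_nhds hx)
    rw [deriv_const_smul c hFx, Pi.smul_apply, smul_eq_mul, smul_eq_mul]
    ring

/-- `L_m^u`: the restriction of `L_m^max` to the `f` with `W_0(u, f) = 0`. -/
def LExt (m : ℂ) (u : ℝ → ℂ) : L2 →ₗ.[ℂ] L2 := (LMax m).domRestrict (wronskianKernel u)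

/-- `ζ_m(x) = x^{1/2 + m}`. -/
def zeta (m : ℂ) (x : ℝ) : ℂ := (x : ℂ) ^ (1 / 2 + m)

/-- A smooth cut-off, equal to `1` on `]-∞, 1]` and to `0` on `[2, ∞[`. -/
def cutoff (x : ℝ) : ℝ := Real.smoothTransition (2 - x)

/-- The line `ℂ v` spanned in `L²` by (the class of) a function `v`. -/
def lineSpan (v : ℝ → ℂ) : Submodule ℂ L2 where
  carrier := {f | ∃ c : ℂ, f =ᵐ[halfLine] fun x => c * v x}
  zero_mem' := ⟨0, by
    filter_upwards [Lp.coeFn_zero ℂ 2 halfLine] with x hx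
    rw [hx, Pi.zero_apply, zero_mul]⟩
  add_mem' := by
    rintro f g ⟨a, hf⟩ ⟨b, hg⟩
    refine ⟨a + b, ?_⟩
    filter_upwards [Lp.coeFn_add f g, hf, hg] with x h1 h2 h3
    rw [h1, Pi.add_apply, h2, h3, add_mul]
  smul_mem' := by
    rintro c f ⟨a, hf⟩
    refine ⟨c * a, ?_⟩
    filter_upwards [Lp.coeFn_smul c f, hf] with x h1 h2
    rw [h1, Pi.smul_apply, h2, smul_eq_mul, mul_assoc]

/-- `H_m` (for `Re m > -1`): the restriction of `L_m^max` to `D(L_m^min) + ℂ ξ ζ_m`. -/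
def Hop (m : ℂ) : L2 →ₗ.[ℂ] L2 :=
  (LMax m).domRestrict ((LMin m).domain ⊔ lineSpan fun x => (cutoff x : ℂ) * zeta m x)

/-! ### Deficiency indices -/

/-- The subspace `ker (T* - z)` of `L²`. -/
def deficiencySpace (T : L2 →ₗ.[ℂ] L2) (z : ℂ) : Submodule ℂ L2 :=
  (LinearMap.ker (T.adjoint.toFun - z • T.adjoint.domain.subtype)).map T.adjoint.domain.subtype

/-- `T` is hermitian (densely defined, `T ⊆ T*`) with deficiency indices `(p, q)`, that is
`dim ker (T* - i) = p` and `dim ker (T* + i) = q`. -/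
structure HasDeficiencyIndices (T : L2 →ₗ.[ℂ] L2) (p q : ℕ) : Prop where
  dense : Dense (T.domain : Set L2)
  hermitian : T ≤ T.adjoint
  pos : Module.rank ℂ (deficiencySpace T Complex.I) = p
  neg : Module.rank ℂ (deficiencySpace T (-Complex.I)) = q

/-! ### Dilations and homogeneity -/

theorem map_mul_halfLine {c : ℝ} (hc : 0 < c) :
    Measure.map (fun x => c * x) halfLine = ENNReal.ofReal c⁻¹ • halfLine := by
  have hpre : (fun x : ℝ => c * x) ⁻¹' Ioi 0 = Ioi 0 := by
    ext x
    simp [hc]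
  have h := Measure.restrict_map (μ := (volume : Measure ℝ)) (f := fun x : ℝ => c * x)
    (measurable_const_mul c) (measurableSet_Ioi (a := (0 : ℝ)))
  rw [hpre, Real.map_volume_mul_left hc.ne', Measure.restrict_smul,
    abs_of_pos (inv_pos.2 hc)] at h
  exact h.symm

theorem quasi_mul {c : ℝ} (hc : 0 < c) :
    Measure.QuasiMeasurePreserving (fun x => c * x) halfLine halfLine :=
  ⟨measurable_const_mul c, by
    rw [map_mul_halfLine hc]
    exact Measure.smul_absolutelyContinuous⟩

theorem memLp_dilate (τ : ℝ) (f : L2) :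
    MemLp (fun x => (Real.exp (τ / 2) : ℂ) * f (Real.exp τ * x)) 2 halfLine := by
  refine MemLp.const_mul ?_ _
  have h : MemLp f 2 (Measure.map (fun x => Real.exp τ * x) halfLine) := by
    rw [map_mul_halfLine (Real.exp_pos τ)]
    exact (Lp.memLp f).smul_measure ENNReal.ofReal_ne_top
  exact h.comp_of_map (measurable_const_mul _).aemeasurable

/-- The dilation group on `L²`: `(U_τ f)(x) = e^{τ/2} f(e^τ x)`. -/
def dilation (τ : ℝ) : L2 →ₗ[ℂ] L2 where
  toFun f := (memLp_dilate τ f).toLp _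
  map_add' f g := by
    rw [← MemLp.toLp_add]
    refine MemLp.toLp_congr _ _ ?_
    filter_upwards [(quasi_mul (Real.exp_pos τ)).ae (Lp.coeFn_add f g)] with x hx
    rw [hx, Pi.add_apply, Pi.add_apply, mul_add]
  map_smul' c f := by
    rw [RingHom.id_apply, ← MemLp.toLp_const_smul]
    refine MemLp.toLp_congr _ _ ?_
    filter_upwards [(quasi_mul (Real.exp_pos τ)).ae (Lp.coeFn_smul c f)] with x hx
    rw [hx, Pi.smul_apply, Pi.smul_apply, smul_eq_mul, smul_eq_mul]
    ring

theorem dilation_coeFn (τ : ℝ) (f : L2) :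
    ⇑(dilation τ f) =ᵐ[halfLine] fun x => (Real.exp (τ / 2) : ℂ) * f (Real.exp τ * x) :=
  (memLp_dilate τ f).coeFn_toLp

/-- `T` is homogeneous of degree `ν`, `U_τ T U_τ⁻¹ = e^{ν τ} T` for all real `τ`; that is,
`U_τ D(T) ⊆ D(T)` and `U_τ T f = e^{ν τ} T U_τ f` for `f ∈ D(T)`. -/
def IsHomogeneous (ν : ℝ) (T : L2 →ₗ.[ℂ] L2) : Prop :=
  ∀ (τ : ℝ) (f : T.domain), ∃ h : dilation τ f ∈ T.domain,
    dilation τ (T f) = (Real.exp (ν * τ) : ℂ) • T ⟨dilation τ f, h⟩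

/-! ### The boundary functions `u_θ` -/

/-- `u_θ(x) = x^{1/2-m} cos θ + x^{1/2+m} sin θ`. -/
def uReal (m θ : ℝ) (x : ℝ) : ℂ :=
  ((x ^ (1 / 2 - m) * Real.cos θ + x ^ (1 / 2 + m) * Real.sin θ : ℝ) : ℂ)

/-- `u_θ(x) = x^{1/2} ln x cos θ + x^{1/2} sin θ`. -/
def uZero (θ : ℝ) (x : ℝ) : ℂ :=
  ((x ^ (1 / 2 : ℝ) * Real.log x * Real.cos θ + x ^ (1 / 2 : ℝ) * Real.sin θ : ℝ) : ℂ)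

/-- `u_θ(x) = x^{1/2} cos(μ ln x) cos θ + x^{1/2} sin(μ ln x) sin θ`. -/
def uImag (μ θ : ℝ) (x : ℝ) : ℂ :=
  ((x ^ (1 / 2 : ℝ) * Real.cos (μ * Real.log x) * Real.cos θ +
    x ^ (1 / 2 : ℝ) * Real.sin (μ * Real.log x) * Real.sin θ : ℝ) : ℂ)

end HomSchrodinger

end

open HomSchrodinger

namespace HomSchrodinger

/-! ### Integration by parts for primitives of integrable functions -/

/-! The proof turns questions about extensions into linear algebra on a space of boundary values at
the origin. By the du Bois-Reymond lemma every element of the maximal domain has a `C¹`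
representative with locally absolutely continuous derivative (`exists_solvesODE`). Green's formula
then identifies the alternating form `bdry p q = ∫ (p.1 q.2 - p.2 q.1)` with the limit at `0` of the
Wronskian of the representatives; infinity contributes nothing, because an `L²` pair cannot have a
Wronskian with nonzero limit there (`SolvesODE.wronskian_atTop`). For real `m²` the adjoint of `LMin
m` is `LMax m`, so by the double adjoint the graph of `LMin m` is the radical of `bdry` on the
maximal graph (`mem_LMin_graph_iff`).

If `m² < 1`, all solutions of the homogeneous equation are square integrable near `0`. For solutions
`u`, `v` with constant Wronskian `w ≠ 0`, the identity `W(F,H) w = W(u,F) W(v,H) - W(v,F) W(u,H)`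
passes to the limit, and `bdry` becomes the pullback of the standard symplectic form under `p ↦
(bdry a p, bdry b p)`, where `a`, `b` are the classes of `ξu`, `ξv` in the graph. Thus maximal
modulo minimal is `ℂ²`, and strict extensions are lines in it. With `u`, `v` real, self-adjoint
extensions are the lines with real direction, hence the angle `θ`. A self-adjoint extension has
codimension one in `LMax m`, which gives deficiency indices `(1, 1)`. Dilations act linearly on
`ℂ²`, and homogeneous extensions are the invariant lines: the two eigenlines of a diagonal action
with distinct characters if `m ≠ 0`, the single eigenline of a Jordan block if `m = 0`. For `m = iμ`
complex conjugation exchanges the two eigenlines, so neither is real and neither extension is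
self-adjoint.

If `m² ≥ 1`, the form vanishes identically. With `k = √(m²) ≥ 1`, the Wronskian of `x^{1/2+k}` with
any element of the maximal domain must tend to `0`, since otherwise that element would be too large
near `0` to lie in `L²` (`tendsto_wronskian_zeta_eq_zero`). The same Wronskian identity, applied to
`x^{1/2±k}` with quantitative bounds, then gives `bdry = 0`, that is `LMin m = LMax m`. -/

theorem absolutelyContinuousOnInterval_congr {f g : ℝ → ℂ} {a b : ℝ}
    (hf : AbsolutelyContinuousOnInterval f a b) (h : EqOn f g (uIcc a b)) :
    AbsolutelyContinuousOnInterval g a b := by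
  refine Tendsto.congr' ?_ hf
  rw [EventuallyEq, eventually_inf_principal]
  refine Eventually.of_forall fun x hx => Finset.sum_congr rfl fun i hi => ?_
  rw [h (hx.left i hi).left, h (hx.left i hi).right]

theorem absolutelyContinuousOnInterval_integral_complex {k : ℝ → ℂ} {a b : ℝ}
    (hk : IntervalIntegrable k volume a b) :
    AbsolutelyContinuousOnInterval (fun x => ∫ t in a..x, k t) a b := by
  have hre : IntervalIntegrable (fun x => (k x).re) volume a b :=
    ⟨hk.1.re, hk.2.re⟩
  have him : IntervalIntegrable (fun x => (k x).im) volume a b :=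
    ⟨hk.1.im, hk.2.im⟩
  have h1 := hre.absolutelyContinuousOnInterval_intervalIntegral left_mem_uIcc
  have h2 := him.absolutelyContinuousOnInterval_intervalIntegral left_mem_uIcc
  have c (z : ℂ) : AbsolutelyContinuousOnInterval (fun _ : ℝ => z) a b :=
    (contDiff_const (c := z)).contDiffOn.absolutelyContinuousOnInterval
  have h3 := (h1.fun_smul (c 1)).fun_add (h2.fun_smul (c Complex.I))
  refine absolutelyContinuousOnInterval_congr h3 fun x hx => ?_
  have hi : IntervalIntegrable k volume a x := hk.mono_set (uIcc_subset_uIcc_left hx)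
  apply Complex.ext
  · have := Complex.reCLM.intervalIntegral_comp_comm hi
    simp only [Complex.reCLM_apply] at this
    simp [this]
  · have := Complex.imCLM.intervalIntegral_comp_comm hi
    simp only [Complex.imCLM_apply] at this
    simp [this]

/-- Integration by parts for the product of a primitive of an integrable function and
a continuously differentiable function. -/
theorem integral_primitive_mul {p q k q' : ℝ → ℂ} {a b : ℝ}
    (hk : IntervalIntegrable k volume a b)
    (hp : ∀ x ∈ uIcc a b, p x = p a + ∫ t in a..x, k t)
    (hq : ∀ x ∈ uIcc a b, HasDerivAt q (q' x) x) (hq' : ContinuousOn q' (uIcc a b)) :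
    ∫ x in a..b, (k x * q x + p x * q' x) = p b * q b - p a * q a := by
  set P : ℝ → ℂ := fun x => p a + ∫ t in a..x, k t with hP
  have hPac : AbsolutelyContinuousOnInterval P a b :=
    ((contDiff_const (c := p a)).contDiffOn.absolutelyContinuousOnInterval).fun_add
      (absolutelyContinuousOnInterval_integral_complex hk)
  have hqc : ContinuousOn q (uIcc a b) := fun x hx => (hq x hx).continuousAt.continuousWithinAt
  have hq'i : IntervalIntegrable q' volume a b := hq'.intervalIntegrable
  have hqac : AbsolutelyContinuousOnInterval q a b := by
    have h := ((contDiff_const (c := q a)).contDiffOn.absolutelyContinuousOnInterval).fun_add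
      (absolutelyContinuousOnInterval_integral_complex hq'i)
    refine absolutelyContinuousOnInterval_congr h fun x hx => ?_
    have hs : uIcc a x ⊆ uIcc a b := uIcc_subset_uIcc_left hx
    rw [intervalIntegral.integral_eq_sub_of_hasDerivAt (fun y hy => hq y (hs hy))
      (hq'i.mono_set hs)]
    ring
  set r : ℝ → ℂ := fun x => k x * q x + P x * q' x with hr
  have hri : IntervalIntegrable r volume a b :=
    (hk.mul_continuousOn hqc).add (hPac.continuousOn.mul hq').intervalIntegrable
  -- `P q` minus the primitive of `r = (P q)'` is absolutely continuous with derivative zero almost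
  -- everywhere, hence constant.
  have hD := (hPac.fun_smul hqac).fun_sub (absolutelyContinuousOnInterval_integral_complex hri)
  have hae : ∀ᵐ x, x ∈ uIcc a b →
      HasDerivAt (fun x => P x • q x - ∫ t in a..x, r t) 0 x := by
    filter_upwards [hk.ae_hasDerivAt_integral, hri.ae_hasDerivAt_integral] with x h1 h2 hx
    have d1 := ((h1 hx a left_mem_uIcc).const_add (p a)).mul (hq x hx)
    have d2 := h2 hx a left_mem_uIcc
    have := d1.sub d2
    rw [sub_self] at this
    exact this
  obtain ⟨C, hC⟩ := hD.const_of_ae_hasDerivAt_zero hae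
  have e1 := hC a left_mem_uIcc
  have e2 := hC b right_mem_uIcc
  have e3 : ∫ x in a..b, (k x * q x + p x * q' x) = ∫ x in a..b, r x := by
    refine intervalIntegral.integral_congr fun x hx => ?_
    simp only [hr, hP]
    rw [hp x hx]
  have e4 : P b = p b := (hp b right_mem_uIcc).symm
  have e5 : P a = p a := by simp [hP]
  rw [e3]
  simp only [smul_eq_mul, intervalIntegral.integral_same, e4, e5] at e1 e2
  linear_combination e1 - e2

/-- `F` is continuously differentiable on `]0, ∞[`, with derivative `F1`, and `F1` is a primitive
of the locally integrable function `k`. -/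
structure IsSecondPrimitive (F F1 k : ℝ → ℂ) : Prop where
  hasDerivAt : ∀ x, 0 < x → HasDerivAt F (F1 x) x
  integrable : ∀ a b, 0 < a → 0 < b → IntervalIntegrable k volume a b
  sub_eq : ∀ a b, 0 < a → 0 < b → F1 b - F1 a = ∫ t in a..b, k t

theorem uIcc_subset_Ioi_zero {a b : ℝ} (ha : 0 < a) (hb : 0 < b) : uIcc a b ⊆ Ioi 0 :=
  fun _ hx => (lt_min ha hb).trans_le hx.1

theorem continuousOn_of_sub_eq_integral {G k : ℝ → ℂ}
    (hk : ∀ a b, 0 < a → 0 < b → IntervalIntegrable k volume a b)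
    (hG : ∀ a b, 0 < a → 0 < b → G b - G a = ∫ t in a..b, k t) : ContinuousOn G (Ioi 0) := by
  intro x hx
  have hx0 : 0 < x := hx
  have hac := (absolutelyContinuousOnInterval_integral_complex
    (hk (x / 2) (2 * x) (by linarith) (by linarith))).continuousOn
  have hmem : uIcc (x / 2) (2 * x) ∈ 𝓝 x := by
    rw [uIcc_of_le (by linarith)]
    exact Icc_mem_nhds (by linarith) (by linarith)
  have h1 : ContinuousAt (fun y => G (x / 2) + ∫ t in (x / 2)..y, k t) x :=
    continuousAt_const.add (hac.continuousAt hmem)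
  refine (h1.congr ?_).continuousWithinAt
  filter_upwards [Ioi_mem_nhds hx0] with y hy
  rw [← hG _ _ (by linarith) hy]
  ring

namespace IsSecondPrimitive

variable {F F1 k H H1 l : ℝ → ℂ}

theorem continuousOn (h : IsSecondPrimitive F F1 k) : ContinuousOn F (Ioi 0) :=
  fun x hx => (h.hasDerivAt x hx).continuousAt.continuousWithinAt

theorem continuousOn_deriv (h : IsSecondPrimitive F F1 k) : ContinuousOn F1 (Ioi 0) :=
  continuousOn_of_sub_eq_integral h.integrable h.sub_eq

theorem contDiffOn (h : IsSecondPrimitive F F1 k) : ContDiffOn ℝ 1 F (Ioi 0) := by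
  rw [show (1 : WithTop ℕ∞) = 0 + 1 from rfl, contDiffOn_succ_iff_deriv_of_isOpen isOpen_Ioi]
  refine ⟨fun x hx => (h.hasDerivAt x hx).differentiableAt.differentiableWithinAt, by simp, ?_⟩
  exact contDiffOn_zero.2 (h.continuousOn_deriv.congr fun x hx => (h.hasDerivAt x hx).deriv)

theorem integral_deriv_mul {q q' : ℝ → ℂ} (h : IsSecondPrimitive F F1 k) {a b : ℝ} (ha : 0 < a)
    (hb : 0 < b) (hq : ∀ x, 0 < x → HasDerivAt q (q' x) x) (hq' : ContinuousOn q' (Ioi 0)) :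
    ∫ x in a..b, (k x * q x + F1 x * q' x) = F1 b * q b - F1 a * q a := by
  have hs := uIcc_subset_Ioi_zero ha hb
  refine integral_primitive_mul (h.integrable a b ha hb) (fun x hx => ?_)
    (fun x hx => hq x (hs hx)) (hq'.mono hs)
  rw [← h.sub_eq a x ha (hs hx)]
  ring

/-- Green's formula. -/
theorem wronskian_sub (hF : IsSecondPrimitive F F1 k) (hH : IsSecondPrimitive H H1 l) {a b : ℝ}
    (ha : 0 < a) (hb : 0 < b) :
    (F b * H1 b - F1 b * H b) - (F a * H1 a - F1 a * H a) =
      ∫ x in a..b, (F x * l x - k x * H x) := by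
  have e1 := hH.integral_deriv_mul ha hb hF.hasDerivAt hF.continuousOn_deriv
  have e2 := hF.integral_deriv_mul ha hb hH.hasDerivAt hH.continuousOn_deriv
  have hs := uIcc_subset_Ioi_zero ha hb
  have c1 := (hF.continuousOn_deriv.mul hH.continuousOn_deriv).mono hs
  have i1 : IntervalIntegrable (fun x => l x * F x + H1 x * F1 x) volume a b :=
    ((hH.integrable a b ha hb).mul_continuousOn (hF.continuousOn.mono hs)).add
      ((hH.continuousOn_deriv.mul hF.continuousOn_deriv).mono hs).intervalIntegrable
  have i2 : IntervalIntegrable (fun x => k x * H x + F1 x * H1 x) volume a b :=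
    ((hF.integrable a b ha hb).mul_continuousOn (hH.continuousOn.mono hs)).add
      c1.intervalIntegrable
  have e3 := intervalIntegral.integral_sub i1 i2
  rw [e1, e2] at e3
  have e4 : ∫ x in a..b, (F x * l x - k x * H x) =
      ∫ x in a..b, (l x * F x + H1 x * F1 x - (k x * H x + F1 x * H1 x)) :=
    intervalIntegral.integral_congr fun x _ => by ring
  rw [e4, e3]
  ring

theorem add (hF : IsSecondPrimitive F F1 k) (hH : IsSecondPrimitive H H1 l) :
    IsSecondPrimitive (fun x => F x + H x) (fun x => F1 x + H1 x) (fun x => k x + l x) where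
  hasDerivAt x hx := (hF.hasDerivAt x hx).add (hH.hasDerivAt x hx)
  integrable a b ha hb := (hF.integrable a b ha hb).add (hH.integrable a b ha hb)
  sub_eq a b ha hb := by
    rw [intervalIntegral.integral_add (hF.integrable a b ha hb) (hH.integrable a b ha hb),
      ← hF.sub_eq a b ha hb, ← hH.sub_eq a b ha hb]
    ring

theorem const_mul (hF : IsSecondPrimitive F F1 k) (c : ℂ) :
    IsSecondPrimitive (fun x => c * F x) (fun x => c * F1 x) (fun x => c * k x) where
  hasDerivAt x hx := (hF.hasDerivAt x hx).const_mul c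
  integrable a b ha hb := (hF.integrable a b ha hb).const_mul c
  sub_eq a b ha hb := by
    rw [intervalIntegral.integral_const_mul, ← hF.sub_eq a b ha hb]
    ring

theorem star (hF : IsSecondPrimitive F F1 k) :
    IsSecondPrimitive (fun x => star (F x)) (fun x => star (F1 x)) (fun x => star (k x)) where
  hasDerivAt x hx := (hF.hasDerivAt x hx).star
  integrable a b ha hb := by
    have h := hF.integrable a b ha hb
    exact ⟨Complex.conjLIE.toContinuousLinearEquiv.toContinuousLinearMap.integrable_comp h.1,
      Complex.conjLIE.toContinuousLinearEquiv.toContinuousLinearMap.integrable_comp h.2⟩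
  sub_eq a b ha hb := by
    have h := Complex.conjCLE.toContinuousLinearMap.intervalIntegral_comp_comm
      (hF.integrable a b ha hb)
    rw [← hF.sub_eq a b ha hb] at h
    refine Eq.trans ?_ h.symm
    simp

theorem of_hasDerivAt (hF : ∀ x, 0 < x → HasDerivAt F (F1 x) x)
    (hF1 : ∀ x, 0 < x → HasDerivAt F1 (k x) x) (hk : ContinuousOn k (Ioi 0)) :
    IsSecondPrimitive F F1 k where
  hasDerivAt := hF
  integrable a b ha hb := (hk.mono (uIcc_subset_Ioi_zero ha hb)).intervalIntegrable
  sub_eq a b ha hb := by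
    have hs := uIcc_subset_Ioi_zero ha hb
    exact (intervalIntegral.integral_eq_sub_of_hasDerivAt (fun x hx => hF1 x (hs hx))
      (hk.mono hs).intervalIntegrable).symm

/-- Only integrals of the second derivative enter, so it may be changed on a null set. This lets
elements of `L²` serve as right-hand sides. -/
theorem congr_ae (hF : IsSecondPrimitive F F1 k) (hk : k =ᵐ[halfLine] l) :
    IsSecondPrimitive F F1 l := by
  have key : ∀ a b, 0 < a → 0 < b → ∀ᵐ x, x ∈ uIoc a b → k x = l x := by
    intro a b ha hb
    have := (ae_restrict_iff' measurableSet_Ioi).1 hk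
    filter_upwards [this] with x hx hm
    exact hx (uIcc_subset_Ioi_zero ha hb (uIoc_subset_uIcc hm))
  refine ⟨hF.hasDerivAt, fun a b ha hb => ?_, fun a b ha hb => ?_⟩
  · exact (hF.integrable a b ha hb).congr_ae ((ae_restrict_iff' measurableSet_uIoc).2 (key a b ha hb))
  · rw [hF.sub_eq a b ha hb]
    exact intervalIntegral.integral_congr_ae (key a b ha hb)

end IsSecondPrimitive

/-! ### Test functions and the lemma of du Bois-Reymond -/

theorem IsTest.deriv {φ : ℝ → ℂ} (h : IsTest φ) : IsTest (deriv φ) :=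
  ⟨(contDiff_infty_iff_deriv.1 h.smooth).2, h.compact.deriv,
    (closure_minimal support_deriv_subset (isClosed_tsupport φ)).trans h.supp⟩

theorem IsTest.add {φ ψ : ℝ → ℂ} (hφ : IsTest φ) (hψ : IsTest ψ) : IsTest (φ + ψ) :=
  ⟨hφ.smooth.add hψ.smooth, hφ.compact.add hψ.compact,
    (tsupport_add φ ψ).trans (union_subset hφ.supp hψ.supp)⟩

theorem IsTest.const_mul {φ : ℝ → ℂ} (hφ : IsTest φ) (c : ℂ) : IsTest (fun x => c * φ x) :=
  ⟨contDiff_const.mul hφ.smooth, hφ.compact.mul_left, tsupport_mul_subset_right.trans hφ.supp⟩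

theorem IsTest.star {φ : ℝ → ℂ} (hφ : IsTest φ) : IsTest (fun x => star (φ x)) := by
  refine ⟨Complex.conjCLE.contDiff.comp hφ.smooth, hφ.compact.comp_left (g := Star.star) (star_zero _),
    (closure_mono fun x hx => ?_).trans hφ.supp⟩
  simpa using hx

theorem IsTest.exists_Ioo {φ : ℝ → ℂ} (h : IsTest φ) :
    ∃ a b, 0 < a ∧ a < b ∧ tsupport φ ⊆ Ioo a b := by
  have hc : IsCompact (tsupport φ) := h.compact
  rcases (tsupport φ).eq_empty_or_nonempty with he | hne
  · exact ⟨1, 2, one_pos, one_lt_two, by simp [he]⟩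
  · obtain ⟨x, hx, hx'⟩ := hc.exists_isLeast hne
    obtain ⟨y, hy, hy'⟩ := hc.exists_isGreatest hne
    have hx0 : 0 < x := h.supp hx
    have hxy := hx' hy
    exact ⟨x / 2, y + 1, by linarith, by linarith, fun z hz =>
      ⟨by linarith [hx' hz], by linarith [hy' hz]⟩⟩

theorem integral_halfLine_eq_intervalIntegral {r : ℝ → ℂ} {a b : ℝ} (ha : 0 < a) (hab : a ≤ b)
    (hr : ∀ x, x ∉ Ioc a b → r x = 0) : ∫ x, r x ∂halfLine = ∫ x in a..b, r x := by
  rw [intervalIntegral.integral_of_le hab]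
  exact setIntegral_eq_of_subset_of_forall_sdiff_eq_zero measurableSet_Ioi
    (fun x hx => ha.trans hx.1) fun x hx => hr x hx.2

theorem IsTest.integral_eq {φ : ℝ → ℂ} (h : IsTest φ) : ∫ x, φ x ∂halfLine = ∫ x, φ x :=
  setIntegral_eq_integral_of_forall_compl_eq_zero fun _ hx =>
    image_eq_zero_of_notMem_tsupport fun h' => hx (h.supp h')

/-- The primitive started left of the support is constant to the right of it, and that constant is
the total integral, so it vanishes. -/
theorem IsTest.exists_deriv_eq {φ : ℝ → ℂ} (h : IsTest φ) (h0 : ∫ x, φ x ∂halfLine = 0) :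
    ∃ ψ, IsTest ψ ∧ _root_.deriv ψ = φ := by
  obtain ⟨a, b, ha, hab, hs⟩ := h.exists_Ioo
  have hz : ∀ x, x ∉ Ioo a b → φ x = 0 := fun x hx =>
    image_eq_zero_of_notMem_tsupport fun h' => hx (hs h')
  have hd : ∀ x, HasDerivAt (fun x => ∫ t in a..x, φ t) (φ x) x := fun x =>
    h.smooth.continuous.integral_hasStrictDerivAt a x |>.hasDerivAt
  have hde : _root_.deriv (fun x => ∫ t in a..x, φ t) = φ := funext fun x => (hd x).deriv
  have hsub : tsupport (fun x => ∫ t in a..x, φ t) ⊆ Icc a b := by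
    refine closure_minimal (fun x hx => ?_) isClosed_Icc
    by_contra hn
    refine hx ?_
    change ∫ t in a..x, φ t = 0
    rw [mem_Icc, not_and_or, not_le, not_le] at hn
    rcases hn with hn | hn
    · rw [intervalIntegral.integral_symm, intervalIntegral.integral_of_le hn.le,
        setIntegral_eq_zero_of_forall_eq_zero, neg_zero]
      exact fun t ht => hz t fun h' => by linarith [ht.2, h'.1]
    · rw [← h0]
      refine (integral_halfLine_eq_intervalIntegral ha (hab.le.trans hn.le) fun t ht => ?_).symm
      exact hz t fun h' => ht ⟨h'.1, by linarith [h'.2]⟩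
  refine ⟨_, ⟨?_, HasCompactSupport.of_support_subset_isCompact isCompact_Icc
    ((subset_tsupport _).trans hsub), hsub.trans fun x hx => ha.trans_le hx.1⟩, hde⟩
  rw [contDiff_infty_iff_deriv, hde]
  exact ⟨fun x => (hd x).differentiableAt, h.smooth⟩

theorem exists_isTest_integral_eq_one : ∃ ρ, IsTest ρ ∧ ∫ x, ρ x ∂halfLine = 1 := by
  let B : ContDiffBump (1 : ℝ) := ⟨1 / 4, 1 / 2, by norm_num, by norm_num⟩
  have hsupp : tsupport (fun x => ((B.normed volume x : ℝ) : ℂ)) ⊆ Ioi 0 := by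
    have h1 : tsupport (fun x => ((B.normed volume x : ℝ) : ℂ)) ⊆ tsupport (B.normed volume) :=
      closure_mono fun x hx => by simpa using hx
    refine h1.trans ?_
    rw [B.tsupport_normed_eq]
    intro x hx
    have := hx.out
    rw [Real.dist_eq, abs_le] at this
    have h2 : B.rOut = 1 / 2 := rfl
    rw [h2] at this
    rw [mem_Ioi]
    linarith [this.1]
  have ht : IsTest fun x => ((B.normed volume x : ℝ) : ℂ) :=
    ⟨Complex.ofRealCLM.contDiff.comp B.contDiff_normed,
      B.hasCompactSupport_normed.comp_left (g := Complex.ofReal) (by simp), hsupp⟩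
  refine ⟨_, ht, ?_⟩
  rw [ht.integral_eq, integral_complex_ofReal, B.integral_normed]
  simp

theorem IsTest.integrable_mul {φ h : ℝ → ℂ} (hφ : IsTest φ) (hh : LocallyIntegrableOn h (Ioi 0)) :
    Integrable (fun x => h x * φ x) halfLine := by
  have hk : IntegrableOn h (tsupport φ) := hh.integrableOn_compact_subset hφ.supp hφ.compact
  have h1 : IntegrableOn (fun x => h x * φ x) (tsupport φ) :=
    hk.mul_continuousOn hφ.smooth.continuous.continuousOn hφ.compact
  exact ((integrableOn_iff_integrable_of_support_subset fun x hx =>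
    subset_tsupport φ (right_ne_zero_of_mul hx)).1 h1).restrict

theorem ae_eq_zero_of_forall_isTest {h : ℝ → ℂ} (hh : LocallyIntegrableOn h (Ioi 0))
    (h0 : ∀ φ, IsTest φ → ∫ x, h x * φ x ∂halfLine = 0) : h =ᵐ[halfLine] 0 := by
  refine (ae_restrict_iff' measurableSet_Ioi).2 ?_
  refine isOpen_Ioi.ae_eq_zero_of_integral_contDiff_smul_eq_zero hh fun ψ hψ hc hs => ?_
  have hsupp : tsupport (fun x => (ψ x : ℂ)) ⊆ tsupport ψ :=
    closure_mono fun x hx => by simpa using hx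
  have ht : IsTest fun x => (ψ x : ℂ) :=
    ⟨Complex.ofRealCLM.contDiff.comp hψ, hc.comp_left (g := Complex.ofReal) (by simp),
      hsupp.trans hs⟩
  rw [← h0 _ ht, ← setIntegral_eq_integral_of_forall_compl_eq_zero (s := Ioi (0 : ℝ))]
  · exact integral_congr_ae (Eventually.of_forall fun x => by simp [mul_comm])
  · intro x hx
    simp [image_eq_zero_of_notMem_tsupport fun h' => hx (hs h')]

/-- A locally integrable function with vanishing weak derivative is constant. -/
theorem exists_ae_eq_const {h : ℝ → ℂ} (hh : LocallyIntegrableOn h (Ioi 0))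
    (h0 : ∀ φ, IsTest φ → ∫ x, h x * deriv φ x ∂halfLine = 0) :
    ∃ C : ℂ, h =ᵐ[halfLine] fun _ => C := by
  obtain ⟨ρ, hρ, hρ1⟩ := exists_isTest_integral_eq_one
  refine ⟨∫ x, h x * ρ x ∂halfLine, ?_⟩
  have hc : LocallyIntegrableOn (fun _ : ℝ => ∫ x, h x * ρ x ∂halfLine) (Ioi 0) :=
    continuousOn_const.locallyIntegrableOn measurableSet_Ioi
  have := ae_eq_zero_of_forall_isTest (hh.sub hc) fun φ hφ => ?_
  · filter_upwards [this] with x hx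
    exact sub_eq_zero.1 hx
  have iφ := (hφ.smooth.continuous.integrable_of_hasCompactSupport (μ := volume) hφ.compact).restrict (s := Ioi 0)
  have iρ := (hρ.smooth.continuous.integrable_of_hasCompactSupport (μ := volume) hρ.compact).restrict (s := Ioi 0)
  set I := ∫ x, φ x ∂halfLine with hI
  -- Subtracting `I ρ` gives `φ` integral zero, so the result is the derivative of a test function
  -- and `h` annihilates it. This says `∫ h φ = C ∫ φ` with `C = ∫ h ρ`.
  obtain ⟨ψ, hψ, hψφ⟩ := (hφ.add (hρ.const_mul (-I))).exists_deriv_eq (by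
    simp only [Pi.add_apply]
    rw [integral_add iφ (iρ.const_mul _), integral_const_mul, hρ1]
    ring)
  have e1 := h0 ψ hψ
  rw [hψφ] at e1
  have i1 := hφ.integrable_mul hh
  have i2 := hρ.integrable_mul hh
  have e2 : ∫ x, h x * (φ + fun x => -I * ρ x) x ∂halfLine =
      ∫ x, h x * φ x ∂halfLine - I * ∫ x, h x * ρ x ∂halfLine := by
    rw [← integral_const_mul, ← integral_sub i1 (i2.const_mul _)]
    exact integral_congr_ae (Eventually.of_forall fun x => by simp only [Pi.add_apply]; ring)
  rw [e2] at e1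
  have e3 : ∫ x, (h - fun _ : ℝ => ∫ x, h x * ρ x ∂halfLine) x * φ x ∂halfLine =
      ∫ x, h x * φ x ∂halfLine - (∫ x, h x * ρ x ∂halfLine) * I := by
    rw [hI, ← integral_const_mul, ← integral_sub i1 (iφ.const_mul _)]
    exact integral_congr_ae (Eventually.of_forall fun x => by simp only [Pi.sub_apply]; ring)
  rw [e3]
  linear_combination e1

/-- A locally integrable function with vanishing second weak derivative is affine. -/
theorem exists_ae_eq_affine {h : ℝ → ℂ} (hh : LocallyIntegrableOn h (Ioi 0))
    (h0 : ∀ φ, IsTest φ → ∫ x, h x * deriv (deriv φ) x ∂halfLine = 0) :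
    ∃ A B : ℂ, h =ᵐ[halfLine] fun x => A + B * x := by
  obtain ⟨ρ, hρ, hρ1⟩ := exists_isTest_integral_eq_one
  -- The slope is forced: if `h = A + B x`, integration by parts gives `∫ h ρ' = -B ∫ ρ = -B`.
  set B := -∫ x, h x * deriv ρ x ∂halfLine with hB
  have hlin : LocallyIntegrableOn (fun x : ℝ => -(B * x)) (Ioi 0) := by
    refine ContinuousOn.locallyIntegrableOn ?_ measurableSet_Ioi
    fun_prop
  suffices H : ∀ φ, IsTest φ → ∫ x, (h + fun x : ℝ => -(B * x)) x * deriv φ x ∂halfLine = 0 by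
    obtain ⟨A, hA⟩ := exists_ae_eq_const (hh.add hlin) H
    refine ⟨A, B, ?_⟩
    filter_upwards [hA] with x hx
    rw [← hx, Pi.add_apply]
    ring
  intro φ hφ
  have iφ := (hφ.smooth.continuous.integrable_of_hasCompactSupport (μ := volume) hφ.compact).restrict (s := Ioi 0)
  have iρ := (hρ.smooth.continuous.integrable_of_hasCompactSupport (μ := volume) hρ.compact).restrict (s := Ioi 0)
  set I := ∫ x, φ x ∂halfLine with hI
  obtain ⟨ψ, hψ, hψφ⟩ := (hφ.add (hρ.const_mul (-I))).exists_deriv_eq (by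
    simp only [Pi.add_apply]
    rw [integral_add iφ (iρ.const_mul _), integral_const_mul, hρ1]
    ring)
  have e1 := h0 ψ hψ
  have hd : deriv (φ + fun x => -I * ρ x) = fun x => deriv φ x - I * deriv ρ x := by
    funext x
    have d1 := (hφ.smooth.differentiable (by simp)) x
    have d2 := (hρ.smooth.differentiable (by simp)) x
    rw [deriv_add d1 (d2.const_mul _), deriv_const_mul _ d2]
    ring
  rw [hψφ, hd] at e1
  have i1 := hφ.deriv.integrable_mul hh
  have i2 := hρ.deriv.integrable_mul hh
  have e2 : ∫ x, h x * (deriv φ x - I * deriv ρ x) ∂halfLine =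
      ∫ x, h x * deriv φ x ∂halfLine - I * ∫ x, h x * deriv ρ x ∂halfLine := by
    rw [← integral_const_mul, ← integral_sub i1 (i2.const_mul _)]
    exact integral_congr_ae (Eventually.of_forall fun x => by ring)
  rw [e2] at e1
  have e3 : ∫ x, (h + fun x : ℝ => -(B * x)) x * deriv φ x ∂halfLine =
      ∫ x, h x * deriv φ x ∂halfLine + ∫ x : ℝ, -(B * x) * deriv φ x ∂halfLine := by
    rw [← integral_add i1 (hφ.deriv.integrable_mul hlin)]
    exact integral_congr_ae (Eventually.of_forall fun x => by simp only [Pi.add_apply]; ring)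
  have e4 : ∫ x : ℝ, -(B * x) * deriv φ x ∂halfLine = B * I := by
    have hsm : ContDiff ℝ ∞ fun x : ℝ => -(B * (x : ℂ)) :=
      (contDiff_const.mul Complex.ofRealCLM.contDiff).neg
    have t1 : IsTest fun x : ℝ => -(B * x) * deriv φ x :=
      ⟨hsm.mul hφ.deriv.smooth, hφ.deriv.compact.mul_left,
        tsupport_mul_subset_right.trans hφ.deriv.supp⟩
    rw [t1.integral_eq]
    have p := integral_parts hφ.smooth hsm hφ.compact
    have dl : ∀ x : ℝ, deriv (fun x : ℝ => -(B * (x : ℂ))) x = -B := fun x => by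
      have := ((Complex.ofRealCLM.hasDerivAt (x := x)).const_mul B).neg
      simpa using this.deriv
    simp_rw [dl] at p
    rw [integral_mul_const] at p
    rw [hI, hφ.integral_eq]
    simp_rw [mul_comm _ (deriv φ _)]
    linear_combination p
  rw [e3, e4]
  linear_combination e1 + I * hB

/-! ### Regularity of the elements of the maximal domain -/

theorem locallyIntegrableOn_of_memLp {f : ℝ → ℂ} (hf : MemLp f 2 halfLine) :
    LocallyIntegrableOn f (Ioi 0) := by
  rw [locallyIntegrableOn_iff isOpen_Ioi.isLocallyClosed]
  intro k hk hkc
  have hm : MemLp f 2 (volume.restrict k) := hf.mono_measure (Measure.restrict_mono_set _ hk)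
  have : IsFiniteMeasure (volume.restrict k) := ⟨by simpa using hkc.measure_lt_top⟩
  exact hm.integrable (by norm_num)

theorem intervalIntegrable_of_locallyIntegrableOn {f : ℝ → ℂ}
    (hf : LocallyIntegrableOn f (Ioi 0)) {a b : ℝ} (ha : 0 < a) (hb : 0 < b) :
    IntervalIntegrable f volume a b :=
  (intervalIntegrable_iff.2 <| (hf.integrableOn_compact_subset (uIcc_subset_Ioi_zero ha hb)
    isCompact_uIcc).mono_set uIoc_subset_uIcc)

theorem IsSecondPrimitive.integral_mul_isTest {F F1 k φ : ℝ → ℂ} (h : IsSecondPrimitive F F1 k)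
    (hφ : IsTest φ) :
    ∫ x, F x * deriv (deriv φ) x ∂halfLine = ∫ x, k x * φ x ∂halfLine := by
  obtain ⟨a, b, ha, hab, hs⟩ := hφ.exists_Ioo
  have hb : 0 < b := ha.trans hab
  have h0 : ∀ x, x ∉ Ioo a b → φ x = 0 := fun x hx =>
    image_eq_zero_of_notMem_tsupport fun h' => hx (hs h')
  have hs1 : tsupport (deriv φ) ⊆ tsupport φ :=
    closure_minimal support_deriv_subset (isClosed_tsupport φ)
  have hs2 : tsupport (deriv (deriv φ)) ⊆ tsupport φ :=
    (closure_minimal support_deriv_subset (isClosed_tsupport _)).trans hs1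
  have h1 : ∀ x, x ∉ Ioo a b → deriv φ x = 0 := fun x hx =>
    image_eq_zero_of_notMem_tsupport fun h' => hx (hs (hs1 h'))
  have h2 : ∀ x, x ∉ Ioo a b → deriv (deriv φ) x = 0 := fun x hx =>
    image_eq_zero_of_notMem_tsupport fun h' => hx (hs (hs2 h'))
  have ho : ∀ x, x ∉ Ioc a b → x ∉ Ioo a b := fun x hx h' => hx (Ioo_subset_Ioc_self h')
  have d0 : ∀ x, HasDerivAt φ (deriv φ x) x := fun x =>
    ((hφ.smooth.differentiable (by simp)) x).hasDerivAt
  have d1 : ∀ x, HasDerivAt (deriv φ) (deriv (deriv φ) x) x := fun x =>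
    ((hφ.deriv.smooth.differentiable (by simp)) x).hasDerivAt
  have c0 := hφ.smooth.continuous
  have c1 := hφ.deriv.smooth.continuous
  have c2 := hφ.deriv.deriv.smooth.continuous
  have hsub := uIcc_subset_Ioi_zero ha hb
  rw [integral_halfLine_eq_intervalIntegral ha hab.le fun x hx => by rw [h2 x (ho x hx), mul_zero],
    integral_halfLine_eq_intervalIntegral ha hab.le fun x hx => by rw [h0 x (ho x hx), mul_zero]]
  have e1 := h.integral_deriv_mul ha hb (fun x _ => d0 x) c1.continuousOn
  have iF1 : ContinuousOn (fun x => F1 x * deriv φ x) (uIcc a b) :=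
    (h.continuousOn_deriv.mono hsub).mul c1.continuousOn
  rw [intervalIntegral.integral_add
    ((h.integrable a b ha hb).mul_continuousOn c0.continuousOn) iF1.intervalIntegrable,
    h0 b (by simp), h0 a (by simp)] at e1
  have e2 := intervalIntegral.integral_mul_deriv_eq_deriv_mul (a := a) (b := b) (u := F)
    (v := deriv φ) (fun x hx => h.hasDerivAt x (hsub hx)) (fun x _ => d1 x)
    (h.continuousOn_deriv.mono hsub).intervalIntegrable c2.continuousOn.intervalIntegrable
  rw [h1 b (by simp), h1 a (by simp)] at e2
  linear_combination e2 - e1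

theorem exists_isSecondPrimitive {k : ℝ → ℂ} (hk : LocallyIntegrableOn k (Ioi 0)) :
    ∃ K K1, IsSecondPrimitive K K1 k := by
  have hi : ∀ a b, 0 < a → 0 < b → IntervalIntegrable k volume a b := fun a b ha hb =>
    intervalIntegrable_of_locallyIntegrableOn hk ha hb
  have hsub : ∀ a b, 0 < a → 0 < b →
      (∫ t in (1 : ℝ)..b, k t) - (∫ t in (1 : ℝ)..a, k t) = ∫ t in a..b, k t := fun a b ha hb =>
    intervalIntegral.integral_interval_sub_left (hi 1 b one_pos hb) (hi 1 a one_pos ha)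
  have hc : ContinuousOn (fun x => ∫ t in (1 : ℝ)..x, k t) (Ioi 0) :=
    continuousOn_of_sub_eq_integral hi hsub
  refine ⟨fun x => ∫ s in (1 : ℝ)..x, ∫ t in (1 : ℝ)..s, k t, fun x => ∫ t in (1 : ℝ)..x, k t,
    fun x hx => ?_, hi, hsub⟩
  exact intervalIntegral.integral_hasDerivAt_right
    (hc.mono (uIcc_subset_Ioi_zero one_pos hx)).intervalIntegrable
    (hc.stronglyMeasurableAtFilter isOpen_Ioi x hx) (hc.continuousAt (Ioi_mem_nhds hx))

/-- `F` is continuously differentiable on `]0, ∞[`, with absolutely continuous derivative `F1`, and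
`-F'' + c x⁻² F = g`. -/
def SolvesODE (c : ℂ) (F F1 g : ℝ → ℂ) : Prop :=
  IsSecondPrimitive F F1 fun x => c / (x : ℂ) ^ 2 * F x - g x

theorem continuousOn_const_div_sq (c : ℂ) : ContinuousOn (fun x : ℝ => c / (x : ℂ) ^ 2) (Ioi 0) := by
  refine continuousOn_const.div (by fun_prop) fun x hx => ?_
  exact pow_ne_zero _ (by exact_mod_cast (ne_of_gt hx))

theorem formalL_eq (m : ℂ) (φ : ℝ → ℂ) (x : ℝ) :
    formalL m φ x = -(deriv (deriv φ) x) + (m ^ 2 - 1 / 4) / (x : ℂ) ^ 2 * φ x := by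
  simp [formalL, iteratedDeriv_succ, iteratedDeriv_zero]

theorem locallyIntegrableOn_div_sq_mul_sub {f g : ℝ → ℂ} (c : ℂ)
    (hf : LocallyIntegrableOn f (Ioi 0)) (hg : LocallyIntegrableOn g (Ioi 0)) :
    LocallyIntegrableOn (fun x : ℝ => c / (x : ℂ) ^ 2 * f x - g x) (Ioi 0) :=
  (hf.continuousOn_mul (continuousOn_const_div_sq c) isOpen_Ioi.isLocallyClosed).sub hg

theorem integral_mul_formalL {f φ : ℝ → ℂ} (m : ℂ) (hf : LocallyIntegrableOn f (Ioi 0))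
    (hφ : IsTest φ) :
    ∫ x, f x * formalL m φ x ∂halfLine =
      ∫ x, (m ^ 2 - 1 / 4) / (x : ℂ) ^ 2 * f x * φ x ∂halfLine -
        ∫ x, f x * deriv (deriv φ) x ∂halfLine := by
  have hV := hf.continuousOn_mul
    (continuousOn_const_div_sq (m ^ 2 - 1 / 4)) isOpen_Ioi.isLocallyClosed
  rw [← integral_sub (hφ.integrable_mul hV) (hφ.deriv.deriv.integrable_mul hf)]
  refine integral_congr_ae (Eventually.of_forall fun x => ?_)
  simp only [formalL_eq]
  ring

/-- Every element of the maximal domain has a continuously differentiable representative with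
absolutely continuous derivative. -/
theorem exists_solvesODE {m : ℂ} {p : L2 × L2} (hp : p ∈ maxGraph m) :
    ∃ F F1, p.1 =ᵐ[halfLine] F ∧ SolvesODE (m ^ 2 - 1 / 4) F F1 p.2 := by
  have hf := locallyIntegrableOn_of_memLp (Lp.memLp p.1)
  have hg := locallyIntegrableOn_of_memLp (Lp.memLp p.2)
  have hk := locallyIntegrableOn_div_sq_mul_sub (m ^ 2 - 1 / 4) hf hg
  have hV := hf.continuousOn_mul
    (continuousOn_const_div_sq (m ^ 2 - 1 / 4)) isOpen_Ioi.isLocallyClosed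
  obtain ⟨K, K1, hK⟩ := exists_isSecondPrimitive hk
  have hKl : LocallyIntegrableOn K (Ioi 0) :=
    hK.continuousOn.locallyIntegrableOn measurableSet_Ioi
  -- `K` is a classical second primitive of what the equation prescribes as the weak second
  -- derivative of `p.1`, so `p.1 - K` has zero second weak derivative.
  obtain ⟨A, B, hAB⟩ := exists_ae_eq_affine (hf.sub hKl) fun φ hφ => by
    have e1 := hK.integral_mul_isTest hφ
    have e2 := hp φ hφ
    have e3 := integral_sub (hφ.integrable_mul hV) (hφ.integrable_mul hg)
    rw [integral_mul_formalL m hf hφ] at e2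
    have e4 : ∫ x, ((m ^ 2 - 1 / 4) / (x : ℂ) ^ 2 * p.1 x - p.2 x) * φ x ∂halfLine =
        ∫ x, ((m ^ 2 - 1 / 4) / (x : ℂ) ^ 2 * p.1 x * φ x - p.2 x * φ x) ∂halfLine :=
      integral_congr_ae (Eventually.of_forall fun x => by ring)
    have e5 : ∫ x, (p.1 - K : ℝ → ℂ) x * deriv (deriv φ) x ∂halfLine =
        ∫ x, p.1 x * deriv (deriv φ) x ∂halfLine - ∫ x, K x * deriv (deriv φ) x ∂halfLine := by
      rw [← integral_sub (hφ.deriv.deriv.integrable_mul hf) (hφ.deriv.deriv.integrable_mul hKl)]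
      exact integral_congr_ae (Eventually.of_forall fun x => by simp only [Pi.sub_apply]; ring)
    rw [e5]
    linear_combination -e1 - e2 - e4 - e3
  have haff : IsSecondPrimitive (fun x : ℝ => A + B * x) (fun _ => B) (fun _ => 0) := by
    refine IsSecondPrimitive.of_hasDerivAt (fun x _ => ?_) (fun x _ => hasDerivAt_const x B)
      continuousOn_const
    simpa using ((Complex.ofRealCLM.hasDerivAt (x := x)).const_mul B).const_add A
  have hF := hK.add haff
  have hae : p.1 =ᵐ[halfLine] fun x => K x + (A + B * x) := by
    filter_upwards [hAB] with x hx
    rw [← hx, Pi.sub_apply]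
    ring
  refine ⟨_, _, hae, hF.congr_ae ?_⟩
  filter_upwards [hae] with x hx
  rw [add_zero, hx]

/-- Two integrations by parts against a test function; with `exists_solvesODE` this makes the
distributional and the almost everywhere form of the equation interchangeable. -/
theorem mem_maxGraph_of_solvesODE {m : ℂ} {p : L2 × L2} {F F1 : ℝ → ℂ} (h1 : p.1 =ᵐ[halfLine] F)
    (hF : SolvesODE (m ^ 2 - 1 / 4) F F1 p.2) : p ∈ maxGraph m := by
  intro φ hφ
  have hf := locallyIntegrableOn_of_memLp (Lp.memLp p.1)
  have hg := locallyIntegrableOn_of_memLp (Lp.memLp p.2)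
  have hV := hf.continuousOn_mul
    (continuousOn_const_div_sq (m ^ 2 - 1 / 4)) isOpen_Ioi.isLocallyClosed
  rw [integral_mul_formalL m hf hφ]
  have e1 := hF.integral_mul_isTest hφ
  have e2 : ∫ x, p.1 x * deriv (deriv φ) x ∂halfLine = ∫ x, F x * deriv (deriv φ) x ∂halfLine := by
    refine integral_congr_ae ?_
    filter_upwards [h1] with x hx
    rw [hx]
  have e3 : ∫ x, ((m ^ 2 - 1 / 4) / (x : ℂ) ^ 2 * F x - p.2 x) * φ x ∂halfLine =
      ∫ x, (m ^ 2 - 1 / 4) / (x : ℂ) ^ 2 * p.1 x * φ x ∂halfLine -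
        ∫ x, p.2 x * φ x ∂halfLine := by
    rw [← integral_sub (hφ.integrable_mul hV) (hφ.integrable_mul hg)]
    refine integral_congr_ae ?_
    filter_upwards [h1] with x hx
    rw [hx]
    ring
  rw [e2, e1, e3]
  ring

/-! ### Green's formula on the half-line -/

theorem integrableOn_norm_sq_of_memLp {f : ℝ → ℂ} (hf : MemLp f 2 halfLine) :
    IntegrableOn (fun x => ‖f x‖ ^ 2) (Ioi 0) :=
  hf.integrable_norm_pow (by norm_num)

theorem integrableOn_Ioi_comp_add_one {S : ℝ → ℝ} (hS : IntegrableOn S (Ioi 0)) :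
    IntegrableOn (fun x => S (x + 1)) (Ioi 0) := by
  have h := (integrable_indicator_iff measurableSet_Ioi).2 hS
  have h1 := (h.comp_add_right 1).integrableOn (s := Ioi 0)
  refine h1.congr_fun (fun x hx => ?_) measurableSet_Ioi
  have hx0 : 0 < x := hx
  exact indicator_of_mem (show x + 1 ∈ Ioi 0 by rw [mem_Ioi]; linarith) S

/-- Taylor's formula on `[x, x + 1]` with integral remainder, solved for the first derivative. It
trades the derivative, about which nothing is known at infinity, for values and the second
derivative. -/
theorem IsSecondPrimitive.deriv_eq {H H1 k : ℝ → ℂ} (h : IsSecondPrimitive H H1 k) {x : ℝ}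
    (hx : 0 < x) :
    H1 x = H (x + 1) - H x - ∫ t in x..(x + 1), k t * ((x + 1 - t : ℝ) : ℂ) := by
  have hx1 : 0 < x + 1 := by linarith
  have hsub := uIcc_subset_Ioi_zero hx hx1
  have hq : ∀ t : ℝ, HasDerivAt (fun t : ℝ => ((x + 1 - t : ℝ) : ℂ)) (-1) t := fun t => by
    simpa using (((hasDerivAt_id t).const_sub (x + 1)).ofReal_comp)
  have e := h.integral_deriv_mul hx hx1 (q' := fun _ => -1) (fun t _ => hq t) continuousOn_const
  have hF1 := (h.continuousOn_deriv.mono hsub).intervalIntegrable (μ := volume)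
  have hc : Continuous fun t : ℝ => ((x + 1 - t : ℝ) : ℂ) := by fun_prop
  rw [intervalIntegral.integral_add
    ((h.integrable _ _ hx hx1).mul_continuousOn hc.continuousOn) (hF1.mul_const _),
    intervalIntegral.integral_mul_const, intervalIntegral.integral_eq_sub_of_hasDerivAt
    (fun t ht => h.hasDerivAt t (hsub ht)) hF1] at e
  simp only [sub_self, Complex.ofReal_zero, mul_zero, add_sub_cancel_left, Complex.ofReal_one,
    mul_one] at e
  linear_combination e

/-- On `[1, ∞[` the potential is bounded by `‖c‖`, and `t ≤ 1 + t²` bounds the Taylor remainder over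
a unit interval by `‖c‖ + 1` plus the full integral of `‖c‖ ‖H‖² + ‖h‖²`, uniformly in `x`. -/
theorem SolvesODE.norm_deriv_le {c : ℂ} {H H1 h : ℝ → ℂ} (hH : SolvesODE c H H1 h)
    (h2 : MemLp H 2 halfLine) (h3 : MemLp h 2 halfLine) :
    ∃ C : ℝ, 0 ≤ C ∧ ∀ x, 1 ≤ x → ‖H1 x‖ ≤ ‖H (x + 1)‖ + ‖H x‖ + C := by
  have iH := integrableOn_norm_sq_of_memLp h2
  have ih := integrableOn_norm_sq_of_memLp h3
  have iB : IntegrableOn (fun t => ‖c‖ * ‖H t‖ ^ 2 + ‖h t‖ ^ 2) (Ioi 0) := (iH.const_mul _).add ih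
  refine ⟨(‖c‖ + 1) + ∫ t in Ioi 0, (‖c‖ * ‖H t‖ ^ 2 + ‖h t‖ ^ 2), ?_, fun x hx => ?_⟩
  · have : 0 ≤ ∫ t in Ioi (0 : ℝ), (‖c‖ * ‖H t‖ ^ 2 + ‖h t‖ ^ 2) :=
      integral_nonneg fun t => by positivity
    positivity
  have hx0 : 0 < x := by linarith
  rw [hH.deriv_eq hx0]
  refine (norm_sub_le _ _).trans (add_le_add (norm_sub_le _ _) ?_)
  have hle : x ≤ x + 1 := by linarith
  have hsub : Ioc x (x + 1) ⊆ Ioi 0 := fun t ht => hx0.trans ht.1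
  have iB' : IntervalIntegrable (fun t => ‖c‖ * ‖H t‖ ^ 2 + ‖h t‖ ^ 2) volume x (x + 1) :=
    (intervalIntegrable_iff_integrableOn_Ioc_of_le hle).2 (iB.mono_set hsub)
  have i1 : IntervalIntegrable (fun t => (‖c‖ + 1) + (‖c‖ * ‖H t‖ ^ 2 + ‖h t‖ ^ 2)) volume x (x + 1) :=
    intervalIntegrable_const.add iB'
  have key : ‖∫ t in x..(x + 1), (c / (t : ℂ) ^ 2 * H t - h t) * ((x + 1 - t : ℝ) : ℂ)‖ ≤
      ∫ t in x..(x + 1), ((‖c‖ + 1) + (‖c‖ * ‖H t‖ ^ 2 + ‖h t‖ ^ 2)) := by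
    refine intervalIntegral.norm_integral_le_of_norm_le hle
      (Eventually.of_forall fun t ht => ?_) i1
    have ht1 : 1 ≤ t := hx.trans ht.1.le
    have n1 : ‖((x + 1 - t : ℝ) : ℂ)‖ ≤ 1 := by
      rw [Complex.norm_real, Real.norm_eq_abs, abs_of_nonneg (by linarith [ht.2])]
      linarith [ht.1]
    have n2 : ‖c / (t : ℂ) ^ 2‖ ≤ ‖c‖ := by
      rw [norm_div, norm_pow, Complex.norm_real, Real.norm_eq_abs, abs_of_pos (by linarith)]
      exact div_le_self (norm_nonneg _) (one_le_pow₀ ht1)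
    have n3 : ‖c / (t : ℂ) ^ 2 * H t - h t‖ ≤ ‖c‖ * ‖H t‖ + ‖h t‖ := by
      refine (norm_sub_le _ _).trans (add_le_add_left ?_ _)
      rw [norm_mul]
      exact mul_le_mul_of_nonneg_right n2 (norm_nonneg _)
    have n4 : ‖H t‖ ≤ 1 + ‖H t‖ ^ 2 := by nlinarith [sq_nonneg (‖H t‖ - 1), norm_nonneg (H t)]
    have n5 : ‖h t‖ ≤ 1 + ‖h t‖ ^ 2 := by nlinarith [sq_nonneg (‖h t‖ - 1), norm_nonneg (h t)]
    rw [norm_mul]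
    calc _ ≤ (‖c‖ * ‖H t‖ + ‖h t‖) * 1 :=
          mul_le_mul n3 n1 (norm_nonneg _) (by positivity)
      _ ≤ (‖c‖ * (1 + ‖H t‖ ^ 2) + (1 + ‖h t‖ ^ 2)) := by
          rw [mul_one]
          exact add_le_add (mul_le_mul_of_nonneg_left n4 (norm_nonneg _)) n5
      _ = _ := by ring
  refine key.trans ?_
  rw [intervalIntegral.integral_add intervalIntegrable_const iB', intervalIntegral.integral_const,
    intervalIntegral.integral_of_le hle]
  have : ∫ t in Ioc x (x + 1), (‖c‖ * ‖H t‖ ^ 2 + ‖h t‖ ^ 2) ≤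
      ∫ t in Ioi 0, (‖c‖ * ‖H t‖ ^ 2 + ‖h t‖ ^ 2) :=
    setIntegral_mono_set iB (Eventually.of_forall fun t => by positivity)
      (Eventually.of_forall hsub)
  simp only [add_sub_cancel_left, one_smul]
  linarith

/-- By the bound on derivatives, the Wronskian is at most quadratic in values of `F` and `H` at `x`
and `x + 1`, plus a linear term. A nonzero limit would therefore bound a positive constant by an
integrable function near infinity. -/
theorem SolvesODE.wronskian_atTop {c : ℂ} {F F1 f H H1 h : ℝ → ℂ} {L : ℂ}
    (hF : SolvesODE c F F1 f) (hH : SolvesODE c H H1 h)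
    (f1 : MemLp F 2 halfLine) (f2 : MemLp f 2 halfLine)
    (h1 : MemLp H 2 halfLine) (h2 : MemLp h 2 halfLine)
    (hL : Tendsto (fun x => F x * H1 x - F1 x * H x) atTop (𝓝 L)) : L = 0 := by
  by_contra hne
  have hpos : 0 < ‖L‖ := norm_pos_iff.2 hne
  obtain ⟨C1, hC1, hF1⟩ := hF.norm_deriv_le f1 f2
  obtain ⟨C2, hC2, hH1⟩ := hH.norm_deriv_le h1 h2
  set δ := ‖L‖ / 2 with hδ
  have hδ0 : 0 < δ := by positivity
  have hev : ∀ᶠ x in atTop, δ < ‖F x * H1 x - F1 x * H x‖ :=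
    hL.norm.eventually_const_lt (by rw [hδ]; linarith)
  obtain ⟨R0, hR0⟩ := eventually_atTop.1 hev
  set R := max R0 1 with hR
  set S : ℝ → ℝ := fun x => ‖F x‖ ^ 2 + ‖H x‖ ^ 2 with hS
  have iS : IntegrableOn S (Ioi 0) :=
    (integrableOn_norm_sq_of_memLp f1).add (integrableOn_norm_sq_of_memLp h1)
  have iS1 := integrableOn_Ioi_comp_add_one iS
  set C := C1 + C2 with hC
  have hC0 : 0 ≤ C := by positivity
  -- The Wronskian exceeds `δ`. Half of `δ` absorbs the linear term through `C (u + v) ≤ δ / 2 + (C²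
  -- / δ) S`, which is the origin of the coefficient; the products of values account for `2 S x + S
  -- (x + 1)`.
  have hbound : ∀ x ∈ Ioi R, ‖δ / 2‖ ≤ (2 + C ^ 2 / δ) * S x + S (x + 1) := by
    intro x hx
    have hxR : R < x := hx
    have hx1 : 1 ≤ x := (le_max_right R0 1).trans hxR.le
    have hlt := hR0 x ((le_max_left R0 1).trans hxR.le)
    rw [Real.norm_eq_abs, abs_of_pos (by positivity)]
    have a1 : ‖F x * H1 x - F1 x * H x‖ ≤ ‖F x‖ * (‖H (x + 1)‖ + ‖H x‖ + C2) +
        (‖F (x + 1)‖ + ‖F x‖ + C1) * ‖H x‖ := by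
      refine (norm_sub_le _ _).trans ?_
      rw [norm_mul, norm_mul]
      exact add_le_add (mul_le_mul_of_nonneg_left (hH1 x hx1) (norm_nonneg _))
        (mul_le_mul_of_nonneg_right (hF1 x hx1) (norm_nonneg _))
    have hSx : S x = ‖F x‖ ^ 2 + ‖H x‖ ^ 2 := rfl
    have hSx1 : S (x + 1) = ‖F (x + 1)‖ ^ 2 + ‖H (x + 1)‖ ^ 2 := rfl
    have p1 := norm_nonneg (F x)
    have p2 := norm_nonneg (H x)
    have p3 := norm_nonneg (F (x + 1))
    have p4 := norm_nonneg (H (x + 1))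
    generalize ‖F x‖ = u at *
    generalize ‖H x‖ = v at *
    generalize ‖F (x + 1)‖ = u' at *
    generalize ‖H (x + 1)‖ = v' at *
    have q1 : u * v' + u' * v + 2 * (u * v) ≤ 2 * S x + S (x + 1) := by
      rw [hSx, hSx1]
      linarith [sq_nonneg (u - v'), sq_nonneg (u' - v), sq_nonneg (u - v), sq_nonneg u,
        sq_nonneg v, sq_nonneg u', sq_nonneg v']
    have q2 : u * C2 + C1 * v ≤ C * (u + v) := by
      rw [hC]
      linarith [mul_nonneg p1 hC1, mul_nonneg p2 hC2]
    have q3 : C * (u + v) ≤ δ / 2 + C ^ 2 / δ * S x := by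
      have q4 : C ^ 2 / δ * S x = δ * ((C / δ) ^ 2 * S x) := by field_simp
      have q5 : C * (u + v) = δ * ((C / δ) * (u + v)) := by field_simp
      rw [q4, q5, hSx]
      have q6 : C / δ * (u + v) ≤ 1 / 2 + (C / δ) ^ 2 * (u ^ 2 + v ^ 2) := by
        linarith [sq_nonneg (C / δ * (u + v) - 1), sq_nonneg (C / δ * (u - v))]
      calc δ * (C / δ * (u + v)) ≤ δ * (1 / 2 + (C / δ) ^ 2 * (u ^ 2 + v ^ 2)) :=
            mul_le_mul_of_nonneg_left q6 hδ0.le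
        _ = _ := by ring
    linarith
  have i0 : IntegrableOn (fun x => (2 + C ^ 2 / δ) * S x + S (x + 1)) (Ioi 0) :=
    (iS.const_mul _).add iS1
  have iR : IntegrableOn (fun x => (2 + C ^ 2 / δ) * S x + S (x + 1)) (Ioi R) :=
    i0.mono_set (Ioi_subset_Ioi (zero_le_one.trans (le_max_right _ _)))
  have ic : IntegrableOn (fun _ : ℝ => δ / 2) (Ioi R) :=
    Integrable.mono' iR aestronglyMeasurable_const
      ((ae_restrict_iff' measurableSet_Ioi).2 (Eventually.of_forall hbound))
  rw [integrableOn_const_iff] at ic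
  simp [hδ0.ne'] at ic

/-- Green's formula: the boundary form at the origin. -/
theorem SolvesODE.tendsto_wronskian {c : ℂ} {F F1 f H H1 h : ℝ → ℂ}
    (hF : SolvesODE c F F1 f) (hH : SolvesODE c H H1 h)
    (f1 : MemLp F 2 halfLine) (f2 : MemLp f 2 halfLine)
    (h1 : MemLp H 2 halfLine) (h2 : MemLp h 2 halfLine) :
    Tendsto (fun x => F x * H1 x - F1 x * H x) (𝓝[>] 0)
      (𝓝 (∫ x, (F x * h x - f x * H x) ∂halfLine)) := by
  -- Extended by zero, the integrand in Green's formula is integrable on the whole line. Its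
  -- primitive is continuous at `0` and has a limit at infinity, so the Wronskian has limits at both
  -- ends; the one at infinity is zero.
  set r : ℝ → ℂ := (Ioi 0).indicator fun x => f x * H x - F x * h x with hr
  have ir0 : Integrable (fun x => f x * H x - F x * h x) halfLine :=
    (f2.integrable_mul h1).sub (f1.integrable_mul h2)
  have ir : Integrable r := (integrable_indicator_iff measurableSet_Ioi).2 ir0
  have hc := intervalIntegral.continuous_primitive (fun a b => ir.intervalIntegrable) 0
  have hW : ∀ a b, 0 < a → 0 < b → (F b * H1 b - F1 b * H b) - (F a * H1 a - F1 a * H a) =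
      (∫ t in (0 : ℝ)..b, r t) - ∫ t in (0 : ℝ)..a, r t := by
    intro a b ha hb
    rw [IsSecondPrimitive.wronskian_sub hF hH ha hb, intervalIntegral.integral_interval_sub_left
      ir.intervalIntegrable ir.intervalIntegrable]
    refine intervalIntegral.integral_congr fun x hx => ?_
    simp only [hr, indicator_of_mem (uIcc_subset_Ioi_zero ha hb hx)]
    ring
  have hinf : Tendsto (fun x => F x * H1 x - F1 x * H x) atTop
      (𝓝 ((F 1 * H1 1 - F1 1 * H 1) + (∫ t in Ioi 0, r t) - ∫ t in (0 : ℝ)..1, r t)) := by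
    have t1 := intervalIntegral_tendsto_integral_Ioi 0 ir.integrableOn (b := id) tendsto_id
    refine ((tendsto_const_nhds.add t1).sub_const _).congr' ?_
    filter_upwards [eventually_gt_atTop 0] with x hx
    simp only [id]
    linear_combination -hW 1 x one_pos hx
  have h0 := hF.wronskian_atTop hH f1 f2 h1 h2 hinf
  have hI : ∫ t in Ioi 0, r t = -∫ x, (F x * h x - f x * H x) ∂halfLine := by
    rw [← integral_neg, hr, setIntegral_indicator measurableSet_Ioi, inter_self]
    exact integral_congr_ae (Eventually.of_forall fun x => by ring)
  have hlim : Tendsto (fun x => F x * H1 x - F1 x * H x) (𝓝[>] 0)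
      (𝓝 ((F 1 * H1 1 - F1 1 * H 1) + (∫ t in (0 : ℝ)..0, r t) - ∫ t in (0 : ℝ)..1, r t)) := by
    have t1 := (hc.tendsto 0).mono_left (nhdsWithin_le_nhds (s := Ioi 0))
    refine ((tendsto_const_nhds.add t1).sub_const _).congr' ?_
    filter_upwards [self_mem_nhdsWithin] with x hx
    linear_combination -hW 1 x one_pos hx
  convert hlim using 2
  rw [intervalIntegral.integral_same]
  linear_combination hI - h0

/-! ### The boundary form -/

/-- The bilinear pairing `(f, g) ↦ ∫ f g` on `L²`. -/
noncomputable def pairing : L2 →ₗ[ℂ] L2 →ₗ[ℂ] ℂ :=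
  LinearMap.mk₂ ℂ (fun f g => ∫ x, f x * g x ∂halfLine)
    (fun f f' g => by
      rw [← integral_add (integrable_pair f (Lp.memLp g)) (integrable_pair f' (Lp.memLp g))]
      refine integral_congr_ae ?_
      filter_upwards [Lp.coeFn_add f f'] with x hx
      rw [hx, Pi.add_apply, add_mul])
    (fun a f g => by
      rw [smul_eq_mul, ← integral_const_mul]
      refine integral_congr_ae ?_
      filter_upwards [Lp.coeFn_smul a f] with x hx
      rw [hx, Pi.smul_apply, smul_eq_mul, mul_assoc])
    (fun f g g' => by
      rw [← integral_add (integrable_pair f (Lp.memLp g)) (integrable_pair f (Lp.memLp g'))]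
      refine integral_congr_ae ?_
      filter_upwards [Lp.coeFn_add g g'] with x hx
      rw [hx, Pi.add_apply, mul_add])
    (fun a f g => by
      rw [smul_eq_mul, ← integral_const_mul]
      refine integral_congr_ae ?_
      filter_upwards [Lp.coeFn_smul a g] with x hx
      rw [hx, Pi.smul_apply, smul_eq_mul]
      ring)

theorem pairing_apply (f g : L2) : pairing f g = ∫ x, f x * g x ∂halfLine := rfl

theorem pairing_star (f g : L2) : pairing (star f) g = inner ℂ f g := by
  rw [pairing_apply, L2.inner_def]
  refine integral_congr_ae ?_
  filter_upwards [Lp.coeFn_star f] with x hx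
  rw [hx]
  simp [mul_comm]

/-- The functional `q ↦ ∫ (p.1 q.2 - p.2 q.1)`. -/
noncomputable def bdry (p : L2 × L2) : L2 × L2 →ₗ[ℂ] ℂ :=
  (pairing p.1).comp (LinearMap.snd ℂ L2 L2) - (pairing p.2).comp (LinearMap.fst ℂ L2 L2)

theorem bdry_apply (p q : L2 × L2) : bdry p q = pairing p.1 q.2 - pairing p.2 q.1 := rfl

theorem bdry_eq_integral {p q : L2 × L2} {F H : ℝ → ℂ} (hF : p.1 =ᵐ[halfLine] F)
    (hH : q.1 =ᵐ[halfLine] H) :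
    bdry p q = ∫ x, (F x * q.2 x - p.2 x * H x) ∂halfLine := by
  rw [bdry_apply, pairing_apply, pairing_apply, ← integral_sub
    (integrable_pair p.1 (Lp.memLp q.2)) (integrable_pair p.2 (Lp.memLp q.1))]
  refine integral_congr_ae ?_
  filter_upwards [hF, hH] with x h1 h2
  rw [h1, h2]

theorem tendsto_wronskian_bdry {c : ℂ} {p q : L2 × L2} {F F1 H H1 : ℝ → ℂ}
    (hp : p.1 =ᵐ[halfLine] F) (hF : SolvesODE c F F1 p.2)
    (hq : q.1 =ᵐ[halfLine] H) (hH : SolvesODE c H H1 q.2) :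
    Tendsto (fun x => F x * H1 x - F1 x * H x) (𝓝[>] 0) (𝓝 (bdry p q)) := by
  rw [bdry_eq_integral hp hq]
  exact hF.tendsto_wronskian hH ((Lp.memLp p.1).ae_eq hp) (Lp.memLp _)
    ((Lp.memLp q.1).ae_eq hq) (Lp.memLp _)

/-! ### Graphs and adjoints -/

/-- Complex conjugation of a pair of elements of `L²`. -/
noncomputable def conjPair (p : L2 × L2) : L2 × L2 := (star p.1, star p.2)

theorem conjPair_conjPair (p : L2 × L2) : conjPair (conjPair p) = p := by
  simp [conjPair]

/-- Conjugating the first argument turns the bilinear form into the sesquilinear one that defines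
adjoints, so adjoints of graphs become orthogonals for `bdry`. -/
theorem bdry_conjPair (p q : L2 × L2) :
    bdry (conjPair p) q = inner ℂ p.1 q.2 - inner ℂ p.2 q.1 := by
  rw [bdry_apply, conjPair, pairing_star, pairing_star]

theorem mem_adjoint_iff_bdry (g : Submodule ℂ (L2 × L2)) (x : L2 × L2) :
    x ∈ g.adjoint ↔ ∀ q ∈ g, bdry (conjPair q) x = 0 := by
  rw [Submodule.mem_adjoint_iff]
  constructor
  · rintro h ⟨a, b⟩ hq
    rw [bdry_conjPair]
    linear_combination -h a b hq
  · intro h a b hq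
    have := h _ hq
    rw [bdry_conjPair] at this
    linear_combination -this

theorem bdry_conjPair_swap (p q : L2 × L2) :
    bdry (conjPair q) p = -star (bdry (conjPair p) q) := by
  rw [bdry_conjPair, bdry_conjPair, star_sub, ← inner_conj_symm q.1, ← inner_conj_symm q.2]
  simp only [starRingEnd_apply]
  ring

theorem continuous_bdry (p : L2 × L2) : Continuous (bdry p) := by
  have h : ∀ q, bdry p q = inner ℂ (star p.1) q.2 - inner ℂ (star p.2) q.1 := fun q => by
    have := bdry_conjPair (conjPair p) q
    rwa [conjPair_conjPair] at this
  have : (bdry p : L2 × L2 → ℂ) = fun q => inner ℂ (star p.1) q.2 - inner ℂ (star p.2) q.1 :=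
    funext h
  rw [this]
  fun_prop

/-- In the Hilbert space `L² ⊕ L²` the adjoint graph is the orthogonal complement rotated by `(x, y)
↦ (y, -x)`, up to sign. Doing this twice cancels the rotations and leaves the double orthogonal
complement, which is the closure. -/
theorem closure_eq_adjoint_adjoint (g : Submodule ℂ (L2 × L2)) :
    g.adjoint.adjoint = g.topologicalClosure := by
  set e : (L2 × L2) ≃L[ℂ] WithLp 2 (L2 × L2) := (WithLp.prodContinuousLinearEquiv 2 ℂ L2 L2).symm
  set G : Submodule ℂ (WithLp 2 (L2 × L2)) := g.map e.toLinearEquiv.toLinearMap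
  have horth : ∀ y : L2 × L2, (y.2, -y.1) ∈ g.adjoint ↔ e y ∈ Gᗮ := by
    intro y
    rw [Submodule.mem_adjoint_iff, Submodule.mem_orthogonal]
    constructor
    · rintro h _ ⟨⟨a, b⟩, hab, rfl⟩
      have := h a b hab
      simp only [inner_neg_right, sub_neg_eq_add] at this
      change inner ℂ a y.1 + inner ℂ b y.2 = 0
      rw [add_comm]
      exact this
    · intro h a b hab
      have := h _ ⟨(a, b), hab, rfl⟩
      change inner ℂ a y.1 + inner ℂ b y.2 = 0 at this
      simp only [inner_neg_right, sub_neg_eq_add]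
      rw [add_comm]
      exact this
  have hclos : ∀ x : L2 × L2, x ∈ g.topologicalClosure ↔ e x ∈ Gᗮᗮ := by
    intro x
    rw [Submodule.orthogonal_orthogonal_eq_closure, ← SetLike.mem_coe, ← SetLike.mem_coe,
      Submodule.topologicalClosure_coe, Submodule.topologicalClosure_coe]
    change _ ↔ e.toHomeomorph x ∈ closure (e.toHomeomorph '' (g : Set (L2 × L2)))
    rw [← e.toHomeomorph.image_closure, e.toHomeomorph.injective.mem_set_image]
  ext x
  rw [hclos, Submodule.mem_adjoint_iff, Submodule.mem_orthogonal]
  constructor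
  · intro h u hu
    obtain ⟨y, rfl⟩ := e.surjective u
    have := h y.2 (-y.1) ((horth y).2 hu)
    change inner ℂ y.1 x.1 + inner ℂ y.2 x.2 = 0
    rw [inner_neg_left] at this
    linear_combination -this
  · intro h a b hab
    have := h (e (-b, a)) ((horth (-b, a)).1 (by simpa using hab))
    change inner ℂ (-b) x.1 + inner ℂ a x.2 = 0 at this
    rw [inner_neg_left] at this
    linear_combination -this

theorem mem_graph_domRestrict (m : ℂ) (S : Submodule ℂ L2) (p : L2 × L2) :
    p ∈ ((LMax m).domRestrict S).graph ↔ p.1 ∈ S ∧ p ∈ maxGraph m := by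
  rw [← LMax_graph]
  constructor
  · intro h
    refine ⟨?_, LinearPMap.le_graph_of_le LinearPMap.domRestrict_le h⟩
    exact (LinearPMap.mem_domain_of_mem_graph (x := p.1) (y := p.2) h).1
  · rintro ⟨h1, h2⟩
    have hd : p.1 ∈ (LMax m).domain := LinearPMap.mem_domain_of_mem_graph (y := p.2) h2
    rw [LinearPMap.mem_graph_iff] at h2 ⊢
    obtain ⟨y, hy1, hy2⟩ := h2
    refine ⟨⟨p.1, h1, hd⟩, rfl, ?_⟩
    rw [← hy2]
    exact LinearPMap.domRestrict_apply hy1.symm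

/-! ### The minimal operator as the radical of the boundary form -/

theorem LMin_graph (m : ℂ) :
    (LMin m).graph = ((LMax m).domRestrict testSpace).graph.topologicalClosure :=
  (isClosable_domRestrict m).graph_closure_eq_closure_graph.symm

theorem LMin_le_LMax (m : ℂ) : LMin m ≤ LMax m := by
  refine LinearPMap.le_of_le_graph ?_
  rw [LMin_graph]
  exact Submodule.topologicalClosure_minimal _
    (LinearPMap.le_graph_of_le LinearPMap.domRestrict_le) (LMax_isClosed m)

theorem dense_testSpace : Dense (testSpace : Set L2) := by
  rw [Submodule.dense_iff_topologicalClosure_eq_top, Submodule.topologicalClosure_eq_top_iff,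
    Submodule.eq_bot_iff]
  intro f hf
  rw [Lp.eq_zero_iff_ae_eq_zero]
  refine ae_eq_zero_of_forall_isTest (locallyIntegrableOn_of_memLp (Lp.memLp f)) fun φ hφ => ?_
  have h := (Submodule.mem_orthogonal _ _).1 hf (hφ.star.memLp.toLp _)
    ⟨_, hφ.star, MemLp.coeFn_toLp _⟩
  rw [L2.inner_def] at h
  rw [← h]
  refine integral_congr_ae ?_
  filter_upwards [hφ.star.memLp.coeFn_toLp] with x hx
  rw [hx]
  simp

theorem dense_domain_of_LMin_le {m : ℂ} {T : L2 →ₗ.[ℂ] L2} (hT : LMin m ≤ T) :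
    Dense (T.domain : Set L2) := by
  refine dense_testSpace.mono fun f hf => hT.1 (((LMax m).domRestrict testSpace).le_closure.1 ?_)
  exact ⟨hf, testSpace_le m hf⟩

theorem IsTest.solvesODE {φ : ℝ → ℂ} (hφ : IsTest φ) (m : ℂ) :
    SolvesODE (m ^ 2 - 1 / 4) φ (_root_.deriv φ) (formalL m φ) := by
  have h : IsSecondPrimitive φ (_root_.deriv φ) (_root_.deriv (_root_.deriv φ)) :=
    IsSecondPrimitive.of_hasDerivAt
      (fun x _ => ((hφ.smooth.differentiable (by simp)) x).hasDerivAt)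
      (fun x _ => ((hφ.deriv.smooth.differentiable (by simp)) x).hasDerivAt)
      hφ.deriv.deriv.smooth.continuous.continuousOn
  refine h.congr_ae (Eventually.of_forall fun x => ?_)
  simp only [formalL_eq]
  ring

theorem SolvesODE.congr_ae {c : ℂ} {F F1 g h : ℝ → ℂ} (hF : SolvesODE c F F1 g)
    (hg : g =ᵐ[halfLine] h) : SolvesODE c F F1 h := by
  refine IsSecondPrimitive.congr_ae hF ?_
  filter_upwards [hg] with x hx
  rw [hx]

theorem mem_maxGraph_of_memLp {m : ℂ} {F F1 g : ℝ → ℂ} (hF : MemLp F 2 halfLine)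
    (hg : MemLp g 2 halfLine) (h : SolvesODE (m ^ 2 - 1 / 4) F F1 g) :
    (hF.toLp F, hg.toLp g) ∈ maxGraph m :=
  mem_maxGraph_of_solvesODE hF.coeFn_toLp (h.congr_ae hg.coeFn_toLp.symm)

theorem maxGraph_snd_unique {m : ℂ} {f g g' : L2} (h : (f, g) ∈ maxGraph m)
    (h' : (f, g') ∈ maxGraph m) : g = g' := by
  have := maxGraph_functional m _ ((maxGraph m).sub_mem h h') (by simp)
  simpa [sub_eq_zero] using this

theorem formalL_star {m : ℂ} (hm : star (m ^ 2) = m ^ 2) (φ : ℝ → ℂ) (x : ℝ) :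
    formalL m (fun x => star (φ x)) x = star (formalL m φ x) := by
  have h1 : ∀ φ : ℝ → ℂ, deriv (fun x => star (φ x)) = fun x => star (deriv φ x) :=
    fun φ => funext fun x => deriv.star (f := φ)
  rw [formalL_eq, formalL_eq, h1, h1]
  simp only [star_add, star_neg, star_mul', star_div₀, star_sub, star_pow] at hm ⊢
  rw [hm]
  have h2 : star (x : ℂ) = x := Complex.conj_ofReal x
  simp [h2]

/-- For real `m²` the differential expression commutes with conjugation, so orthogonality to the
graph over a test function `φ` is the distributional equation tested against `star φ`, and `star φ`
runs over all test functions. -/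
theorem adjoint_test_graph {m : ℂ} (hm : star (m ^ 2) = m ^ 2) :
    ((LMax m).domRestrict testSpace).graph.adjoint = maxGraph m := by
  have key : ∀ (p : L2 × L2) (φ : ℝ → ℂ) (hφ : IsTest φ),
      bdry (conjPair (hφ.memLp.toLp φ, (hφ.memLp_formalL m).toLp _)) p =
        ∫ x, p.2 x * star (φ x) ∂halfLine - ∫ x, p.1 x * formalL m (fun x => star (φ x)) x ∂halfLine := by
    intro p φ hφ
    rw [bdry_conjPair, L2.inner_def, L2.inner_def]
    congr 1
    · refine integral_congr_ae ?_
      filter_upwards [hφ.memLp.coeFn_toLp] with x hx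
      simp only [hx]
      simp
    · refine integral_congr_ae ?_
      filter_upwards [(hφ.memLp_formalL m).coeFn_toLp] with x hx
      simp only [hx, formalL_star hm]
      simp
  ext p
  rw [mem_adjoint_iff_bdry]
  constructor
  · intro h φ hφ
    have h1 := h (hφ.star.memLp.toLp _, (hφ.star.memLp_formalL m).toLp _)
      ((mem_graph_domRestrict _ _ _).2 ⟨⟨_, hφ.star, hφ.star.memLp.coeFn_toLp⟩,
        mem_maxGraph_of_memLp hφ.star.memLp (hφ.star.memLp_formalL m) (hφ.star.solvesODE m)⟩)
    rw [key p _ hφ.star] at h1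
    simp only [star_star] at h1
    exact (sub_eq_zero.1 h1).symm
  · rintro hp ⟨a, b⟩ hq
    obtain ⟨⟨φ, hφ, haφ⟩, hq2⟩ := (mem_graph_domRestrict _ _ _).1 hq
    have ha : a = hφ.memLp.toLp φ := by
      refine Lp.ext ?_
      exact haφ.trans hφ.memLp.coeFn_toLp.symm
    subst ha
    have hb : b = (hφ.memLp_formalL m).toLp _ :=
      maxGraph_snd_unique hq2 (mem_maxGraph_of_memLp hφ.memLp (hφ.memLp_formalL m) (hφ.solvesODE m))
    subst hb
    rw [key p φ hφ, hp _ hφ.star, sub_self]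

theorem adjoint_LMin_graph {m : ℂ} (hm : star (m ^ 2) = m ^ 2) :
    (LMin m).graph.adjoint = maxGraph m := by
  rw [← adjoint_test_graph hm, LMin_graph]
  ext x
  rw [mem_adjoint_iff_bdry, mem_adjoint_iff_bdry]
  refine ⟨fun h q hq => h q (Submodule.le_topologicalClosure _ hq), fun h q hq => ?_⟩
  -- An adjoint does not change under closure because each orthogonality condition is closed. Here
  -- `q` sits in the conjugated slot; the skew-symmetry moves it to the slot where continuity is
  -- known.
  have hcl : IsClosed {q | bdry (conjPair q) x = 0} := by
    have : {q | bdry (conjPair q) x = 0} = {q | bdry (conjPair x) q = 0} := by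
      ext q
      simp only [mem_ofPred_eq]
      rw [bdry_conjPair_swap]
      simp
    rw [this]
    exact isClosed_eq (continuous_bdry _) continuous_const
  exact closure_minimal (s := (((LMax m).domRestrict testSpace).graph : Set (L2 × L2))) h hcl hq

theorem LMin_adjoint {m : ℂ} (hm : star (m ^ 2) = m ^ 2) : (LMin m).adjoint = LMax m := by
  refine LinearPMap.eq_of_eq_graph ?_
  rw [LinearPMap.adjoint_graph_eq_graph_adjoint (dense_domain_of_LMin_le le_rfl),
    adjoint_LMin_graph hm, LMax_graph]

theorem conjPair_mem_maxGraph {m : ℂ} (hm : star (m ^ 2) = m ^ 2) {p : L2 × L2}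
    (hp : p ∈ maxGraph m) : conjPair p ∈ maxGraph m := by
  obtain ⟨F, F1, h1, h2⟩ := exists_solvesODE hp
  refine mem_maxGraph_of_solvesODE (F := fun x => star (F x)) (F1 := fun x => star (F1 x)) ?_ ?_
  · filter_upwards [Lp.coeFn_star p.1, h1] with x hx hx'
    rw [conjPair, hx, Pi.star_apply, hx']
  · refine (IsSecondPrimitive.star h2).congr_ae ?_
    filter_upwards [Lp.coeFn_star p.2] with x hx
    rw [conjPair, hx, Pi.star_apply]
    simp only [star_sub, star_mul', star_div₀, star_pow] at hm ⊢
    rw [hm]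
    have h2 : star (x : ℂ) = x := Complex.conj_ofReal x
    simp [h2]

/-- Being closed, `LMin m` is its own double adjoint, hence the adjoint of `LMax m`. The maximal
graph is stable under conjugation, so the conjugation in the orthogonality condition can be dropped.
-/
theorem mem_LMin_graph_iff {m : ℂ} (hm : star (m ^ 2) = m ^ 2) {p : L2 × L2} :
    p ∈ (LMin m).graph ↔ p ∈ maxGraph m ∧ ∀ q ∈ maxGraph m, bdry q p = 0 := by
  have hcl : (LMin m).graph = (maxGraph m).adjoint := by
    rw [← adjoint_LMin_graph hm, closure_eq_adjoint_adjoint, LMin_graph]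
    exact (Submodule.isClosed_topologicalClosure _).submodule_topologicalClosure_eq.symm
  constructor
  · intro h
    refine ⟨LMax_graph m ▸ LinearPMap.le_graph_of_le (LMin_le_LMax m) h, fun q hq => ?_⟩
    rw [hcl, mem_adjoint_iff_bdry] at h
    rw [← conjPair_conjPair q]
    exact h _ (conjPair_mem_maxGraph hm hq)
  · rintro ⟨-, h⟩
    rw [hcl, mem_adjoint_iff_bdry]
    exact fun q hq => h _ (conjPair_mem_maxGraph hm hq)

theorem graph_le_maxGraph {m : ℂ} {T : L2 →ₗ.[ℂ] L2} (hT : T ≤ LMax m) : T.graph ≤ maxGraph m :=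
  LMax_graph m ▸ LinearPMap.le_graph_of_le hT

theorem isSelfAdjoint_iff_graph {T : L2 →ₗ.[ℂ] L2} (hd : Dense (T.domain : Set L2)) :
    IsSelfAdjoint T ↔ T.graph.adjoint = T.graph := by
  rw [LinearPMap.isSelfAdjoint_def, ← LinearPMap.adjoint_graph_eq_graph_adjoint hd]
  exact ⟨fun h => by rw [h], LinearPMap.eq_of_eq_graph⟩

theorem adjoint_anti {g h : Submodule ℂ (L2 × L2)} (hgh : g ≤ h) : h.adjoint ≤ g.adjoint := by
  intro x hx
  rw [mem_adjoint_iff_bdry] at hx ⊢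
  exact fun q hq => hx q (hgh hq)

theorem IsSelfAdjointExtension.le_LMax {m : ℂ} (hm : star (m ^ 2) = m ^ 2) {T : L2 →ₗ.[ℂ] L2}
    (h : IsSelfAdjointExtension m T) : T ≤ LMax m := by
  refine LinearPMap.le_of_le_graph ?_
  rw [← (isSelfAdjoint_iff_graph h.2.dense_domain).1 h.2, LMax_graph, ← adjoint_LMin_graph hm]
  exact adjoint_anti (LinearPMap.le_graph_of_le h.1)

/-- Self-adjointness means that the graph is its own orthogonal. Membership in `maxGraph m` is
automatic, since the adjoint of an extension of `LMin m` lies in `LMax m`; it is recorded because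
boundary values are only available there. -/
theorem isSelfAdjoint_iff_bdry {m : ℂ} (hm : star (m ^ 2) = m ^ 2) {T : L2 →ₗ.[ℂ] L2}
    (h1 : LMin m ≤ T) :
    IsSelfAdjoint T ↔
      ∀ x, x ∈ T.graph ↔ x ∈ maxGraph m ∧ ∀ q ∈ T.graph, bdry (conjPair q) x = 0 := by
  rw [isSelfAdjoint_iff_graph (dense_domain_of_LMin_le h1), SetLike.ext_iff]
  have hle : T.graph.adjoint ≤ maxGraph m := by
    rw [← adjoint_LMin_graph hm]
    exact adjoint_anti (LinearPMap.le_graph_of_le h1)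
  refine forall_congr' fun x => ?_
  rw [mem_adjoint_iff_bdry]
  constructor
  · exact fun h => ⟨fun hx => ⟨hle ((mem_adjoint_iff_bdry _ _).2 (h.2 hx)), h.2 hx⟩, fun hx => h.1 hx.2⟩
  · exact fun h => ⟨fun hx => h.2 ⟨hle ((mem_adjoint_iff_bdry _ _).2 hx), hx⟩, fun hx => (h.1 hx).2⟩

/-! ### Solutions of the homogeneous equation and boundary functionals -/

/-- `u` solves `u'' = c x⁻² u` on `]0, ∞[` and is square integrable near the origin. -/
structure IsHomSol (c : ℂ) (u u1 : ℝ → ℂ) : Prop where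
  hasDerivAt : ∀ x, 0 < x → HasDerivAt u (u1 x) x
  hasDerivAt_deriv : ∀ x : ℝ, 0 < x → HasDerivAt u1 (c / (x : ℂ) ^ 2 * u x) x
  memLp : MemLp u 2 (volume.restrict (Ioc (0 : ℝ) 2))

namespace IsHomSol

variable {c : ℂ} {u u1 v v1 : ℝ → ℂ}

theorem add (hu : IsHomSol c u u1) (hv : IsHomSol c v v1) :
    IsHomSol c (fun x => u x + v x) (fun x => u1 x + v1 x) where
  hasDerivAt x hx := (hu.hasDerivAt x hx).add (hv.hasDerivAt x hx)
  hasDerivAt_deriv x hx := by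
    rw [mul_add]
    exact (hu.hasDerivAt_deriv x hx).add (hv.hasDerivAt_deriv x hx)
  memLp := hu.memLp.add hv.memLp

theorem const_mul (hu : IsHomSol c u u1) (a : ℂ) :
    IsHomSol c (fun x => a * u x) (fun x => a * u1 x) where
  hasDerivAt x hx := (hu.hasDerivAt x hx).const_mul a
  hasDerivAt_deriv x hx := by
    rw [mul_left_comm]
    exact (hu.hasDerivAt_deriv x hx).const_mul a
  memLp := hu.memLp.const_mul a

theorem congr (hu : IsHomSol c u u1) (h : EqOn v u (Ioi 0)) : IsHomSol c v u1 where
  hasDerivAt x hx := (hu.hasDerivAt x hx).congr_of_eventuallyEq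
    (h.eventuallyEq_of_mem (Ioi_mem_nhds hx))
  hasDerivAt_deriv x hx := by
    rw [h hx]
    exact hu.hasDerivAt_deriv x hx
  memLp := hu.memLp.ae_eq ((ae_restrict_iff' measurableSet_Ioc).2
    (Eventually.of_forall fun _ hx => (h hx.1).symm))

theorem continuousOn (hu : IsHomSol c u u1) : ContinuousOn u (Ioi 0) :=
  fun x hx => (hu.hasDerivAt x hx).continuousAt.continuousWithinAt

theorem continuousOn_deriv (hu : IsHomSol c u u1) : ContinuousOn u1 (Ioi 0) :=
  fun x hx => (hu.hasDerivAt_deriv x hx).continuousAt.continuousWithinAt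

end IsHomSol

/-! ### Cut-off solutions as elements of the maximal graph -/

theorem contDiff_cutoff : ContDiff ℝ ∞ cutoff :=
  Real.smoothTransition.contDiff.comp (contDiff_const.sub contDiff_id)

theorem cutoff_eq_one {x : ℝ} (hx : x ≤ 1) : cutoff x = 1 :=
  Real.smoothTransition.one_of_one_le (by linarith)

theorem cutoff_eq_zero {x : ℝ} (hx : 2 ≤ x) : cutoff x = 0 :=
  Real.smoothTransition.zero_of_nonpos (by linarith)

theorem deriv_cutoff_of_lt {x : ℝ} (hx : x < 1) : deriv cutoff x = 0 := by
  have h : cutoff =ᶠ[𝓝 x] fun _ => 1 := by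
    filter_upwards [Iio_mem_nhds hx] with y hy using cutoff_eq_one (le_of_lt hy)
  rw [h.deriv_eq, deriv_const]

theorem deriv_cutoff_of_gt {x : ℝ} (hx : 2 < x) : deriv cutoff x = 0 := by
  have h : cutoff =ᶠ[𝓝 x] fun _ => 0 := by
    filter_upwards [Ioi_mem_nhds hx] with y hy using cutoff_eq_zero (le_of_lt hy)
  rw [h.deriv_eq, deriv_const]

theorem deriv_deriv_cutoff_of_lt {x : ℝ} (hx : x < 1) : deriv (deriv cutoff) x = 0 := by
  have h : deriv cutoff =ᶠ[𝓝 x] fun _ => 0 := by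
    filter_upwards [Iio_mem_nhds hx] with y hy using deriv_cutoff_of_lt hy
  rw [h.deriv_eq, deriv_const]

theorem deriv_deriv_cutoff_of_gt {x : ℝ} (hx : 2 < x) : deriv (deriv cutoff) x = 0 := by
  have h : deriv cutoff =ᶠ[𝓝 x] fun _ => 0 := by
    filter_upwards [Ioi_mem_nhds hx] with y hy using deriv_cutoff_of_gt hy
  rw [h.deriv_eq, deriv_const]

theorem memLp_of_continuousOn_of_support {g : ℝ → ℂ} (hg : ContinuousOn g (Ioi 0))
    (h1 : ∀ x, x < 1 → g x = 0) (h2 : ∀ x, 2 < x → g x = 0) : MemLp g 2 halfLine := by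
  have hc : ContinuousOn g (Icc 1 2) := hg.mono fun x hx => zero_lt_one.trans_le hx.1
  have hI : g = (Icc 1 2).indicator g := by
    ext x
    by_cases hx : x ∈ Icc 1 2
    · rw [indicator_of_mem hx]
    · rw [indicator_of_notMem hx]
      rw [mem_Icc, not_and_or, not_le, not_le] at hx
      exact hx.elim (h1 x) (h2 x)
  obtain ⟨C, hC⟩ := isCompact_Icc.exists_bound_of_continuousOn hc
  have hm : MemLp g 2 (volume.restrict (Icc (1 : ℝ) 2)) :=
    MemLp.of_bound (hc.aestronglyMeasurable measurableSet_Icc) C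
      ((ae_restrict_iff' measurableSet_Icc).2 (Eventually.of_forall hC))
  rw [hI]
  exact ((memLp_indicator_iff_restrict measurableSet_Icc).2 hm).restrict _

theorem memLp_cutoff_mul {u : ℝ → ℂ} (hu : MemLp u 2 (volume.restrict (Ioc (0 : ℝ) 2))) :
    MemLp (fun x => (cutoff x : ℂ) * u x) 2 halfLine := by
  have h1 : MemLp (fun x => (cutoff x : ℂ) * u x) 2 (volume.restrict (Ioc (0 : ℝ) 2)) := by
    have hcc : Continuous fun x => (cutoff x : ℂ) :=
      Complex.continuous_ofReal.comp contDiff_cutoff.continuous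
    refine hu.of_le (hcc.aestronglyMeasurable.mul hu.1) (Eventually.of_forall fun x => ?_)
    rw [norm_mul, Complex.norm_real, Real.norm_eq_abs, abs_of_nonneg (show 0 ≤ cutoff x from Real.smoothTransition.nonneg _)]
    exact mul_le_of_le_one_left (norm_nonneg _) (Real.smoothTransition.le_one _)
  have h2 := (memLp_indicator_iff_restrict measurableSet_Ioc).2 h1
  refine (h2.restrict (Ioi 0)).ae_eq ((ae_restrict_iff' measurableSet_Ioi).2
    (Eventually.of_forall fun x hx => ?_))
  by_cases hx2 : x ≤ 2
  · exact indicator_of_mem (show x ∈ Ioc 0 2 from ⟨hx, hx2⟩) _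
  · rw [indicator_of_notMem fun h => hx2 h.2]
    simp [cutoff_eq_zero (le_of_not_ge hx2)]

/-- The class of `ξ u` belongs to the maximal domain. -/
theorem IsHomSol.exists_cutoff {m : ℂ} {u u1 : ℝ → ℂ} (hu : IsHomSol (m ^ 2 - 1 / 4) u u1) :
    ∃ e : L2 × L2, e ∈ maxGraph m ∧ e.1 =ᵐ[halfLine] (fun x => (cutoff x : ℂ) * u x) ∧
      ∃ E E1, e.1 =ᵐ[halfLine] E ∧ SolvesODE (m ^ 2 - 1 / 4) E E1 e.2 ∧
        ∀ x ∈ Ioo (0 : ℝ) 1, E x = u x ∧ E1 x = u1 x := by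
  have hd0 : ∀ x, HasDerivAt (fun x => (cutoff x : ℂ)) ((deriv cutoff x : ℝ) : ℂ) x := fun x =>
    ((contDiff_cutoff.differentiable (by simp)) x).hasDerivAt.ofReal_comp
  have hs1 : ContDiff ℝ ∞ (deriv cutoff) := (contDiff_infty_iff_deriv.1 contDiff_cutoff).2
  have hs2 : ContDiff ℝ ∞ (deriv (deriv cutoff)) := (contDiff_infty_iff_deriv.1 hs1).2
  have hd1 : ∀ x, HasDerivAt (fun x => ((deriv cutoff x : ℝ) : ℂ)) ((deriv (deriv cutoff) x : ℝ) : ℂ) x :=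
    fun x => ((hs1.differentiable (by simp)) x).hasDerivAt.ofReal_comp
  have c0 : Continuous fun x => (cutoff x : ℂ) :=
    Complex.continuous_ofReal.comp contDiff_cutoff.continuous
  have c1 : Continuous fun x => ((deriv cutoff x : ℝ) : ℂ) :=
    Complex.continuous_ofReal.comp hs1.continuous
  have c2 : Continuous fun x => ((deriv (deriv cutoff) x : ℝ) : ℂ) :=
    Complex.continuous_ofReal.comp hs2.continuous
  -- As `u` solves the equation, only the commutator `-(ξ'' u + 2 ξ' u')` survives. It vanishes off
  -- `[1, 2]`, so it is square integrable whatever the behaviour of `u1` at `0`.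
  set g : ℝ → ℂ := fun x =>
    -(((deriv (deriv cutoff) x : ℝ) : ℂ) * u x + 2 * (((deriv cutoff x : ℝ) : ℂ) * u1 x)) with hg
  have hgc : ContinuousOn g (Ioi 0) :=
    ((c2.continuousOn.mul hu.continuousOn).add
      (continuousOn_const.mul (c1.continuousOn.mul hu.continuousOn_deriv))).neg
  have hgm : MemLp g 2 halfLine := by
    refine memLp_of_continuousOn_of_support hgc (fun x hx => ?_) fun x hx => ?_
    · simp [hg, deriv_cutoff_of_lt hx, deriv_deriv_cutoff_of_lt hx]
    · simp [hg, deriv_cutoff_of_gt hx, deriv_deriv_cutoff_of_gt hx]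
  have hode : SolvesODE (m ^ 2 - 1 / 4) (fun x => (cutoff x : ℂ) * u x)
      (fun x => ((deriv cutoff x : ℝ) : ℂ) * u x + (cutoff x : ℂ) * u1 x) g := by
    refine IsSecondPrimitive.of_hasDerivAt (fun x hx => (hd0 x).mul (hu.hasDerivAt x hx))
      (fun x hx => ?_) (((continuousOn_const_div_sq _).mul
        (c0.continuousOn.mul hu.continuousOn)).sub hgc)
    have hd := ((hd1 x).mul (hu.hasDerivAt x hx)).add
      ((hd0 x).mul (hu.hasDerivAt_deriv x hx))
    refine hd.congr_deriv ?_
    simp only [hg]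
    ring
  have hum := memLp_cutoff_mul hu.memLp
  refine ⟨(hum.toLp _, hgm.toLp _), mem_maxGraph_of_memLp hum hgm hode, hum.coeFn_toLp, _, _,
    hum.coeFn_toLp, hode.congr_ae hgm.coeFn_toLp.symm, fun x hx => ?_⟩
  simp [cutoff_eq_one hx.2.le, deriv_cutoff_of_lt hx.2]

namespace IsHomSol

variable {m : ℂ} {u u1 v v1 : ℝ → ℂ}

/-- The element of the graph of the maximal operator given by `ξ u`. -/
noncomputable def pair (hu : IsHomSol (m ^ 2 - 1 / 4) u u1) : L2 × L2 := hu.exists_cutoff.choose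

theorem pair_mem (hu : IsHomSol (m ^ 2 - 1 / 4) u u1) : hu.pair ∈ maxGraph m :=
  hu.exists_cutoff.choose_spec.1

theorem pair_fst (hu : IsHomSol (m ^ 2 - 1 / 4) u u1) :
    hu.pair.1 =ᵐ[halfLine] fun x => (cutoff x : ℂ) * u x :=
  hu.exists_cutoff.choose_spec.2.1

/-- The cut-off is `1` near the origin, so the Wronskian there is that of `u` itself. Hence the
boundary condition of `LExt` is a linear functional on the maximal graph. -/
theorem tendsto_bdry (hu : IsHomSol (m ^ 2 - 1 / 4) u u1) {q : L2 × L2} {H H1 : ℝ → ℂ}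
    (hq : q.1 =ᵐ[halfLine] H) (hH : SolvesODE (m ^ 2 - 1 / 4) H H1 q.2) :
    Tendsto (fun x => u x * H1 x - u1 x * H x) (𝓝[>] 0) (𝓝 (bdry hu.pair q)) := by
  obtain ⟨E, E1, h1, h2, h3⟩ := hu.exists_cutoff.choose_spec.2.2
  refine (tendsto_wronskian_bdry h1 h2 hq hH).congr' ?_
  filter_upwards [Ioo_mem_nhdsGT one_pos] with x hx
  rw [(h3 x hx).1, (h3 x hx).2]

theorem bdry_pair_pair (hu : IsHomSol (m ^ 2 - 1 / 4) u u1) (hv : IsHomSol (m ^ 2 - 1 / 4) v v1)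
    {w : ℂ} (hw : ∀ x, 0 < x → u x * v1 x - u1 x * v x = w) : bdry hu.pair hv.pair = w := by
  obtain ⟨E, E1, h1, h2, h3⟩ := hv.exists_cutoff.choose_spec.2.2
  refine tendsto_nhds_unique (hu.tendsto_bdry h1 h2) (tendsto_const_nhds.congr' ?_)
  filter_upwards [Ioo_mem_nhdsGT one_pos] with x hx
  rw [(h3 x hx).1, (h3 x hx).2, hw x hx.1]

theorem bdry_pair_eq_of_combination {α β : ℂ} {y y1 : ℝ → ℂ}
    (hu : IsHomSol (m ^ 2 - 1 / 4) u u1) (hv : IsHomSol (m ^ 2 - 1 / 4) v v1)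
    (hy : IsHomSol (m ^ 2 - 1 / 4) y y1) (h : ∀ x, 0 < x → y x = α * u x + β * v x)
    {q : L2 × L2} (hq : q ∈ maxGraph m) :
    bdry hy.pair q = α * bdry hu.pair q + β * bdry hv.pair q := by
  obtain ⟨H, H1, h1, h2⟩ := exists_solvesODE hq
  have h' : ∀ x, 0 < x → y1 x = α * u1 x + β * v1 x := fun x hx =>
    (hy.hasDerivAt x hx).unique ((((hu.hasDerivAt x hx).const_mul α).add
      ((hv.hasDerivAt x hx).const_mul β)).congr_of_eventuallyEq
        (by filter_upwards [Ioi_mem_nhds hx] with t ht using h t ht))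
  refine tendsto_nhds_unique (hy.tendsto_bdry h1 h2)
    ((((hu.tendsto_bdry h1 h2).const_mul α).add ((hv.tendsto_bdry h1 h2).const_mul β)).congr' ?_)
  filter_upwards [self_mem_nhdsWithin] with x hx
  rw [h x hx, h' x hx]
  ring

theorem conjPair_pair (hm : star (m ^ 2) = m ^ 2) (hu : IsHomSol (m ^ 2 - 1 / 4) u u1)
    (hv : IsHomSol (m ^ 2 - 1 / 4) v v1) (h : ∀ x, 0 < x → star (u x) = v x) :
    conjPair hu.pair = hv.pair := by
  have h1 : (conjPair hu.pair).1 = hv.pair.1 := by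
    refine Lp.ext ?_
    filter_upwards [Lp.coeFn_star hu.pair.1, hu.pair_fst, hv.pair_fst,
      ae_restrict_mem measurableSet_Ioi] with x h1 h2 h3 hx
    rw [conjPair, h1, h3, Pi.star_apply, h2, star_mul', h x hx]
    congr 1
    exact Complex.conj_ofReal _
  refine Prod.ext h1 ?_
  have h2 := conjPair_mem_maxGraph hm hu.pair_mem
  have h3 := hv.pair_mem
  refine maxGraph_snd_unique (m := m) (f := hv.pair.1) ?_ h3
  rw [← h1]
  exact h2

/-- The graph of the operator `L_m^u`. -/
theorem mem_LExt_graph (hu : IsHomSol (m ^ 2 - 1 / 4) u u1) (p : L2 × L2) :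
    p ∈ (LExt m u).graph ↔ p ∈ maxGraph m ∧ bdry hu.pair p = 0 := by
  rw [LExt, mem_graph_domRestrict, and_comm]
  refine and_congr_right fun hp => ?_
  obtain ⟨H, H1, h1, h2⟩ := exists_solvesODE hp
  have ht := hu.tendsto_bdry h1 h2
  have hev : ∀ᶠ x in 𝓝[>] (0 : ℝ), u x * H1 x - u1 x * H x = u x * deriv H x - deriv u x * H x := by
    filter_upwards [self_mem_nhdsWithin] with x hx
    rw [(h2.hasDerivAt x hx).deriv, (hu.hasDerivAt x hx).deriv]
  constructor
  · rintro ⟨G, hG, hGc, hG0⟩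
    -- The representative supplied by `wronskianKernel` is arbitrary, but two continuous
    -- representatives of one class agree everywhere on the half-line.
    have heq : EqOn G H (Ioi 0) := Measure.eqOn_open_of_ae_eq (hG.symm.trans h1) isOpen_Ioi
      hGc.continuousOn h2.continuousOn
    refine tendsto_nhds_unique ht (hG0.congr' ?_)
    filter_upwards [hev, self_mem_nhdsWithin] with x hx hx0
    rw [hx, heq hx0, (heq.eventuallyEq_of_mem (Ioi_mem_nhds hx0)).deriv_eq]
  · intro h0
    rw [h0] at ht
    exact ⟨H, h1, h2.contDiffOn, ht.congr' hev⟩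

end IsHomSol

/-! ### The two-dimensional space of boundary values -/

theorem bdry_self (p : L2 × L2) : bdry p p = 0 := by
  rw [bdry_apply, pairing_apply, pairing_apply, sub_eq_zero]
  exact integral_congr_ae (Eventually.of_forall fun x => mul_comm _ _)

theorem bdry_swap (p q : L2 × L2) : bdry q p = -bdry p q := by
  rw [bdry_apply, bdry_apply]
  have : ∀ f g : L2, pairing f g = pairing g f := fun f g =>
    integral_congr_ae (Eventually.of_forall fun x => mul_comm _ _)
  rw [this q.1, this q.2]
  ring

/-- Two elements of the maximal graph that span it modulo the minimal graph. -/
structure IsBoundaryBasis (m : ℂ) (a b : L2 × L2) (w : ℂ) : Prop where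
  left_mem : a ∈ maxGraph m
  right_mem : b ∈ maxGraph m
  ne_zero : w ≠ 0
  bdry_left_right : bdry a b = w
  bdry_mul : ∀ p ∈ maxGraph m, ∀ q ∈ maxGraph m,
    bdry p q * w = bdry a p * bdry b q - bdry b p * bdry a q

/-- `W(F,H) W(u,v) = W(u,F) W(v,H) - W(v,F) W(u,H)` is a pointwise algebraic identity. As `W(u,v)`
is the constant `w`, it survives the limit at the origin. -/
theorem IsHomSol.isBoundaryBasis {m : ℂ} {u u1 v v1 : ℝ → ℂ} (hu : IsHomSol (m ^ 2 - 1 / 4) u u1)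
    (hv : IsHomSol (m ^ 2 - 1 / 4) v v1) {w : ℂ} (hw0 : w ≠ 0)
    (hw : ∀ x, 0 < x → u x * v1 x - u1 x * v x = w) : IsBoundaryBasis m hu.pair hv.pair w where
  left_mem := hu.pair_mem
  right_mem := hv.pair_mem
  ne_zero := hw0
  bdry_left_right := hu.bdry_pair_pair hv hw
  bdry_mul p hp q hq := by
    obtain ⟨F, F1, f1, f2⟩ := exists_solvesODE hp
    obtain ⟨H, H1, h1, h2⟩ := exists_solvesODE hq
    refine tendsto_nhds_unique ((tendsto_wronskian_bdry f1 f2 h1 h2).mul_const w)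
      ((((hu.tendsto_bdry f1 f2).mul (hv.tendsto_bdry h1 h2)).sub
        ((hv.tendsto_bdry f1 f2).mul (hu.tendsto_bdry h1 h2))).congr' ?_)
    filter_upwards [self_mem_nhdsWithin] with x hx
    rw [← hw x hx]
    ring

namespace IsBoundaryBasis

variable {m : ℂ} {a b : L2 × L2} {w : ℂ}

theorem bdry_right_left (h : IsBoundaryBasis m a b w) : bdry b a = -w := by
  rw [bdry_swap, h.bdry_left_right]

/-- The form factors through the functionals `bdry a` and `bdry b` and is nondegenerate on their
values, so its radical is their common kernel. -/
theorem mem_LMin_graph (h : IsBoundaryBasis m a b w) (hm : star (m ^ 2) = m ^ 2) {p : L2 × L2} :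
    p ∈ (LMin m).graph ↔ p ∈ maxGraph m ∧ bdry a p = 0 ∧ bdry b p = 0 := by
  rw [mem_LMin_graph_iff hm]
  refine and_congr_right fun hp => ⟨fun H => ⟨H a h.left_mem, H b h.right_mem⟩, fun H q hq => ?_⟩
  have := h.bdry_mul q hq p hp
  rw [H.1, H.2, mul_zero, mul_zero, sub_zero] at this
  exact (mul_eq_zero.1 this).resolve_right h.ne_zero

/-- A pair with prescribed boundary values. -/
theorem exists_bdry_eq (h : IsBoundaryBasis m a b w) (s t : ℂ) :
    ∃ p ∈ maxGraph m, bdry a p = s ∧ bdry b p = t := by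
  have hw := h.ne_zero
  refine ⟨(s / w) • b + (-(t / w)) • a, (maxGraph m).add_mem ((maxGraph m).smul_mem _ h.right_mem)
    ((maxGraph m).smul_mem _ h.left_mem), ?_, ?_⟩
  · rw [map_add, map_smul, map_smul, h.bdry_left_right, bdry_self, smul_eq_mul]
    field_simp
    simp
  · rw [map_add, map_smul, map_smul, h.bdry_right_left, bdry_self, smul_eq_mul, smul_eq_mul]
    field_simp
    simp

end IsBoundaryBasis

/-! ### The operators `H_m` -/

/-- Only `m²` enters the equation, so the extensions attached to `m` and to `-m` can be compared
inside one and the same maximal operator. -/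
theorem maxGraph_congr {k m : ℂ} (h : k ^ 2 = m ^ 2) : maxGraph k = maxGraph m := by
  have : formalL k = formalL m := by
    funext φ x
    rw [formalL, formalL, h]
  ext p
  change (∀ φ, _ → _) ↔ (∀ φ, _ → _)
  rw [this]

theorem LMax_congr {k m : ℂ} (h : k ^ 2 = m ^ 2) : LMax k = LMax m := by
  rw [LMax, LMax, maxGraph_congr h]

theorem LMin_congr {k m : ℂ} (h : k ^ 2 = m ^ 2) : LMin k = LMin m := by
  rw [LMin, LMin, LMax_congr h]

theorem IsBoundaryBasis.symm {m : ℂ} {a b : L2 × L2} {w : ℂ} (h : IsBoundaryBasis m a b w) :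
    IsBoundaryBasis m b a (-w) where
  left_mem := h.right_mem
  right_mem := h.left_mem
  ne_zero := neg_ne_zero.2 h.ne_zero
  bdry_left_right := h.bdry_right_left
  bdry_mul p hp q hq := by linear_combination -h.bdry_mul p hp q hq

/-- The form is alternating, so `ξ ζ_k` lies in the kernel of its own functional. Modulo the minimal
graph that kernel is a line, and `ξ ζ_k` spans it. -/
theorem mem_Hop_graph {m k : ℂ} (hm : star (m ^ 2) = m ^ 2) (hk : k ^ 2 = m ^ 2) {u1 : ℝ → ℂ}
    {b : L2 × L2} {w : ℂ} (hu : IsHomSol (m ^ 2 - 1 / 4) (zeta k) u1)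
    (h : IsBoundaryBasis m hu.pair b w) (p : L2 × L2) :
    p ∈ (Hop k).graph ↔ p ∈ maxGraph m ∧ bdry hu.pair p = 0 := by
  rw [Hop, mem_graph_domRestrict, LMin_congr hk, maxGraph_congr hk, and_comm]
  refine and_congr_right fun hp => ?_
  rw [Submodule.mem_sup]
  have hline : ∀ c : ℂ, (c • hu.pair.1 : L2) =ᵐ[halfLine] fun x => c * ((cutoff x : ℂ) * zeta k x) := by
    intro c
    filter_upwards [Lp.coeFn_smul c hu.pair.1, hu.pair_fst] with x h1 h2
    rw [h1, Pi.smul_apply, h2, smul_eq_mul]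
  constructor
  · rintro ⟨f, hf, g, ⟨c, hc⟩, hfg⟩
    obtain ⟨f', hf'⟩ := LinearPMap.mem_domain_iff.1 hf
    have hg : g = c • hu.pair.1 := Lp.ext (hc.trans (hline c).symm)
    have hf'' := (h.mem_LMin_graph hm).1 hf'
    have hmem := (maxGraph m).add_mem hf''.1 ((maxGraph m).smul_mem c hu.pair_mem)
    have heq : p = (f, f') + c • hu.pair := by
      have h1 : p.1 = ((f, f') + c • hu.pair).1 := by rw [← hfg, hg]; rfl
      refine Prod.ext h1 (maxGraph_snd_unique (m := m) (f := p.1) hp ?_)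
      rw [h1]
      exact hmem
    rw [heq, map_add, map_smul, hf''.2.1, bdry_self]
    simp
  · intro h0
    -- Since `bdry b` takes the value `-w` on `ξ ζ_k`, this multiple cancels the remaining boundary
    -- value of `p`.
    set c := bdry b p / w with hc
    have hq : p + c • hu.pair ∈ (LMin m).graph := by
      rw [h.mem_LMin_graph hm]
      refine ⟨(maxGraph m).add_mem hp ((maxGraph m).smul_mem c hu.pair_mem), ?_, ?_⟩
      · rw [map_add, map_smul, h0, bdry_self]
        simp
      · have := h.ne_zero
        rw [map_add, map_smul, h.bdry_right_left, hc, smul_eq_mul]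
        field_simp
        simp
    refine ⟨(p + c • hu.pair).1, LinearPMap.mem_domain_of_mem_graph hq, (-c) • hu.pair.1,
      ⟨-c, hline (-c)⟩, ?_⟩
    rw [Prod.fst_add, Prod.smul_fst]
    module

/-! ### Self-adjoint extensions -/

theorem bdry_conjPair_conjPair (p q : L2 × L2) :
    bdry (conjPair p) (conjPair q) = star (bdry p q) := by
  have key : ∀ f g : L2, pairing (star f) (star g) = star (pairing f g) := by
    intro f g
    rw [pairing_apply, pairing_apply]
    refine Eq.trans ?_ integral_conj
    refine integral_congr_ae ?_
    filter_upwards [Lp.coeFn_star f, Lp.coeFn_star g] with x h1 h2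
    rw [h1, h2]
    simp
  rw [bdry_apply, bdry_apply, conjPair, conjPair, key, key, star_sub]

/-- A boundary basis consisting of real functions. -/
structure IsRealBoundaryBasis (m : ℂ) (a b : L2 × L2) (w : ℂ) : Prop extends
    IsBoundaryBasis m a b w where
  real : star (m ^ 2) = m ^ 2
  left_real : conjPair a = a
  right_real : conjPair b = b

namespace IsRealBoundaryBasis

variable {m : ℂ} {a b : L2 × L2} {w : ℂ} (h : IsRealBoundaryBasis m a b w)

include h

theorem bdry_conjPair_mul {p q : L2 × L2} (hp : p ∈ maxGraph m) (hq : q ∈ maxGraph m) :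
    bdry (conjPair p) q * w = star (bdry a p) * bdry b q - star (bdry b p) * bdry a q := by
  rw [h.bdry_mul _ (conjPair_mem_maxGraph h.real hp) _ hq]
  have h1 := bdry_conjPair_conjPair a p
  have h2 := bdry_conjPair_conjPair b p
  rw [h.left_real] at h1
  rw [h.right_real] at h2
  rw [h1, h2]

/-- The boundary values allowed form the line through the real vector `(-sin θ, cos θ)`. On a real
line the sesquilinear form reduces to the symplectic form, for which every line in the plane is its
own orthogonal. -/
theorem isSelfAdjointExtension {T : L2 →ₗ.[ℂ] L2} {θ : ℝ}
    (hT : ∀ p, p ∈ T.graph ↔ p ∈ maxGraph m ∧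
      (Real.cos θ : ℂ) * bdry a p + (Real.sin θ : ℂ) * bdry b p = 0) :
    IsSelfAdjointExtension m T := by
  have hmin : LMin m ≤ T := by
    refine LinearPMap.le_of_le_graph fun p hp => (hT p).2 ?_
    obtain ⟨h1, h2, h3⟩ := (h.mem_LMin_graph h.real).1 hp
    exact ⟨h1, by rw [h2, h3]; simp⟩
  refine ⟨hmin, (isSelfAdjoint_iff_bdry h.real hmin).2 fun x => ⟨fun hx => ?_, fun hx => ?_⟩⟩
  · refine ⟨((hT x).1 hx).1, fun q hq => ?_⟩
    obtain ⟨hx1, hx2⟩ := (hT x).1 hx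
    obtain ⟨hq1, hq2⟩ := (hT q).1 hq
    refine (mul_eq_zero.1 ?_).resolve_right h.ne_zero
    rw [h.bdry_conjPair_mul hq1 hx1]
    have hq3 := congrArg star hq2
    have hcs : (Real.cos θ : ℂ) ^ 2 + (Real.sin θ : ℂ) ^ 2 = 1 := by
      exact_mod_cast Real.cos_sq_add_sin_sq θ
    have hc : star (Real.cos θ : ℂ) = Real.cos θ := Complex.conj_ofReal _
    have hs : star (Real.sin θ : ℂ) = Real.sin θ := Complex.conj_ofReal _
    rw [star_add, star_mul', star_mul', hc, hs, star_zero] at hq3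
    linear_combination ((Real.cos θ : ℂ) * bdry b x - (Real.sin θ : ℂ) * bdry a x) * hq3 +
      ((Real.sin θ : ℂ) * star (bdry a q) - (Real.cos θ : ℂ) * star (bdry b q)) * hx2 -
      (star (bdry a q) * bdry b x - star (bdry b q) * bdry a x) * hcs
  · obtain ⟨q, hq, hq1, hq2⟩ := h.exists_bdry_eq (-(Real.sin θ : ℂ)) (Real.cos θ : ℂ)
    have h0 := hx.2 q ((hT q).2 ⟨hq, by rw [hq1, hq2]; ring⟩)
    have h1 := h.bdry_conjPair_mul hq hx.1
    have hc : star (Real.cos θ : ℂ) = Real.cos θ := Complex.conj_ofReal _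
    have hs : star (Real.sin θ : ℂ) = Real.sin θ := Complex.conj_ofReal _
    rw [h0, hq1, hq2, star_neg, hc, hs, zero_mul] at h1
    exact (hT x).2 ⟨hx.1, by linear_combination h1⟩

/-- A self-adjoint `T` contains some `f` with nonzero boundary values, for otherwise its orthogonal
would be the whole maximal graph. Orthogonality to `f` is one linear equation for all of `T`;
applied to `f` itself it says that the ratio of the boundary values of `f` is real, so the equation
can be written with a real angle. -/
theorem exists_angle {T : L2 →ₗ.[ℂ] L2} (hT : IsSelfAdjointExtension m T) :
    ∃ θ ∈ Ico 0 Real.pi, ∀ p ∈ T.graph,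
      (Real.cos θ : ℂ) * bdry a p + (Real.sin θ : ℂ) * bdry b p = 0 := by
  have hsa := (isSelfAdjoint_iff_bdry h.real hT.1).1 hT.2
  obtain ⟨f, hf, hf0⟩ : ∃ f ∈ T.graph, ¬ (bdry a f = 0 ∧ bdry b f = 0) := by
    by_contra! hcon
    obtain ⟨x, hx, hx1, hx2⟩ := h.exists_bdry_eq 1 0
    have hxT : x ∈ T.graph := by
      refine (hsa x).2 ⟨hx, fun q hq => (mul_eq_zero.1 ?_).resolve_right h.ne_zero⟩
      rw [h.bdry_conjPair_mul ((hsa q).1 hq).1 hx, (hcon q hq).1, (hcon q hq).2]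
      simp
    rw [(hcon x hxT).1] at hx1
    exact zero_ne_one hx1
  have hfm := ((hsa f).1 hf).1
  have hrel : ∀ p ∈ T.graph, star (bdry a f) * bdry b p = star (bdry b f) * bdry a p := by
    intro p hp
    have h1 := h.bdry_conjPair_mul hfm ((hsa p).1 hp).1
    rw [((hsa p).1 hp).2 f hf, zero_mul] at h1
    linear_combination -h1
  by_cases hb : bdry b f = 0
  · have ha : bdry a f ≠ 0 := fun ha => hf0 ⟨ha, hb⟩
    refine ⟨Real.pi / 2, ⟨by positivity, by linarith [Real.pi_pos]⟩, fun p hp => ?_⟩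
    have h1 := hrel p hp
    rw [hb, star_zero, zero_mul] at h1
    have h2 := (mul_eq_zero.1 h1).resolve_left (star_ne_zero.2 ha)
    rw [h2]
    simp
  · have hff := hrel f hf
    -- The equation is `bdry a p + r bdry b p = 0`, so `r = tan θ`; the real part loses nothing
    -- because the ratio is real.
    set r : ℝ := (-(bdry a f / bdry b f)).re with hr
    have hrc : (r : ℂ) = -(bdry a f / bdry b f) := by
      refine Complex.conj_eq_iff_re.1 ?_
      have hb' : star (bdry b f) ≠ 0 := star_ne_zero.2 hb
      change star _ = _
      rw [star_neg, star_div₀, neg_inj, div_eq_div_iff hb' hb]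
      linear_combination hff
    have hra : bdry a f = -(r : ℂ) * bdry b f := by
      rw [hrc]
      field_simp
    set θ := Real.arctan r with hθ
    have hcos : 0 < Real.cos θ := Real.cos_arctan_pos r
    have hsin : Real.sin θ = r * Real.cos θ := by
      rw [← Real.tan_mul_cos hcos.ne', hθ, Real.tan_arctan]
    have hall : ∀ p ∈ T.graph, (Real.cos θ : ℂ) * bdry a p + (Real.sin θ : ℂ) * bdry b p = 0 := by
      intro p hp
      have h1 := hrel p hp
      have hrr : star (r : ℂ) = r := Complex.conj_ofReal r
      rw [hra, star_mul', star_neg, hrr] at h1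
      have h2 : bdry a p + (r : ℂ) * bdry b p = 0 := by
        refine (mul_eq_zero.1 ?_).resolve_left (star_ne_zero.2 hb)
        linear_combination -h1
      rw [hsin, Complex.ofReal_mul]
      linear_combination (Real.cos θ : ℂ) * h2
    -- The arctangent lies in `]-π/2, π/2[`. A negative angle is moved into `[0, π[` by adding `π`,
    -- which only changes the sign of the equation.
    rcases le_or_gt 0 θ with h0 | h0
    · exact ⟨θ, ⟨h0, (Real.arctan_lt_pi_div_two r).trans (by linarith [Real.pi_pos])⟩, hall⟩
    · refine ⟨θ + Real.pi, ⟨?_, by linarith⟩, fun p hp => ?_⟩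
      · linarith [Real.neg_pi_div_two_lt_arctan r, Real.pi_pos]
      · rw [Real.cos_add_pi, Real.sin_add_pi, Complex.ofReal_neg, Complex.ofReal_neg]
        linear_combination -hall p hp

/-- The vector `(-sin θ, cos θ)` satisfies the equation of angle `η` exactly when `sin (η - θ) = 0`,
and `|η - θ| < π`. -/
theorem angle_unique {T : L2 →ₗ.[ℂ] L2} {θ η : ℝ} (hθ : θ ∈ Ico 0 Real.pi)
    (hη : η ∈ Ico 0 Real.pi)
    (h1 : ∀ p ∈ maxGraph m, (Real.cos θ : ℂ) * bdry a p + (Real.sin θ : ℂ) * bdry b p = 0 →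
      p ∈ T.graph)
    (h2 : ∀ p ∈ T.graph, (Real.cos η : ℂ) * bdry a p + (Real.sin η : ℂ) * bdry b p = 0) :
    η = θ := by
  obtain ⟨q, hq, hq1, hq2⟩ := h.exists_bdry_eq (-(Real.sin θ : ℂ)) (Real.cos θ : ℂ)
  have h3 := h2 q (h1 q hq (by rw [hq1, hq2]; ring))
  rw [hq1, hq2] at h3
  have h4 : Real.sin (η - θ) = 0 := by
    rw [Real.sin_sub]
    have : ((Real.sin η * Real.cos θ - Real.cos η * Real.sin θ : ℝ) : ℂ) = 0 := by
      push_cast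
      push_cast at h3
      linear_combination h3
    exact_mod_cast this
  have h5 := (Real.sin_eq_zero_iff_of_lt_of_lt (by linarith [hθ.2, hη.1])
    (by linarith [hθ.1, hη.2])).1 h4
  linarith

/-- An inclusion between self-adjoint operators is an equality, because adjoints reverse it. -/
theorem existsUnique_angle {S : ℝ → L2 →ₗ.[ℂ] L2}
    (hS : ∀ θ p, p ∈ (S θ).graph ↔ p ∈ maxGraph m ∧
      (Real.cos θ : ℂ) * bdry a p + (Real.sin θ : ℂ) * bdry b p = 0)
    {T : L2 →ₗ.[ℂ] L2} (hT : IsSelfAdjointExtension m T) :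
    ∃! θ : ℝ, θ ∈ Ico 0 Real.pi ∧ T = S θ := by
  obtain ⟨θ, hθ, hall⟩ := h.exists_angle hT
  have hle : T.graph ≤ (S θ).graph := fun p hp =>
    (hS θ p).2 ⟨graph_le_maxGraph (hT.le_LMax h.real) hp, hall p hp⟩
  have hSθ := h.isSelfAdjointExtension (hS θ)
  have hge : (S θ).graph ≤ T.graph := by
    rw [← (isSelfAdjoint_iff_graph hSθ.2.dense_domain).1 hSθ.2,
      ← (isSelfAdjoint_iff_graph hT.2.dense_domain).1 hT.2]
    exact adjoint_anti hle
  have heq : T = S θ := LinearPMap.eq_of_eq_graph (le_antisymm hle hge)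
  refine ⟨θ, ⟨hθ, heq⟩, ?_⟩
  rintro η ⟨hη, hTη⟩
  refine h.angle_unique (T := T) hθ hη (fun p hp hp' => ?_) fun p hp => ?_
  · rw [heq]
    exact (hS θ p).2 ⟨hp, hp'⟩
  · rw [hTη] at hp
    exact ((hS η p).1 hp).2

end IsRealBoundaryBasis

/-! ### Deficiency indices -/

/-- On a self-adjoint graph the inner product of the two components is real, and `z` is purely
imaginary, so the cross term in the square has real part zero. -/
theorem norm_sq_sub_smul_of_adjoint_eq {g : Submodule ℂ (L2 × L2)} (hg : g.adjoint = g) {z : ℂ}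
    (hz : star z = -z) (hz1 : ‖z‖ = 1) {q : L2 × L2} (hq : q ∈ g) :
    ‖q.2 - z • q.1‖ ^ 2 = ‖q.2‖ ^ 2 + ‖q.1‖ ^ 2 := by
  have hsym : inner ℂ q.2 q.1 - inner ℂ q.1 q.2 = 0 := by
    have : q ∈ g.adjoint := by rwa [hg]
    exact (Submodule.mem_adjoint_iff g q).1 this q.1 q.2 hq
  have hre : RCLike.re (inner ℂ q.2 (z • q.1)) = 0 := by
    rw [inner_smul_right]
    have h1 : star (inner ℂ q.2 q.1) = inner ℂ q.2 q.1 := by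
      have : star (inner ℂ q.2 q.1) = inner ℂ q.1 q.2 := inner_conj_symm (𝕜 := ℂ) q.1 q.2
      linear_combination this - hsym
    have h2 : star (z * inner ℂ q.2 q.1) = -(z * inner ℂ q.2 q.1) := by
      rw [star_mul', hz, h1]
      ring
    have h3 := congrArg Complex.re h2
    have h4 : (star (z * inner ℂ q.2 q.1)).re = (z * inner ℂ q.2 q.1).re := Complex.conj_re _
    rw [h4, Complex.neg_re] at h3
    change (z * inner ℂ q.2 q.1).re = 0
    linarith
  rw [@norm_sub_sq ℂ, hre, norm_smul, hz1]
  ring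

/-- Von Neumann's criterion: `T - z` is bounded below on its closed graph, so its range is closed. A
vector orthogonal to the range is an eigenvector for `star z`, and the norm identity for `star z`
makes it zero. -/
theorem exists_sub_smul_eq {g : Submodule ℂ (L2 × L2)} (hg : g.adjoint = g)
    (hcl : IsClosed (g : Set (L2 × L2))) {z : ℂ} (hz : star z = -z) (hz1 : ‖z‖ = 1) (y : L2) :
    ∃ q ∈ g, q.2 - z • q.1 = y := by
  let S : g →L[ℂ] L2 :=
    ((ContinuousLinearMap.snd ℂ L2 L2) - z • (ContinuousLinearMap.fst ℂ L2 L2)).comp g.subtypeL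
  have hS : ∀ q : g, S q = (q : L2 × L2).2 - z • (q : L2 × L2).1 := fun _ => rfl
  have hbound : ∀ q : g, ‖q‖ ≤ ‖S q‖ := by
    intro q
    have h1 := norm_sq_sub_smul_of_adjoint_eq hg hz hz1 q.2
    rw [← hS] at h1
    refine max_le ?_ ?_
    · refine abs_le_of_sq_le_sq' ?_ (norm_nonneg _) |>.2
      rw [h1]
      exact le_add_of_nonneg_left (sq_nonneg _)
    · refine abs_le_of_sq_le_sq' ?_ (norm_nonneg _) |>.2
      rw [h1]
      exact le_add_of_nonneg_right (sq_nonneg _)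
  have hanti : AntilipschitzWith 1 S := S.antilipschitz_of_bound fun q => by simpa using hbound q
  have : CompleteSpace g := hcl.completeSpace_coe
  have hrc : IsClosed (range S) := hanti.isClosed_range S.uniformContinuous
  have hperp : (LinearMap.range S.toLinearMap)ᗮ = ⊥ := by
    rw [Submodule.eq_bot_iff]
    intro v hv
    have hmem : (v, star z • v) ∈ g := by
      rw [← hg, Submodule.mem_adjoint_iff]
      intro a b hab
      have := (Submodule.mem_orthogonal _ _).1 hv (S ⟨(a, b), hab⟩) ⟨_, rfl⟩
      rw [hS, inner_sub_left, inner_smul_left] at this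
      rw [inner_smul_right]
      exact this
    have hn := norm_sq_sub_smul_of_adjoint_eq hg (z := star z) (by rw [hz]; simp [hz])
      (by rw [norm_star, hz1]) hmem
    simp only [sub_self, norm_zero] at hn
    have : ‖v‖ ^ 2 = 0 := by
      have h1 := sq_nonneg ‖v‖
      have h2 := sq_nonneg ‖star z • v‖
      nlinarith
    simpa using this
  have htop : LinearMap.range S.toLinearMap = ⊤ := by
    rw [← Submodule.topologicalClosure_eq_top_iff] at hperp
    rw [← hperp]
    exact (IsClosed.submodule_topologicalClosure_eq (s := LinearMap.range S.toLinearMap) hrc).symm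
  obtain ⟨q, hq⟩ := (htop ▸ Submodule.mem_top : y ∈ LinearMap.range S.toLinearMap)
  exact ⟨q, q.2, hq⟩

theorem mem_deficiencySpace_iff {T : L2 →ₗ.[ℂ] L2} {z : ℂ} {y : L2} :
    y ∈ deficiencySpace T z ↔ (y, z • y) ∈ T.adjoint.graph := by
  rw [deficiencySpace, Submodule.mem_map, LinearPMap.mem_graph_iff]
  constructor
  · rintro ⟨x, hx, rfl⟩
    exact ⟨x, rfl, sub_eq_zero.1 hx⟩
  · rintro ⟨x, hx1, hx2⟩
    refine ⟨x, ?_, hx1⟩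
    change T.adjoint.toFun x - z • (x : L2) = 0
    rw [hx1]
    exact sub_eq_zero.2 hx2

/-- Here `e` spans the maximal graph modulo that of `T`. Surjectivity of `T - z` yields `d` in `T`
with `(T - z) d = (LMax m - z) e`, so `e - d` is in the deficiency space. It spans, because
subtracting a multiple of it from any other element lands in `T`, where `T - z` is injective. -/
theorem rank_deficiencySpace {m : ℂ} (hm : star (m ^ 2) = m ^ 2) {T : L2 →ₗ.[ℂ] L2}
    (hT : IsSelfAdjointExtension m T) {e : L2 × L2} (he : e ∈ maxGraph m) (heT : e ∉ T.graph)
    (hspan : ∀ p ∈ maxGraph m, ∃ c : ℂ, p - c • e ∈ T.graph) {z : ℂ} (hz : star z = -z)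
    (hz1 : ‖z‖ = 1) : Module.rank ℂ (deficiencySpace (LMin m) z) = 1 := by
  have hg := (isSelfAdjoint_iff_graph hT.2.dense_domain).1 hT.2
  obtain ⟨d, hd, hde⟩ := exists_sub_smul_eq hg hT.2.isClosed hz hz1 (e.2 - z • e.1)
  have hle := graph_le_maxGraph (hT.le_LMax hm)
  have hmem : ∀ y : L2, y ∈ deficiencySpace (LMin m) z ↔ (y, z • y) ∈ maxGraph m := fun y => by
    rw [mem_deficiencySpace_iff, LMin_adjoint hm, LMax_graph]
  have hη2 : (e - d).2 = z • (e - d).1 := by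
    rw [Prod.snd_sub, Prod.fst_sub, smul_sub]
    rw [sub_eq_sub_iff_add_eq_add] at hde ⊢
    rw [← hde]
    abel
  have hη : ((e - d).1, z • (e - d).1) = e - d := Prod.ext rfl hη2.symm
  have hspace : deficiencySpace (LMin m) z = Submodule.span ℂ {(e - d).1} := by
    ext y
    rw [Submodule.mem_span_singleton, hmem]
    constructor
    · intro hy
      obtain ⟨c, hc⟩ := hspan _ hy
      refine ⟨c, ?_⟩
      have h1 : (y, z • y) - c • (e - d) ∈ T.graph := by
        have := T.graph.add_mem hc (T.graph.smul_mem c hd)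
        convert this using 1
        module
      have h2 := norm_sq_sub_smul_of_adjoint_eq hg hz hz1 h1
      have h3 : ((y, z • y) - c • (e - d)).2 - z • ((y, z • y) - c • (e - d)).1 = 0 := by
        rw [Prod.snd_sub, Prod.fst_sub, Prod.smul_snd, Prod.smul_fst, hη2]
        module
      rw [h3] at h2
      have h4 : ‖((y, z • y) - c • (e - d)).1‖ ^ 2 = 0 := by
        have h1 := sq_nonneg ‖((y, z • y) - c • (e - d)).1‖
        have h2 := sq_nonneg ‖((y, z • y) - c • (e - d)).2‖
        rw [norm_zero] at *
        linarith
      have h5 : y - c • (e - d).1 = 0 := by simpa using h4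
      exact (sub_eq_zero.1 h5).symm
    · rintro ⟨c, rfl⟩
      have := (maxGraph m).smul_mem c ((maxGraph m).sub_mem he (hle hd))
      rw [← hη] at this
      rw [smul_comm]
      exact this
  have hne : (e - d).1 ≠ 0 := by
    intro h0
    rw [h0, smul_zero] at hη
    refine heT ?_
    rw [sub_eq_zero.1 hη.symm]
    exact hd
  rw [hspace, Module.rank_eq_one_iff_finrank_eq_one, finrank_span_singleton hne]

theorem IsRealBoundaryBasis.hasDeficiencyIndices {m : ℂ} {a b : L2 × L2} {w : ℂ}
    (h : IsRealBoundaryBasis m a b w) {T : L2 →ₗ.[ℂ] L2}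
    (hT : ∀ p, p ∈ T.graph ↔ p ∈ maxGraph m ∧ bdry a p = 0) :
    HasDeficiencyIndices (LMin m) 1 1 := by
  have hsa : IsSelfAdjointExtension m T := by
    refine h.isSelfAdjointExtension (θ := 0) fun p => ?_
    rw [hT]
    simp
  have hw := h.ne_zero
  have key : ∀ z : ℂ, star z = -z → ‖z‖ = 1 →
      Module.rank ℂ (deficiencySpace (LMin m) z) = 1 := by
    intro z hz hz1
    refine rank_deficiencySpace h.real hsa h.right_mem (fun hb => ?_) (fun p hp => ?_) hz hz1
    · have := ((hT b).1 hb).2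
      rw [h.bdry_left_right] at this
      exact hw this
    · refine ⟨bdry a p / w, (hT _).2
        ⟨(maxGraph m).sub_mem hp ((maxGraph m).smul_mem _ h.right_mem), ?_⟩⟩
      rw [map_sub, map_smul, h.bdry_left_right, smul_eq_mul]
      field_simp
      simp
  refine ⟨dense_domain_of_LMin_le le_rfl, ?_, ?_, ?_⟩
  · rw [LMin_adjoint h.real]
    exact LMin_le_LMax m
  · exact_mod_cast key Complex.I Complex.conj_I Complex.norm_I
  · exact_mod_cast key (-Complex.I) (by rw [star_neg]; exact congrArg _ Complex.conj_I)
      (by rw [norm_neg, Complex.norm_I])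

/-! ### Dilations -/

theorem IsSecondPrimitive.comp_mul {F F1 k : ℝ → ℂ} (h : IsSecondPrimitive F F1 k) {s : ℝ}
    (hs : 0 < s) :
    IsSecondPrimitive (fun x => F (s * x)) (fun x => s * F1 (s * x))
      (fun x => (s : ℂ) ^ 2 * k (s * x)) where
  hasDerivAt x hx := by
    have h1 := (h.hasDerivAt (s * x) (mul_pos hs hx)).scomp x ((hasDerivAt_id x).const_mul s)
    simpa [Function.comp_def] using h1
  integrable a b ha hb := by
    have h1 := (h.integrable (s * a) (s * b) (mul_pos hs ha) (mul_pos hs hb)).comp_mul_left (c := s)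
    rw [mul_div_cancel_left₀ _ hs.ne', mul_div_cancel_left₀ _ hs.ne'] at h1
    exact h1.const_mul _
  sub_eq a b ha hb := by
    rw [intervalIntegral.integral_const_mul, intervalIntegral.integral_comp_mul_left k hs.ne',
      ← h.sub_eq _ _ (mul_pos hs ha) (mul_pos hs hb), Complex.real_smul]
    have : (s : ℂ) ≠ 0 := by exact_mod_cast hs.ne'
    push_cast
    field_simp

/-- The potential is homogeneous of degree `-2`, so it scales by the same factor `s²` as the second
derivative. -/
theorem SolvesODE.comp_mul {c : ℂ} {F F1 g : ℝ → ℂ} (h : SolvesODE c F F1 g) {s : ℝ} (hs : 0 < s) :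
    SolvesODE c (fun x => F (s * x)) (fun x => s * F1 (s * x))
      (fun x => (s : ℂ) ^ 2 * g (s * x)) := by
  refine (IsSecondPrimitive.comp_mul h hs).congr_ae ?_
  filter_upwards [ae_restrict_mem measurableSet_Ioi] with x hx
  have h1 : (s : ℂ) ≠ 0 := by exact_mod_cast hs.ne'
  have h2 : (x : ℂ) ≠ 0 := by exact_mod_cast (ne_of_gt hx)
  push_cast
  field_simp

theorem SolvesODE.const_mul {c : ℂ} {F F1 g : ℝ → ℂ} (h : SolvesODE c F F1 g) (a : ℂ) :
    SolvesODE c (fun x => a * F x) (fun x => a * F1 x) (fun x => a * g x) := by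
  refine (IsSecondPrimitive.const_mul h a).congr_ae (Eventually.of_forall fun x => ?_)
  ring

/-- The action of dilations on the graph of an operator that is homogeneous of degree `-2`. -/
noncomputable def dilPair (τ : ℝ) (p : L2 × L2) : L2 × L2 :=
  (dilation τ p.1, (Real.exp (2 * τ) : ℂ) • dilation τ p.2)

theorem dilPair_rep {m : ℂ} {p : L2 × L2} {F F1 : ℝ → ℂ} (h1 : p.1 =ᵐ[halfLine] F)
    (h2 : SolvesODE (m ^ 2 - 1 / 4) F F1 p.2) (τ : ℝ) :
    (dilPair τ p).1 =ᵐ[halfLine] (fun x => (Real.exp (τ / 2) : ℂ) * F (Real.exp τ * x)) ∧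
    SolvesODE (m ^ 2 - 1 / 4) (fun x => (Real.exp (τ / 2) : ℂ) * F (Real.exp τ * x))
      (fun x => (Real.exp (τ / 2) : ℂ) * ((Real.exp τ : ℂ) * F1 (Real.exp τ * x)))
      (dilPair τ p).2 := by
  have hs := Real.exp_pos τ
  constructor
  · filter_upwards [dilation_coeFn τ p.1, (quasi_mul hs).ae h1] with x hx hx'
    rw [dilPair, hx, hx']
  · refine ((h2.comp_mul hs).const_mul _).congr_ae ?_
    filter_upwards [dilation_coeFn τ p.2, Lp.coeFn_smul (Real.exp (2 * τ) : ℂ) (dilation τ p.2)]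
      with x hx hx'
    rw [dilPair, hx', Pi.smul_apply, hx, smul_eq_mul, two_mul, Real.exp_add, Complex.ofReal_mul]
    ring

theorem dilPair_mem_maxGraph {m : ℂ} {p : L2 × L2} (hp : p ∈ maxGraph m) (τ : ℝ) :
    dilPair τ p ∈ maxGraph m := by
  obtain ⟨F, F1, h1, h2⟩ := exists_solvesODE hp
  obtain ⟨h3, h4⟩ := dilPair_rep h1 h2 τ
  exact mem_maxGraph_of_solvesODE h3 h4

/-- Substitution `x ↦ e^τ x` in the Wronskian: `l` comes from the solution, `e^τ` from one
derivative, and `e^{τ/2}` from the unitary normalisation of dilations. -/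
theorem IsHomSol.bdry_dilPair {m : ℂ} {u u1 v v1 : ℝ → ℂ} (hu : IsHomSol (m ^ 2 - 1 / 4) u u1)
    (hv : IsHomSol (m ^ 2 - 1 / 4) v v1) {τ : ℝ} {l : ℂ}
    (h : ∀ x, 0 < x → u x = l * v (Real.exp τ * x)) {p : L2 × L2} (hp : p ∈ maxGraph m) :
    bdry hu.pair (dilPair τ p) =
      l * (Real.exp τ : ℂ) * (Real.exp (τ / 2) : ℂ) * bdry hv.pair p := by
  obtain ⟨F, F1, h1, h2⟩ := exists_solvesODE hp
  obtain ⟨h3, h4⟩ := dilPair_rep h1 h2 τ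
  have hs := Real.exp_pos τ
  have h' : ∀ x, 0 < x → u1 x = l * ((Real.exp τ : ℂ) * v1 (Real.exp τ * x)) := fun x hx => by
    have hd := ((hv.hasDerivAt (Real.exp τ * x) (mul_pos hs hx)).scomp x
      ((hasDerivAt_id x).const_mul (Real.exp τ))).const_mul l
    have := (hu.hasDerivAt x hx).unique (hd.congr_of_eventuallyEq
      (by filter_upwards [Ioi_mem_nhds hx] with t ht using h t ht))
    rw [this]
    simp
  have hscale : Tendsto (fun x => Real.exp τ * x) (𝓝[>] 0) (𝓝[>] 0) := by
    refine tendsto_nhdsWithin_iff.2 ⟨?_, ?_⟩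
    · have : Tendsto (fun x => Real.exp τ * x) (𝓝 0) (𝓝 (Real.exp τ * 0)) :=
        (continuous_const_mul (Real.exp τ)).tendsto 0
      rw [mul_zero] at this
      exact this.mono_left nhdsWithin_le_nhds
    · filter_upwards [self_mem_nhdsWithin] with x hx using mul_pos hs hx
  refine tendsto_nhds_unique (hu.tendsto_bdry h3 h4)
    ((((hv.tendsto_bdry h1 h2).comp hscale).const_mul _).congr' ?_)
  filter_upwards [self_mem_nhdsWithin] with x hx
  rw [h x hx, h' x hx, Function.comp_apply]
  ring

theorem isHomogeneous_iff {T : L2 →ₗ.[ℂ] L2} :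
    IsHomogeneous (-2) T ↔ ∀ τ : ℝ, ∀ p ∈ T.graph, dilPair τ p ∈ T.graph := by
  have hexp : ∀ τ : ℝ, (Real.exp (2 * τ) : ℂ) * (Real.exp (-2 * τ) : ℂ) = 1 := fun τ => by
    rw [← Complex.ofReal_mul, ← Real.exp_add]
    simp
  constructor
  · rintro h τ ⟨f, g⟩ hp
    obtain ⟨f', hf1, hf2⟩ := T.mem_graph_iff.1 hp
    obtain ⟨hd, he⟩ := h τ f'
    simp only at hf1 hf2
    rw [T.mem_graph_iff]
    refine ⟨⟨_, hd⟩, by simp [dilPair, hf1], ?_⟩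
    simp only [dilPair]
    rw [← hf2, he, smul_smul, hexp, one_smul]
  · intro h τ f
    have h1 := h τ _ (T.mem_graph f)
    have hd : dilation τ f ∈ T.domain := LinearPMap.mem_domain_of_mem_graph (x := dilation τ f) h1
    refine ⟨hd, ?_⟩
    obtain ⟨y, hy1, hy2⟩ := T.mem_graph_iff.1 h1
    simp only [dilPair] at hy1 hy2
    have hy : y = ⟨dilation τ f, hd⟩ := Subtype.ext hy1
    rw [← hy, hy2, smul_smul, mul_comm, hexp, one_smul]

theorem isHomogeneous_LMax (m : ℂ) : IsHomogeneous (-2) (LMax m) := by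
  rw [isHomogeneous_iff, LMax_graph]
  exact fun τ p hp => dilPair_mem_maxGraph hp τ

/-! ### Homogeneous strict extensions -/

theorem IsStrictExtension.not_maxGraph_le {m : ℂ} {T : L2 →ₗ.[ℂ] L2} (hT : IsStrictExtension m T) :
    ¬ maxGraph m ≤ T.graph := fun hle =>
  hT.2.not_ge (LinearPMap.le_of_le_graph (by rwa [LMax_graph]))

theorem isHomogeneous_of_bdry {m : ℂ} {a : L2 × L2} {T : L2 →ₗ.[ℂ] L2}
    (hT : ∀ p, p ∈ T.graph ↔ p ∈ maxGraph m ∧ bdry a p = 0)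
    (ha : ∀ τ : ℝ, ∃ l : ℂ, ∀ p ∈ maxGraph m, bdry a (dilPair τ p) = l * bdry a p) :
    IsHomogeneous (-2) T := by
  rw [isHomogeneous_iff]
  intro τ p hp
  obtain ⟨l, hl⟩ := ha τ
  obtain ⟨h1, h2⟩ := (hT p).1 hp
  exact (hT _).2 ⟨dilPair_mem_maxGraph h1 τ, by rw [hl p h1, h2, mul_zero]⟩

namespace IsBoundaryBasis

variable {m : ℂ} {a b : L2 × L2} {w : ℂ} (h : IsBoundaryBasis m a b w)
  (hm : star (m ^ 2) = m ^ 2)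

include h hm

/-- The kernel of `bdry a` contains `a`, which is not in the minimal graph since `bdry b a ≠ 0`, and
omits `b`. -/
theorem isStrictExtension {T : L2 →ₗ.[ℂ] L2}
    (hT : ∀ p, p ∈ T.graph ↔ p ∈ maxGraph m ∧ bdry a p = 0) : IsStrictExtension m T := by
  have hw := h.ne_zero
  refine ⟨lt_of_le_of_ne (LinearPMap.le_of_le_graph fun p hp => ?_) fun heq => ?_,
    lt_of_le_of_ne (LinearPMap.le_of_le_graph fun p hp => ?_) fun heq => ?_⟩
  · exact (hT p).2 ⟨((h.mem_LMin_graph hm).1 hp).1, ((h.mem_LMin_graph hm).1 hp).2.1⟩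
  · have h1 : a ∈ T.graph := (hT a).2 ⟨h.left_mem, bdry_self a⟩
    rw [← heq, h.mem_LMin_graph hm, h.bdry_right_left] at h1
    exact hw (neg_eq_zero.1 h1.2.2)
  · rw [LMax_graph]
    exact ((hT p).1 hp).1
  · have h1 := h.right_mem
    rw [← LMax_graph, ← heq, hT, h.bdry_left_right] at h1
    exact hw h1.2

/-- Two elements with independent boundary values span the quotient by the minimal graph; the
coefficients `s`, `t` are given by Cramer's rule. -/
theorem maxGraph_le {T : L2 →ₗ.[ℂ] L2} (h1 : LMin m ≤ T) (h2 : T ≤ LMax m) {p q : L2 × L2}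
    (hp : p ∈ T.graph) (hq : q ∈ T.graph)
    (hpq : bdry a p * bdry b q - bdry a q * bdry b p ≠ 0) : maxGraph m ≤ T.graph := by
  intro x hx
  set D := bdry a p * bdry b q - bdry a q * bdry b p with hD
  set s := (bdry a x * bdry b q - bdry a q * bdry b x) / D with hs
  set t := (bdry a p * bdry b x - bdry a x * bdry b p) / D with ht
  have hmem : s • p + t • q ∈ T.graph :=
    T.graph.add_mem (T.graph.smul_mem _ hp) (T.graph.smul_mem _ hq)
  have hx0 : x - (s • p + t • q) ∈ (LMin m).graph := by
    rw [h.mem_LMin_graph hm]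
    refine ⟨(maxGraph m).sub_mem hx (graph_le_maxGraph h2 hmem), ?_, ?_⟩
    · rw [map_sub, map_add, map_smul, map_smul, smul_eq_mul, smul_eq_mul, hs, ht]
      field_simp
      rw [hD]
      ring
    · rw [map_sub, map_add, map_smul, map_smul, smul_eq_mul, smul_eq_mul, hs, ht]
      field_simp
      rw [hD]
      ring
  have := T.graph.add_mem (LinearPMap.le_graph_of_le h1 hx0) hmem
  rwa [sub_add_cancel] at this

/-- Modulo the minimal graph the kernel of `bdry a` is a line, and a strict extension inside it is
not zero there, so it fills the line. -/
theorem graph_eq_of_strict {T : L2 →ₗ.[ℂ] L2} (hT : IsStrictExtension m T)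
    (h0 : ∀ p ∈ T.graph, bdry a p = 0) (p : L2 × L2) :
    p ∈ T.graph ↔ p ∈ maxGraph m ∧ bdry a p = 0 := by
  refine ⟨fun hp => ⟨graph_le_maxGraph hT.2.le hp, h0 p hp⟩, fun ⟨hp, hp0⟩ => ?_⟩
  obtain ⟨q, hq, hq0⟩ : ∃ q ∈ T.graph, bdry b q ≠ 0 := by
    by_contra! hcon
    refine hT.1.not_ge (LinearPMap.le_of_le_graph fun x hx => ?_)
    exact (h.mem_LMin_graph hm).2 ⟨graph_le_maxGraph hT.2.le hx, h0 x hx, hcon x hx⟩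
  have hx0 : p - (bdry b p / bdry b q) • q ∈ (LMin m).graph := by
    rw [h.mem_LMin_graph hm]
    refine ⟨(maxGraph m).sub_mem hp ((maxGraph m).smul_mem _ (graph_le_maxGraph hT.2.le hq)), ?_, ?_⟩
    · rw [map_sub, map_smul, hp0, h0 q hq]
      simp
    · rw [map_sub, map_smul, smul_eq_mul]
      field_simp
      simp
  have := T.graph.add_mem (LinearPMap.le_graph_of_le hT.1.le hx0)
    (T.graph.smul_mem (bdry b p / bdry b q) hq)
  rwa [sub_add_cancel] at this

/-- If dilations act diagonally on the boundary values, with distinct eigenvalues, there are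
exactly two homogeneous strict extensions. -/
theorem setOf_homogeneous_of_diagonal {A B : L2 →ₗ.[ℂ] L2}
    (hA : ∀ p, p ∈ A.graph ↔ p ∈ maxGraph m ∧ bdry a p = 0)
    (hB : ∀ p, p ∈ B.graph ↔ p ∈ maxGraph m ∧ bdry b p = 0)
    {l k : ℝ → ℂ} (hl : ∀ τ, ∀ p ∈ maxGraph m, bdry a (dilPair τ p) = l τ * bdry a p)
    (hk : ∀ τ, ∀ p ∈ maxGraph m, bdry b (dilPair τ p) = k τ * bdry b p)
    {σ : ℝ} (hσ : l σ ≠ k σ) :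
    {T : L2 →ₗ.[ℂ] L2 | IsStrictExtension m T ∧ IsHomogeneous (-2) T} = {A, B} := by
  ext T
  simp only [mem_ofPred_eq, mem_insert_iff, mem_singleton_iff]
  constructor
  · rintro ⟨hs, hT⟩
    rw [isHomogeneous_iff] at hT
    by_cases h0 : ∀ p ∈ T.graph, bdry a p = 0
    · left
      refine LinearPMap.eq_of_eq_graph (SetLike.ext fun p => ?_)
      rw [h.graph_eq_of_strict hm hs h0, hA]
    by_cases h0' : ∀ p ∈ T.graph, bdry b p = 0
    · right
      refine LinearPMap.eq_of_eq_graph (SetLike.ext fun p => ?_)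
      rw [h.symm.graph_eq_of_strict hm hs h0', hB]
    exfalso
    push Not at h0 h0'
    obtain ⟨p, hp, hp0⟩ := h0
    obtain ⟨q, hq, hq0⟩ := h0'
    have hpm := graph_le_maxGraph hs.2.le hp
    have hqm := graph_le_maxGraph hs.2.le hq
    -- The dilation minus `k σ` kills the second boundary value of `p`, and the dilation minus `l σ`
    -- kills the first one of `q`. What remains is a pair with diagonal, nonsingular boundary
    -- values, so `T` would be maximal.
    refine hs.not_maxGraph_le (h.maxGraph_le hm hs.1.le hs.2.le
      (T.graph.sub_mem (hT σ p hp) (T.graph.smul_mem (k σ) hp))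
      (T.graph.sub_mem (hT σ q hq) (T.graph.smul_mem (l σ) hq)) ?_)
    simp only [map_sub, map_smul, smul_eq_mul, hl σ p hpm, hl σ q hqm, hk σ p hpm, hk σ q hqm]
    have : (l σ * bdry a p - k σ * bdry a p) * (k σ * bdry b q - l σ * bdry b q) -
        (l σ * bdry a q - l σ * bdry a q) * (k σ * bdry b p - k σ * bdry b p) =
        -((l σ - k σ) ^ 2 * (bdry a p * bdry b q)) := by ring
    rw [this]
    exact neg_ne_zero.2 (mul_ne_zero (pow_ne_zero _ (sub_ne_zero.2 hσ)) (mul_ne_zero hp0 hq0))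
  · rintro (rfl | rfl)
    · exact ⟨h.isStrictExtension hm hA, isHomogeneous_of_bdry hA fun τ => ⟨l τ, hl τ⟩⟩
    · exact ⟨h.symm.isStrictExtension hm hB, isHomogeneous_of_bdry hB fun τ => ⟨k τ, hk τ⟩⟩

/-- If dilations act on the boundary values by nontrivial Jordan blocks, there is exactly one
homogeneous strict extension. -/
theorem setOf_homogeneous_of_jordan {A : L2 →ₗ.[ℂ] L2}
    (hA : ∀ p, p ∈ A.graph ↔ p ∈ maxGraph m ∧ bdry a p = 0)
    {l : ℝ → ℂ} (hl : ∀ τ, ∀ p ∈ maxGraph m, bdry a (dilPair τ p) = l τ * bdry a p)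
    {σ : ℝ} {k : ℂ} (hk0 : k ≠ 0)
    (hk : ∀ p ∈ maxGraph m, bdry b (dilPair σ p) = l σ * bdry b p + k * bdry a p) :
    {T : L2 →ₗ.[ℂ] L2 | IsStrictExtension m T ∧ IsHomogeneous (-2) T} = {A} := by
  ext T
  simp only [mem_ofPred_eq, mem_singleton_iff]
  constructor
  · rintro ⟨hs, hT⟩
    rw [isHomogeneous_iff] at hT
    by_cases h0 : ∀ p ∈ T.graph, bdry a p = 0
    · refine LinearPMap.eq_of_eq_graph (SetLike.ext fun p => ?_)
      rw [h.graph_eq_of_strict hm hs h0, hA]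
    exfalso
    push Not at h0
    obtain ⟨p, hp, hp0⟩ := h0
    have hpm := graph_le_maxGraph hs.2.le hp
    -- The dilation minus `l σ` sends the boundary values of `p` to `(0, k bdry a p)`, independent
    -- of those of `p` because `bdry a p ≠ 0`.
    refine hs.not_maxGraph_le (h.maxGraph_le hm hs.1.le hs.2.le hp
      (T.graph.sub_mem (hT σ p hp) (T.graph.smul_mem (l σ) hp)) ?_)
    simp only [map_sub, map_smul, smul_eq_mul, hl σ p hpm, hk p hpm]
    have : bdry a p * (l σ * bdry b p + k * bdry a p - l σ * bdry b p) -
        (l σ * bdry a p - l σ * bdry a p) * bdry b p = k * bdry a p ^ 2 := by ring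
    rw [this]
    exact mul_ne_zero hk0 (pow_ne_zero _ hp0)
  · rintro rfl
    exact ⟨h.isStrictExtension hm hA, isHomogeneous_of_bdry hA fun τ => ⟨l τ, hl τ⟩⟩

end IsBoundaryBasis

/-! ### Explicit solutions -/

theorem hasDerivAt_ofReal_cpow_pos (r : ℂ) {x : ℝ} (hx : 0 < x) :
    HasDerivAt (fun y : ℝ => (y : ℂ) ^ r) (r * (x : ℂ) ^ (r - 1)) x := by
  have h := ((hasDerivAt_id (x : ℂ)).cpow_const (c := r)
    (Complex.ofReal_mem_slitPlane.2 hx)).comp_ofReal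
  simpa using h

/-- The derivative of `ζ_m`. -/
noncomputable def zetaDeriv (m : ℂ) (x : ℝ) : ℂ := (1 / 2 + m) * (x : ℂ) ^ (1 / 2 + m - 1)

theorem hasDerivAt_zeta (m : ℂ) {x : ℝ} (hx : 0 < x) : HasDerivAt (zeta m) (zetaDeriv m x) x :=
  hasDerivAt_ofReal_cpow_pos _ hx

theorem hasDerivAt_zetaDeriv (m : ℂ) {x : ℝ} (hx : 0 < x) :
    HasDerivAt (zetaDeriv m) ((m ^ 2 - 1 / 4) / (x : ℂ) ^ 2 * zeta m x) x := by
  refine ((hasDerivAt_ofReal_cpow_pos _ hx).const_mul (1 / 2 + m)).congr_deriv ?_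
  have h0 : (x : ℂ) ≠ 0 := by exact_mod_cast hx.ne'
  rw [Complex.cpow_sub _ _ h0, Complex.cpow_sub _ _ h0, Complex.cpow_one, zeta]
  field_simp
  ring

theorem norm_zeta (m : ℂ) {x : ℝ} (hx : 0 < x) : ‖zeta m x‖ = x ^ (1 / 2 + m.re) := by
  rw [zeta, Complex.norm_cpow_eq_rpow_re_of_pos hx]
  simp

theorem continuousOn_zeta (m : ℂ) : ContinuousOn (zeta m) (Ioi 0) :=
  fun _ hx => (hasDerivAt_zeta m hx).continuousAt.continuousWithinAt

/-- Square integrability at `0` is integrability of `x^{1 + 2 Re k}`, that is `Re k > -1`. -/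
theorem isHomSol_zeta {m k : ℂ} (hk : k ^ 2 = m ^ 2) (hre : -1 < k.re) :
    IsHomSol (m ^ 2 - 1 / 4) (zeta k) (zetaDeriv k) where
  hasDerivAt _ hx := hasDerivAt_zeta k hx
  hasDerivAt_deriv x hx := by
    rw [← hk]
    exact hasDerivAt_zetaDeriv k hx
  memLp := by
    have hm : AEStronglyMeasurable (zeta k) (volume.restrict (Ioc (0 : ℝ) 2)) :=
      ((continuousOn_zeta k).mono fun x hx => hx.1).aestronglyMeasurable measurableSet_Ioc
    rw [memLp_two_iff_integrable_sq_norm hm]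
    have h1 : IntervalIntegrable (fun x : ℝ => x ^ (1 + 2 * k.re)) volume 0 2 :=
      intervalIntegral.intervalIntegrable_rpow' (by linarith)
    rw [intervalIntegrable_iff_integrableOn_Ioc_of_le (by norm_num)] at h1
    refine h1.congr_fun (fun x hx => ?_) measurableSet_Ioc
    simp only
    rw [norm_zeta k hx.1, ← Real.rpow_natCast, ← Real.rpow_mul hx.1.le]
    congr 1
    push_cast
    ring

theorem wronskian_zeta (m : ℂ) {x : ℝ} (hx : 0 < x) :
    zeta m x * zetaDeriv (-m) x - zetaDeriv m x * zeta (-m) x = -(2 * m) := by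
  have h0 : (x : ℂ) ≠ 0 := by exact_mod_cast hx.ne'
  have h1 : (x : ℂ) ^ (1 / 2 + m) * (x : ℂ) ^ (1 / 2 + -m) = x := by
    rw [← Complex.cpow_add _ _ h0, show (1 / 2 + m + (1 / 2 + -m) : ℂ) = 1 by ring, Complex.cpow_one]
  simp only [zeta, zetaDeriv, Complex.cpow_sub _ _ h0, Complex.cpow_one]
  generalize (x : ℂ) ^ (1 / 2 + m) = A at *
  generalize (x : ℂ) ^ (1 / 2 + -m) = B at *
  field_simp
  linear_combination (-4 * m) * h1

theorem zeta_scale (m : ℂ) (τ : ℝ) {x : ℝ} (hx : 0 < x) :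
    zeta m x = Complex.exp (-(τ * (1 / 2 + m))) * zeta m (Real.exp τ * x) := by
  have h0 : (x : ℂ) ≠ 0 := by exact_mod_cast hx.ne'
  rw [zeta, zeta, Complex.ofReal_mul, Complex.mul_cpow_ofReal_nonneg (Real.exp_pos τ).le hx.le,
    ← mul_assoc, Complex.ofReal_exp, Complex.cpow_def_of_ne_zero (Complex.exp_ne_zero _),
    ← Complex.ofReal_exp, ← Complex.ofReal_log (Real.exp_pos τ).le, Real.log_exp,
    ← Complex.exp_add, neg_add_cancel, Complex.exp_zero, one_mul]

theorem zeta_ofReal (m : ℝ) {x : ℝ} (hx : 0 < x) : zeta m x = ((x ^ (1 / 2 + m) : ℝ) : ℂ) := by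
  rw [zeta, Complex.ofReal_cpow hx.le]
  push_cast
  rfl

/-- The function `x^{1/2} ln x`. -/
noncomputable def sqrtLog (x : ℝ) : ℂ := ((x ^ (1 / 2 : ℝ) * Real.log x : ℝ) : ℂ)

/-- The derivative of `x^{1/2} ln x`. -/
noncomputable def sqrtLogDeriv (x : ℝ) : ℂ := zetaDeriv 0 x * Real.log x + zeta 0 x / x

theorem sqrtLog_eq {x : ℝ} (hx : 0 < x) : sqrtLog x = zeta 0 x * Real.log x := by
  have := zeta_ofReal 0 hx
  simp only [Complex.ofReal_zero, add_zero] at this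
  rw [this, sqrtLog, Complex.ofReal_mul]

theorem hasDerivAt_log_ofReal {x : ℝ} (hx : 0 < x) :
    HasDerivAt (fun y : ℝ => (Real.log y : ℂ)) ((x : ℂ)⁻¹) x := by
  simpa using (Real.hasDerivAt_log hx.ne').ofReal_comp

theorem isHomSol_sqrtLog : IsHomSol ((0 : ℂ) ^ 2 - 1 / 4) sqrtLog sqrtLogDeriv where
  hasDerivAt x hx := by
    have h := (hasDerivAt_zeta 0 hx).mul (hasDerivAt_log_ofReal hx)
    refine (h.congr_of_eventuallyEq ?_).congr_deriv ?_
    · filter_upwards [Ioi_mem_nhds hx] with y hy using sqrtLog_eq hy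
    · rw [sqrtLogDeriv]
      ring
  hasDerivAt_deriv x hx := by
    have h0 : (x : ℂ) ≠ 0 := by exact_mod_cast hx.ne'
    have h := ((hasDerivAt_zetaDeriv 0 hx).mul (hasDerivAt_log_ofReal hx)).add
      ((hasDerivAt_zeta 0 hx).div (Complex.ofRealCLM.hasDerivAt (x := x)) (by simpa using h0))
    refine h.congr_deriv ?_
    rw [sqrtLog_eq hx]
    simp only [zeta, zetaDeriv, Complex.cpow_sub _ _ h0, Complex.cpow_one,
      Complex.ofRealCLM_apply, Complex.ofReal_one]
    field_simp
    ring
  memLp := by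
    -- Writing `√x log x` as `2 √x log √x` exhibits it as a continuous function up to the origin,
    -- hence bounded on `[0, 2]`.
    have hc : Continuous fun x : ℝ => ((2 * (√x * Real.log √x) : ℝ) : ℂ) :=
      Complex.continuous_ofReal.comp
        (continuous_const.mul (Real.continuous_mul_log.comp Real.continuous_sqrt))
    obtain ⟨C, hC⟩ := (isCompact_Icc (a := (0 : ℝ)) (b := 2)).exists_bound_of_continuousOn
      hc.continuousOn
    have h1 : MemLp (fun x : ℝ => ((2 * (√x * Real.log √x) : ℝ) : ℂ)) 2
        (volume.restrict (Ioc (0 : ℝ) 2)) :=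
      MemLp.of_bound hc.aestronglyMeasurable C ((ae_restrict_iff' measurableSet_Ioc).2
        (Eventually.of_forall fun x hx => hC x (Ioc_subset_Icc_self hx)))
    refine h1.ae_eq ((ae_restrict_iff' measurableSet_Ioc).2 (Eventually.of_forall fun x hx => ?_))
    rw [sqrtLog, ← Real.sqrt_eq_rpow, Real.log_sqrt hx.1.le]
    congr 1
    ring

theorem wronskian_sqrtLog {x : ℝ} (hx : 0 < x) :
    zeta 0 x * sqrtLogDeriv x - zetaDeriv 0 x * sqrtLog x = 1 := by
  have h0 : (x : ℂ) ≠ 0 := by exact_mod_cast hx.ne'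
  have h1 : (x : ℂ) ^ (1 / 2 : ℂ) * (x : ℂ) ^ (1 / 2 : ℂ) = x := by
    rw [← Complex.cpow_add _ _ h0, show (1 / 2 + 1 / 2 : ℂ) = 1 by ring, Complex.cpow_one]
  rw [sqrtLog_eq hx, sqrtLogDeriv]
  simp only [zeta, zetaDeriv, add_zero, Complex.cpow_sub _ _ h0, Complex.cpow_one]
  generalize (x : ℂ) ^ (1 / 2 : ℂ) = A at *
  field_simp
  linear_combination 2 * h1

/-! ### The case `m² ≥ 1` -/

theorem not_integrableOn_of_div_le {S : ℝ → ℝ} {C δ : ℝ} (hC : 0 < C) (hδ : 0 < δ)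
    (hS : IntegrableOn S (Ioo 0 δ)) (h : ∀ x ∈ Ioo 0 δ, C * x⁻¹ ≤ S x) : False := by
  have h1 : IntegrableOn (fun x : ℝ => C * x⁻¹) (Ioo 0 δ) := by
    refine Integrable.mono' hS (by fun_prop) ((ae_restrict_iff' measurableSet_Ioo).2
      (Eventually.of_forall fun x hx => ?_))
    rw [Real.norm_eq_abs, abs_of_nonneg (mul_nonneg hC.le (inv_nonneg.2 hx.1.le))]
    exact h x hx
  have h2 : IntegrableOn (fun x : ℝ => x⁻¹) (Ioo 0 δ) := by
    have : IntegrableOn (fun x : ℝ => C⁻¹ * (C * x⁻¹)) (Ioo 0 δ) := h1.const_mul C⁻¹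
    refine this.congr_fun (fun x _ => ?_) measurableSet_Ioo
    simp only
    rw [← mul_assoc, inv_mul_cancel₀ hC.ne', one_mul]
  have h3 : IntervalIntegrable (fun x : ℝ => x⁻¹) volume 0 δ :=
    (intervalIntegrable_iff_integrableOn_Ioo_of_le hδ.le).2 h2
  rw [intervalIntegrable_inv_iff] at h3
  rcases h3 with h3 | h3
  · exact hδ.ne h3
  · exact h3 left_mem_uIcc

/-- Against a homogeneous solution `y`, the potential terms in Green's formula cancel and the
Wronskian has derivative `-y g`. -/
theorem norm_wronskian_sub_le {c : ℂ} {y y1 F F1 g : ℝ → ℂ} (hy : SolvesODE c y y1 fun _ => 0)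
    (hF : SolvesODE c F F1 g) (hg : MemLp g 2 halfLine) {a b B : ℝ} (ha : 0 < a) (hab : a ≤ b)
    (hb : b ≤ 1) (hB : ∀ t ∈ Icc a b, ‖y t‖ ≤ B) :
    ‖(y b * F1 b - y1 b * F b) - (y a * F1 a - y1 a * F a)‖ ≤ B * ∫ t in Ioc 0 1, ‖g t‖ := by
  have ig : IntegrableOn g (Ioc 0 1) :=
    (hg.mono_measure (Measure.restrict_mono_set _ fun t ht => ht.1)).integrable (by norm_num)
  have ign : IntegrableOn (fun t => ‖g t‖) (Ioc 0 1) := ig.norm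
  have hsub : Ioc a b ⊆ Ioc 0 1 := fun t ht => ⟨ha.trans ht.1, ht.2.trans hb⟩
  have hB0 : 0 ≤ B := (norm_nonneg _).trans (hB a ⟨le_rfl, hab⟩)
  rw [IsSecondPrimitive.wronskian_sub hy hF ha (ha.trans_le hab)]
  have e1 : ∫ x in a..b, (y x * (c / (x : ℂ) ^ 2 * F x - g x) -
      (c / (x : ℂ) ^ 2 * y x - 0) * F x) = ∫ x in a..b, -(y x * g x) :=
    intervalIntegral.integral_congr fun x _ => by ring
  rw [e1]
  refine (intervalIntegral.norm_integral_le_of_norm_le hab (g := fun t => B * ‖g t‖)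
    (Eventually.of_forall fun t ht => ?_) ?_).trans ?_
  · rw [norm_neg, norm_mul]
    exact mul_le_mul_of_nonneg_right (hB t (Ioc_subset_Icc_self ht)) (norm_nonneg _)
  · rw [intervalIntegrable_iff_integrableOn_Ioc_of_le hab]
    exact (ign.mono_set hsub).const_mul B
  · rw [intervalIntegral.integral_of_le hab, integral_const_mul]
    refine mul_le_mul_of_nonneg_left ?_ hB0
    exact setIntegral_mono_set ign (Eventually.of_forall fun t => norm_nonneg _)
      (Eventually.of_forall hsub)

theorem solvesODE_zeta {m k : ℂ} (hk : k ^ 2 = m ^ 2) :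
    SolvesODE (m ^ 2 - 1 / 4) (zeta k) (zetaDeriv k) fun _ => 0 := by
  refine IsSecondPrimitive.of_hasDerivAt (fun x hx => hasDerivAt_zeta k hx) (fun x hx => ?_) ?_
  · rw [sub_zero, ← hk]
    exact hasDerivAt_zetaDeriv k hx
  · exact ((continuousOn_const_div_sq _).mul (continuousOn_zeta k)).sub continuousOn_const

theorem zeta_sq_le {k : ℝ} (hk : 1 ≤ k) {x : ℝ} (hx : 0 < x) (hx1 : x ≤ 1) :
    (x ^ (1 / 2 + k)) ^ 2 ≤ x ^ 3 := by
  rw [← Real.rpow_natCast, ← Real.rpow_mul hx.le, ← Real.rpow_natCast x 3]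
  exact Real.rpow_le_rpow_of_exponent_ge hx hx1 (by push_cast; linarith)

/-- The Wronskian divided by `ζ_k²` is the derivative of `H / ζ_k`. If `L ≠ 0`, this derivative is
of size at least `x^{-1-2k}` near `0`, and its increment over `[x, 2x]` forces `‖H x‖ + ‖H (2x)‖` to
dominate a multiple of `x^{1/2-k}`. For `k ≥ 1` the square of this is at least a multiple of `1 /
x`, contradicting `H ∈ L²`. -/
theorem tendsto_wronskian_zeta_eq_zero {m : ℂ} {k : ℝ} (hk : 1 ≤ k)
    {H H1 g : ℝ → ℂ} (hH : SolvesODE (m ^ 2 - 1 / 4) H H1 g) (h2 : MemLp H 2 halfLine) {L : ℂ}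
    (hL : Tendsto (fun x => zeta k x * H1 x - zetaDeriv k x * H x) (𝓝[>] 0) (𝓝 L)) : L = 0 := by
  by_contra hne
  have hpos : 0 < ‖L‖ := norm_pos_iff.2 hne
  set r : ℝ → ℝ := fun x => x ^ (1 / 2 + k) with hr
  have hr0 : ∀ x, 0 < x → 0 < r x := fun x hx => Real.rpow_pos_of_pos hx _
  have hzr : ∀ x, 0 < x → zeta k x = (r x : ℂ) := fun x hx => zeta_ofReal k hx
  -- Projecting onto the direction of `L` gives a real function, to which the mean value theorem
  -- applies, with derivative eventually at least `‖L‖² / 2` over `ζ_k²`.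
  set φ : ℝ → ℝ := fun x => (star L * (H x / zeta k x)).re with hφ
  have hφd : ∀ x, 0 < x → HasDerivAt φ
      ((star L * (zeta k x * H1 x - zetaDeriv k x * H x)).re / (r x) ^ 2) x := by
    intro x hx
    have hz : zeta k x ≠ 0 := by
      rw [hzr x hx]
      exact_mod_cast (hr0 x hx).ne'
    have hd := ((hH.hasDerivAt x hx).div (hasDerivAt_zeta k hx) hz).const_mul (star L)
    have hd2 := Complex.reCLM.hasFDerivAt.comp_hasDerivAt x hd
    refine hd2.congr_deriv ?_
    have : star L * ((H1 x * zeta k x - H x * zetaDeriv k x) / zeta k x ^ 2) =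
        star L * (zeta k x * H1 x - zetaDeriv k x * H x) / (((r x) ^ 2 : ℝ) : ℂ) := by
      rw [hzr x hx]
      push_cast
      ring
    rw [Complex.reCLM_apply, this, Complex.div_ofReal_re]
  have hev : ∀ᶠ x in 𝓝[>] (0 : ℝ),
      ‖L‖ ^ 2 / 2 < (star L * (zeta k x * H1 x - zetaDeriv k x * H x)).re := by
    have h1 : Tendsto (fun x => (star L * (zeta k x * H1 x - zetaDeriv k x * H x)).re) (𝓝[>] 0)
        (𝓝 (star L * L).re) := (Complex.continuous_re.tendsto _).comp (hL.const_mul _)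
    have h3 : (star L * L).re = ‖L‖ ^ 2 := by
      have h4 : star L * L = ((‖L‖ ^ 2 : ℝ) : ℂ) := by
        rw [Complex.ofReal_pow]
        exact Complex.conj_mul' L
      rw [h4, Complex.ofReal_re]
    rw [h3] at h1
    exact h1.eventually_const_lt (by nlinarith [pow_pos hpos 2])
  obtain ⟨ε, hε0, hε⟩ := mem_nhdsGT_iff_exists_Ioo_subset.1 hev
  set δ := min (ε / 2) 1 with hδ
  have hδ0 : 0 < δ := lt_min (half_pos hε0) one_pos
  -- Doubling factor: `r (2 x) = M r x`, so `r ≤ M r x` on `[x, 2x]`.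
  set M : ℝ := 2 ^ (1 / 2 + k) with hM
  have hM1 : 1 ≤ M := Real.one_le_rpow one_le_two (by linarith)
  have hM0 : 0 < M := by linarith
  -- What is left of `(‖L‖² / 2) x / (M r x)²` after dividing out the factor `‖L‖ / r x` of the
  -- upper bound for the increment.
  set C : ℝ := ‖L‖ / (2 * M ^ 2) with hC
  have hC0 : 0 < C := by positivity
  have hbound : ∀ x ∈ Ioo 0 δ, C ^ 2 * x⁻¹ ≤ 2 * (‖H (2 * x)‖ ^ 2 + ‖H x‖ ^ 2) := by
    intro x hx
    have hx0 := hx.1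
    have hxδ : x < ε / 2 := hx.2.trans_le (min_le_left _ _)
    have hx1 : x ≤ 1 := hx.2.le.trans (min_le_right _ _)
    have h2x : 0 < 2 * x := by linarith
    have hr2 : r (2 * x) = M * r x := Real.mul_rpow zero_le_two hx0.le
    obtain ⟨ξ, hξ, hslope⟩ := exists_hasDerivAt_eq_slope φ _ (show x < 2 * x by linarith)
      (fun t ht => (hφd t (hx0.trans_le ht.1)).continuousAt.continuousWithinAt)
      (fun t ht => hφd t (hx0.trans ht.1))
    have hξ0 : 0 < ξ := hx0.trans hξ.1
    have hξr : r ξ ≤ M * r x := by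
      rw [← hr2]
      exact Real.rpow_le_rpow hξ0.le hξ.2.le (by linarith)
    have hnum : ‖L‖ ^ 2 / 2 < (star L * (zeta k ξ * H1 ξ - zetaDeriv k ξ * H ξ)).re :=
      hε ⟨hξ0, by linarith [hξ.2]⟩
    have hlow : ‖L‖ ^ 2 / 2 / (M * r x) ^ 2 ≤ (φ (2 * x) - φ x) / (2 * x - x) := by
      rw [← hslope]
      exact div_le_div₀ (by linarith [sq_nonneg ‖L‖]) hnum.le (pow_pos (hr0 ξ hξ0) 2)
        (pow_le_pow_left₀ (hr0 ξ hξ0).le hξr 2)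
    have hφn : ∀ t, 0 < t → |φ t| ≤ ‖L‖ * (‖H t‖ / r t) := by
      intro t ht
      refine (Complex.abs_re_le_norm _).trans ?_
      rw [norm_mul, norm_star, norm_div, hzr t ht, Complex.norm_real, Real.norm_eq_abs,
        abs_of_pos (hr0 t ht)]
    have hrx := hr0 x hx0
    have hup : φ (2 * x) - φ x ≤ ‖L‖ * ((‖H (2 * x)‖ + ‖H x‖) / r x) := by
      have a1 := (le_abs_self _).trans (hφn (2 * x) h2x)
      have a2 := (neg_le_abs _).trans (hφn x hx0)
      have a3 : ‖H (2 * x)‖ / r (2 * x) ≤ ‖H (2 * x)‖ / r x := by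
        refine div_le_div_of_nonneg_left (norm_nonneg _) hrx ?_
        rw [hr2]
        exact le_mul_of_one_le_left hrx.le hM1
      have a4 := mul_le_mul_of_nonneg_left a3 hpos.le
      rw [add_div, mul_add]
      linarith
    have hmain : C * (x / r x) ≤ ‖H (2 * x)‖ + ‖H x‖ := by
      rw [le_div_iff₀ (by linarith)] at hlow
      have b1 := hlow.trans hup
      have b2 : ‖L‖ ^ 2 / 2 / (M * r x) ^ 2 * (2 * x - x) = ‖L‖ * (C * (x / r x) / r x) := by
        rw [hC]
        field_simp
        ring
      rw [b2] at b1
      exact (div_le_div_iff_of_pos_right hrx).1 (le_of_mul_le_mul_left b1 hpos)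
    have hsq : x⁻¹ ≤ (x / r x) ^ 2 := by
      rw [div_pow, le_div_iff₀ (pow_pos hrx 2)]
      have := zeta_sq_le hk hx0 hx1
      calc x⁻¹ * r x ^ 2 ≤ x⁻¹ * x ^ 3 := mul_le_mul_of_nonneg_left this (by positivity)
        _ = x ^ 2 := by field_simp
    calc C ^ 2 * x⁻¹ ≤ C ^ 2 * (x / r x) ^ 2 := mul_le_mul_of_nonneg_left hsq (by positivity)
      _ = (C * (x / r x)) ^ 2 := by ring
      _ ≤ (‖H (2 * x)‖ + ‖H x‖) ^ 2 := pow_le_pow_left₀ (by positivity) hmain 2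
      _ ≤ 2 * (‖H (2 * x)‖ ^ 2 + ‖H x‖ ^ 2) := by
          linarith [sq_nonneg (‖H (2 * x)‖ - ‖H x‖)]
  have iH := integrableOn_norm_sq_of_memLp h2
  have iH2 : IntegrableOn (fun x => ‖H (2 * x)‖ ^ 2) (Ioi 0) := by
    have := (integrableOn_Ioi_comp_mul_left_iff (fun x => ‖H x‖ ^ 2) 0 two_pos).2 (by simpa using iH)
    exact this
  have iS : IntegrableOn (fun x => 2 * (‖H (2 * x)‖ ^ 2 + ‖H x‖ ^ 2)) (Ioi 0) :=
    (iH2.add iH).const_mul 2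
  exact not_integrableOn_of_div_le (pow_pos hC0 2) hδ0 (iS.mono_set fun x hx => hx.1) hbound

/-- The solution `ζ_{-k}` is not square integrable at `0`, so it defines no boundary functional and
its Wronskians are estimated instead. Those with `ζ_k` tend to `0`, so integrating their derivative
from `0` makes them `O(x^{1/2+k})`. Those with `ζ_{-k}`, integrated from `x` to `1`, are `O(1 +
x^{1/2-k})`. The products in the Wronskian identity are then `O(x)`. -/
theorem bdry_eq_zero_of_one_le {m : ℂ} {k : ℝ} (hk : 1 ≤ k) (hkm : (k : ℂ) ^ 2 = m ^ 2)
    {p q : L2 × L2} (hp : p ∈ maxGraph m) (hq : q ∈ maxGraph m) : bdry p q = 0 := by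
  obtain ⟨F, F1, f1, f2⟩ := exists_solvesODE hp
  obtain ⟨H, H1, h1, h2⟩ := exists_solvesODE hq
  have hkm' : (-(k : ℂ)) ^ 2 = m ^ 2 := by rw [neg_sq, hkm]
  have hu := isHomSol_zeta hkm (by rw [Complex.ofReal_re]; linarith)
  have hU := solvesODE_zeta hkm
  have hV := solvesODE_zeta hkm'
  have key : ∀ {p : L2 × L2} {F F1 : ℝ → ℂ}, p.1 =ᵐ[halfLine] F →
      SolvesODE (m ^ 2 - 1 / 4) F F1 p.2 →
      ∃ C, 0 ≤ C ∧ ∀ x ∈ Ioo (0 : ℝ) 1,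
        ‖zeta k x * F1 x - zetaDeriv k x * F x‖ ≤ C * x ^ (1 / 2 + k) ∧
        ‖zeta (-k) x * F1 x - zetaDeriv (-k) x * F x‖ ≤ C * (1 + x ^ (1 / 2 - k)) := by
    intro p F F1 f1 f2
    have hL2 : MemLp F 2 halfLine := (Lp.memLp p.1).ae_eq f1
    have hlim := hu.tendsto_bdry f1 f2
    rw [tendsto_wronskian_zeta_eq_zero hk f2 hL2 hlim] at hlim
    set G := ∫ t in Ioc 0 1, ‖p.2 t‖ with hG
    have hG0 : 0 ≤ G := integral_nonneg fun _ => norm_nonneg _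
    set K := ‖zeta (-k) 1 * F1 1 - zetaDeriv (-k) 1 * F 1‖ with hK
    have hK0 : 0 ≤ K := norm_nonneg _
    refine ⟨G + K, by positivity, fun x hx => ⟨?_, ?_⟩⟩
    · have h3 : ‖(zeta k x * F1 x - zetaDeriv k x * F x) - 0‖ ≤ x ^ (1 / 2 + k) * G := by
        refine le_of_tendsto (hlim.const_sub _).norm ?_
        filter_upwards [Ioo_mem_nhdsGT hx.1] with a ha
        refine norm_wronskian_sub_le hU f2 (Lp.memLp p.2) ha.1 ha.2.le hx.2.le fun t ht => ?_
        rw [norm_zeta _ (ha.1.trans_le ht.1), Complex.ofReal_re]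
        exact Real.rpow_le_rpow (ha.1.le.trans ht.1) ht.2 (by linarith)
      rw [sub_zero] at h3
      have h4 : 0 ≤ x ^ (1 / 2 + k) := Real.rpow_nonneg hx.1.le _
      calc _ ≤ x ^ (1 / 2 + k) * G := h3
        _ ≤ (G + K) * x ^ (1 / 2 + k) := by linarith [mul_nonneg hK0 h4]
    · have h3 := norm_wronskian_sub_le hV f2 (Lp.memLp p.2) hx.1 hx.2.le le_rfl
        (B := x ^ (1 / 2 - k)) fun t ht => by
          rw [norm_zeta _ (hx.1.trans_le ht.1), Complex.neg_re, Complex.ofReal_re, ← sub_eq_add_neg]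
          exact Real.rpow_le_rpow_of_nonpos hx.1 ht.1 (by linarith)
      have h4 : 0 ≤ x ^ (1 / 2 - k) := Real.rpow_nonneg hx.1.le _
      have h5 := norm_sub_norm_le (zeta (-k) x * F1 x - zetaDeriv (-k) x * F x)
        (zeta (-k) 1 * F1 1 - zetaDeriv (-k) 1 * F 1)
      have h6 := norm_sub_rev (zeta (-k) x * F1 x - zetaDeriv (-k) x * F x)
        (zeta (-k) 1 * F1 1 - zetaDeriv (-k) 1 * F 1)
      calc _ ≤ x ^ (1 / 2 - k) * G + K := by linarith
        _ ≤ (G + K) * (1 + x ^ (1 / 2 - k)) := by nlinarith [mul_nonneg hK0 h4]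
  obtain ⟨C, hC0, hC⟩ := key f1 f2
  obtain ⟨D, hD0, hD⟩ := key h1 h2
  have hw : (2 * (k : ℂ)) ≠ 0 := by
    refine mul_ne_zero two_ne_zero ?_
    exact_mod_cast (show k ≠ 0 by linarith)
  have ht := ((tendsto_wronskian_bdry f1 f2 h1 h2).mul_const (2 * (k : ℂ)))
  have h0 : Tendsto (fun x => (F x * H1 x - F1 x * H x) * (2 * (k : ℂ))) (𝓝[>] 0) (𝓝 0) := by
    have hx0 : Tendsto (fun x : ℝ => 4 * (C * D) * x) (𝓝[>] 0) (𝓝 0) := by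
      have : Tendsto (fun x : ℝ => 4 * (C * D) * x) (𝓝 0) (𝓝 (4 * (C * D) * 0)) :=
        (continuous_const_mul _).tendsto 0
      rw [mul_zero] at this
      exact this.mono_left nhdsWithin_le_nhds
    refine squeeze_zero_norm' ?_ hx0
    filter_upwards [Ioo_mem_nhdsGT one_pos] with x hx
    obtain ⟨c1, c2⟩ := hC x hx
    obtain ⟨d1, d2⟩ := hD x hx
    have hid : (F x * H1 x - F1 x * H x) * (2 * (k : ℂ)) =
        (zeta (-k) x * F1 x - zetaDeriv (-k) x * F x) * (zeta k x * H1 x - zetaDeriv k x * H x) -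
        (zeta k x * F1 x - zetaDeriv k x * F x) *
          (zeta (-k) x * H1 x - zetaDeriv (-k) x * H x) := by
      linear_combination (F x * H1 x - F1 x * H x) * wronskian_zeta (k : ℂ) hx.1
    have e1 : x ^ (1 / 2 + k) * x ^ (1 / 2 - k) = x := by
      rw [← Real.rpow_add hx.1, show (1 / 2 + k + (1 / 2 - k)) = 1 by ring, Real.rpow_one]
    have e2 : x ^ (1 / 2 + k) ≤ x := by
      conv_rhs => rw [← Real.rpow_one x]
      exact Real.rpow_le_rpow_of_exponent_ge hx.1 hx.2.le (by linarith)
    have e3 : x ^ (1 / 2 + k) * (1 + x ^ (1 / 2 - k)) ≤ 2 * x := by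
      rw [mul_add, e1]
      linarith
    have e4 : 0 ≤ x ^ (1 / 2 - k) := Real.rpow_nonneg hx.1.le _
    have e5 : 0 ≤ x ^ (1 / 2 + k) := Real.rpow_nonneg hx.1.le _
    rw [hid]
    refine (norm_sub_le _ _).trans ?_
    rw [norm_mul, norm_mul]
    have g1 := mul_le_mul c2 d1 (norm_nonneg _) (by positivity)
    have g2 := mul_le_mul c1 d2 (norm_nonneg _) (by positivity)
    have g3 := mul_le_mul_of_nonneg_left e3 (mul_nonneg hC0 hD0)
    calc _ ≤ C * (1 + x ^ (1 / 2 - k)) * (D * x ^ (1 / 2 + k)) +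
          C * x ^ (1 / 2 + k) * (D * (1 + x ^ (1 / 2 - k))) := add_le_add g1 g2
      _ = 2 * (C * D * (x ^ (1 / 2 + k) * (1 + x ^ (1 / 2 - k)))) := by ring
      _ ≤ 4 * (C * D) * x := by linarith
  exact (mul_eq_zero.1 (tendsto_nhds_unique ht h0)).resolve_right hw

theorem LMin_eq_LMax_of_one_le {m : ℂ} {k : ℝ} (hk : 1 ≤ k) (hkm : (k : ℂ) ^ 2 = m ^ 2) :
    LMin m = LMax m := by
  have hm : star (m ^ 2) = m ^ 2 := by
    rw [← hkm, star_pow]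
    congr 1
    exact Complex.conj_ofReal k
  refine LinearPMap.eq_of_eq_graph (SetLike.ext fun p => ?_)
  rw [mem_LMin_graph_iff hm, LMax_graph]
  exact ⟨fun h => h.1, fun h => ⟨h, fun q hq => bdry_eq_zero_of_one_le hk hkm hq h⟩⟩

/-! ### Bases of solutions -/

theorem star_sq_of_eq_ofReal {m : ℂ} {s : ℝ} (h : m ^ 2 = (s : ℂ)) : star (m ^ 2) = m ^ 2 := by
  rw [h]
  exact Complex.conj_ofReal s

theorem mem_LExt_graph_of_combination {m : ℂ} {u u1 v v1 y : ℝ → ℂ}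
    (hu : IsHomSol (m ^ 2 - 1 / 4) u u1) (hv : IsHomSol (m ^ 2 - 1 / 4) v v1) {α β : ℂ}
    (h : ∀ x, 0 < x → y x = α * u x + β * v x) (p : L2 × L2) :
    p ∈ (LExt m y).graph ↔ p ∈ maxGraph m ∧ α * bdry hu.pair p + β * bdry hv.pair p = 0 := by
  have hy := ((hu.const_mul α).add (hv.const_mul β)).congr (v := y) h
  rw [hy.mem_LExt_graph]
  exact and_congr_right fun hp => by rw [IsHomSol.bdry_pair_eq_of_combination hu hv hy h hp]

theorem IsHomSol.isRealBoundaryBasis {m : ℂ} {u u1 v v1 : ℝ → ℂ}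
    (hm : star (m ^ 2) = m ^ 2) (hu : IsHomSol (m ^ 2 - 1 / 4) u u1)
    (hv : IsHomSol (m ^ 2 - 1 / 4) v v1) {w : ℂ} (hw0 : w ≠ 0)
    (hw : ∀ x, 0 < x → u x * v1 x - u1 x * v x = w) (hur : ∀ x, 0 < x → star (u x) = u x)
    (hvr : ∀ x, 0 < x → star (v x) = v x) : IsRealBoundaryBasis m hu.pair hv.pair w where
  toIsBoundaryBasis := hu.isBoundaryBasis hv hw0 hw
  real := hm
  left_real := hu.conjPair_pair hm hu hur
  right_real := hv.conjPair_pair hm hv hvr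

theorem isBoundaryBasis_zeta {m k : ℂ} (hk : k ^ 2 = m ^ 2) (hk' : (-k) ^ 2 = m ^ 2)
    (h1 : -1 < k.re) (h2 : -1 < (-k).re) (h0 : k ≠ 0) :
    IsBoundaryBasis m (isHomSol_zeta hk h1).pair (isHomSol_zeta hk' h2).pair (-(2 * k)) :=
  (isHomSol_zeta hk h1).isBoundaryBasis _ (neg_ne_zero.2 (mul_ne_zero two_ne_zero h0))
    fun _ hx => wronskian_zeta k hx

theorem bdry_zeta_dilPair {m k : ℂ} (hk : k ^ 2 = m ^ 2) (h1 : -1 < k.re) (τ : ℝ) {p : L2 × L2}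
    (hp : p ∈ maxGraph m) :
    bdry (isHomSol_zeta hk h1).pair (dilPair τ p) =
      Complex.exp (-(τ * (1 / 2 + k))) * (Real.exp τ : ℂ) * (Real.exp (τ / 2) : ℂ) *
        bdry (isHomSol_zeta hk h1).pair p :=
  (isHomSol_zeta hk h1).bdry_dilPair _ (fun _ hx => zeta_scale k τ hx) hp

theorem mem_Hop_graph_zeta {m k : ℂ} (hm : star (m ^ 2) = m ^ 2) (hk : k ^ 2 = m ^ 2)
    (hk' : (-k) ^ 2 = m ^ 2) (h1 : -1 < k.re) (h2 : -1 < (-k).re) (h0 : k ≠ 0) (p : L2 × L2) :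
    p ∈ (Hop k).graph ↔ p ∈ maxGraph m ∧ bdry (isHomSol_zeta hk h1).pair p = 0 :=
  mem_Hop_graph hm hk _ (isBoundaryBasis_zeta hk hk' h1 h2 h0) p

theorem mem_Hop_neg_graph_zeta {m k : ℂ} (hm : star (m ^ 2) = m ^ 2) (hk : k ^ 2 = m ^ 2)
    (hk' : (-k) ^ 2 = m ^ 2) (h1 : -1 < k.re) (h2 : -1 < (-k).re) (h0 : k ≠ 0) (p : L2 × L2) :
    p ∈ (Hop (-k)).graph ↔ p ∈ maxGraph m ∧ bdry (isHomSol_zeta hk' h2).pair p = 0 :=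
  mem_Hop_graph hm hk' _ (isBoundaryBasis_zeta hk hk' h1 h2 h0).symm p

/-- Otherwise `e^{2kσ} = 1` for every real `σ`, and the derivative at `0` gives `k = 0`. For
imaginary `k` some nonzero `σ` do give equality, so `σ` cannot be arbitrary. -/
theorem exists_exp_ne {k : ℂ} (h0 : k ≠ 0) :
    ∃ σ : ℝ, Complex.exp (-(σ * (1 / 2 + k))) ≠ Complex.exp (-(σ * (1 / 2 + -k))) := by
  by_contra! hcon
  have hone : ∀ σ : ℝ, Complex.exp ((σ : ℂ) * (2 * k)) = 1 := by
    intro σ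
    have h : Complex.exp ((σ : ℂ) * (2 * k)) =
        Complex.exp (-(σ * (1 / 2 + -k))) / Complex.exp (-(σ * (1 / 2 + k))) := by
      rw [← Complex.exp_sub]
      congr 1
      ring
    rw [h, hcon σ, div_self (Complex.exp_ne_zero _)]
  have hd : HasDerivAt (fun σ : ℝ => Complex.exp ((σ : ℂ) * (2 * k))) (2 * k) 0 := by
    have h := ((Complex.ofRealCLM.hasDerivAt (x := 0)).mul_const (2 * k)).cexp
    simpa using h
  simp_rw [hone] at hd
  exact h0 (by simpa using hd.unique (hasDerivAt_const (0 : ℝ) (1 : ℂ)))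

theorem setOf_homogeneous_zeta {m k : ℂ} (hm : star (m ^ 2) = m ^ 2) (hk : k ^ 2 = m ^ 2)
    (hk' : (-k) ^ 2 = m ^ 2) (h1 : -1 < k.re) (h2 : -1 < (-k).re) (h0 : k ≠ 0) :
    {T : L2 →ₗ.[ℂ] L2 | IsStrictExtension m T ∧ IsHomogeneous (-2) T} = {Hop k, Hop (-k)} := by
  obtain ⟨σ, hσ⟩ := exists_exp_ne h0
  refine (isBoundaryBasis_zeta hk hk' h1 h2 h0).setOf_homogeneous_of_diagonal hm
    (mem_Hop_graph_zeta hm hk hk' h1 h2 h0) (mem_Hop_neg_graph_zeta hm hk hk' h1 h2 h0)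
    (fun τ p hp => bdry_zeta_dilPair hk h1 τ hp) (fun τ p hp => bdry_zeta_dilPair hk' h2 τ hp)
    (σ := σ) ?_
  have e1 : (Real.exp σ : ℂ) ≠ 0 := by exact_mod_cast (Real.exp_pos σ).ne'
  have e2 : (Real.exp (σ / 2) : ℂ) ≠ 0 := by exact_mod_cast (Real.exp_pos (σ / 2)).ne'
  exact fun h => hσ (mul_right_cancel₀ e1 (mul_right_cancel₀ e2 h))

theorem Hop_ne_Hop_neg {m k : ℂ} (hm : star (m ^ 2) = m ^ 2) (hk : k ^ 2 = m ^ 2)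
    (hk' : (-k) ^ 2 = m ^ 2) (h1 : -1 < k.re) (h2 : -1 < (-k).re) (h0 : k ≠ 0) :
    Hop k ≠ Hop (-k) := by
  intro heq
  have h := isBoundaryBasis_zeta hk hk' h1 h2 h0
  have hmem := (mem_Hop_graph_zeta hm hk hk' h1 h2 h0 _).2 ⟨h.left_mem, bdry_self _⟩
  rw [heq, mem_Hop_neg_graph_zeta hm hk hk' h1 h2 h0, h.bdry_right_left] at hmem
  exact h.ne_zero (neg_eq_zero.1 hmem.2)

/-! ### The case `m² ≥ 1` -/

theorem Hop_eq_LMax {m : ℂ} (h : LMin m = LMax m) : Hop m = LMax m := by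
  refine LinearPMap.eq_of_eq_graph (SetLike.ext fun p => ?_)
  rw [Hop, mem_graph_domRestrict, LMax_graph]
  refine and_iff_right_of_imp fun hp => ?_
  rw [← LMax_graph, ← h] at hp
  exact (le_sup_left : (LMin m).domain ≤ _) (LinearPMap.mem_domain_of_mem_graph hp)

/-! ### The case `0 < m < 1` -/

/-- The solution with exponent `1/2 - k` comes first because it is the one multiplied by `cos θ` in
`uReal`. -/
theorem isRealBoundaryBasis_zeta {m : ℂ} {k : ℝ} (hk : (k : ℂ) ^ 2 = m ^ 2)
    (hk' : (-(k : ℂ)) ^ 2 = m ^ 2) (h1 : -1 < (k : ℂ).re) (h2 : -1 < (-(k : ℂ)).re) (h0 : k ≠ 0) :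
    IsRealBoundaryBasis m (isHomSol_zeta hk' h2).pair (isHomSol_zeta hk h1).pair (2 * k) := by
  have hstar : ∀ (r : ℝ) (x : ℝ), 0 < x → star (zeta r x) = zeta r x := fun r x hx => by
    rw [zeta_ofReal r hx]
    exact Complex.conj_ofReal _
  refine (isHomSol_zeta hk' h2).isRealBoundaryBasis
    (star_sq_of_eq_ofReal (s := k ^ 2) (by rw [← hk]; push_cast; rfl)) _
    (mul_ne_zero two_ne_zero (Complex.ofReal_ne_zero.2 h0)) (fun x hx => ?_) (fun x hx => ?_)
    (hstar k)
  · linear_combination -wronskian_zeta (k : ℂ) hx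
  · have := hstar (-k) x hx
    rwa [Complex.ofReal_neg] at this

theorem uReal_eq (m θ : ℝ) {x : ℝ} (hx : 0 < x) :
    uReal m θ x = (Real.cos θ : ℂ) * zeta (-(m : ℂ)) x + (Real.sin θ : ℂ) * zeta m x := by
  rw [← Complex.ofReal_neg, zeta_ofReal _ hx, zeta_ofReal _ hx, uReal, ← sub_eq_add_neg]
  push_cast
  ring

/-! ### The case `m = 0` -/

theorem uZero_eq (θ : ℝ) {x : ℝ} (hx : 0 < x) :
    uZero θ x = (Real.cos θ : ℂ) * sqrtLog x + (Real.sin θ : ℂ) * zeta 0 x := by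
  have h := zeta_ofReal 0 hx
  rw [Complex.ofReal_zero, add_zero] at h
  rw [sqrtLog_eq hx, h, uZero]
  push_cast
  ring

theorem isHomSol_zeta_zero : IsHomSol ((0 : ℂ) ^ 2 - 1 / 4) (zeta 0) (zetaDeriv 0) :=
  isHomSol_zeta rfl (by simp)

theorem isRealBoundaryBasis_sqrtLog :
    IsRealBoundaryBasis 0 isHomSol_sqrtLog.pair isHomSol_zeta_zero.pair (-1) := by
  have hz : ∀ x : ℝ, 0 < x → star (zeta 0 x) = zeta 0 x := fun x hx => by
    have h := zeta_ofReal 0 hx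
    rw [Complex.ofReal_zero] at h
    rw [h]
    exact Complex.conj_ofReal _
  refine isHomSol_sqrtLog.isRealBoundaryBasis (by simp) _ (neg_ne_zero.2 one_ne_zero)
    (fun x hx => ?_) (fun x hx => ?_) hz
  · linear_combination -wronskian_sqrtLog hx
  · rw [sqrtLog_eq hx, star_mul', hz x hx]
    congr 1
    exact Complex.conj_ofReal _

/-- Since `ln x = ln (e^τ x) - τ`, rescaling `x^{1/2} ln x` produces a multiple of `x^{1/2}`: this
`-τ` is the off-diagonal entry of the Jordan block. -/
theorem bdry_sqrtLog_dilPair (τ : ℝ) {p : L2 × L2} (hp : p ∈ maxGraph 0) :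
    bdry isHomSol_sqrtLog.pair (dilPair τ p) =
      Complex.exp (-(τ * (1 / 2 + 0))) * (Real.exp τ : ℂ) * (Real.exp (τ / 2) : ℂ) *
        (1 * bdry isHomSol_sqrtLog.pair p + -τ * bdry isHomSol_zeta_zero.pair p) := by
  have hy := (isHomSol_sqrtLog.const_mul 1).add (isHomSol_zeta_zero.const_mul (-(τ : ℂ)))
  rw [isHomSol_sqrtLog.bdry_dilPair hy (fun x hx => ?_) hp,
    IsHomSol.bdry_pair_eq_of_combination isHomSol_sqrtLog isHomSol_zeta_zero hy
      (fun _ _ => rfl) hp]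
  rw [sqrtLog_eq hx, sqrtLog_eq (mul_pos (Real.exp_pos τ) hx),
    Real.log_mul (Real.exp_pos τ).ne' hx.ne', Real.log_exp, zeta_scale 0 τ hx]
  push_cast
  ring

theorem mem_Hop_zero_graph (p : L2 × L2) :
    p ∈ (Hop 0).graph ↔ p ∈ maxGraph 0 ∧ bdry isHomSol_zeta_zero.pair p = 0 :=
  mem_Hop_graph (by simp) rfl _ isRealBoundaryBasis_sqrtLog.symm p

theorem setOf_homogeneous_zero :
    {T : L2 →ₗ.[ℂ] L2 | IsStrictExtension 0 T ∧ IsHomogeneous (-2) T} = {Hop 0} := by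
  -- The basis is swapped so that the eigenfunctional, that of `ζ_0`, comes first. At `σ = 1` the
  -- off-diagonal entry is minus the common eigenvalue.
  refine isRealBoundaryBasis_sqrtLog.symm.setOf_homogeneous_of_jordan (by simp) mem_Hop_zero_graph
    (fun τ p hp => bdry_zeta_dilPair rfl (by simp) τ hp) (σ := 1)
    (k := -(Complex.exp (-((1 : ℝ) * (1 / 2 + 0))) * (Real.exp 1 : ℂ) * (Real.exp (1 / 2) : ℂ)))
    ?_ fun p hp => ?_
  · refine neg_ne_zero.2 (mul_ne_zero (mul_ne_zero (Complex.exp_ne_zero _) ?_) ?_)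
    · exact_mod_cast (Real.exp_pos _).ne'
    · exact_mod_cast (Real.exp_pos _).ne'
  · rw [bdry_sqrtLog_dilPair 1 hp]
    push_cast
    ring

/-! ### The case `m = iμ` -/

/-- For imaginary `m`, conjugation exchanges the two exponents. Hence `sqrtCos` and `sqrtSin` are
real while the two dilation eigenlines are not. -/
theorem star_zeta {m : ℂ} (hm : star m = -m) {x : ℝ} (hx : 0 < x) :
    star (zeta m x) = zeta (-m) x := by
  have h0 : (x : ℂ) ≠ 0 := by exact_mod_cast hx.ne'
  have hc : star (1 / 2 + m) = 1 / 2 + -m := by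
    rw [star_add, hm]
    simp
  rw [zeta, zeta, ← hc]
  have := Complex.cpow_conj (x : ℂ) (1 / 2 + m) (by
    rw [Complex.arg_ofReal_of_nonneg hx.le]
    exact Real.pi_pos.ne)
  rw [Complex.conj_ofReal] at this
  exact this.symm

theorem zeta_eq_zeta_zero_mul_exp (m : ℂ) {x : ℝ} (hx : 0 < x) :
    zeta m x = zeta 0 x * Complex.exp (Real.log x * m) := by
  have h0 : (x : ℂ) ≠ 0 := by exact_mod_cast hx.ne'
  rw [zeta, zeta, Complex.cpow_def_of_ne_zero h0, Complex.cpow_def_of_ne_zero h0,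
    ← Complex.exp_add, Complex.ofReal_log hx.le]
  congr 1
  ring

/-- `x^{1/2} cos(μ ln x)` as a combination of `ζ_m` and `ζ_{-m}`, for `m = iμ`. -/
noncomputable def sqrtCos (m : ℂ) (x : ℝ) : ℂ := 1 / 2 * zeta m x + 1 / 2 * zeta (-m) x

/-- `x^{1/2} sin(μ ln x)` as a combination of `ζ_m` and `ζ_{-m}`, for `m = iμ`. -/
noncomputable def sqrtSin (m : ℂ) (x : ℝ) : ℂ := -(Complex.I / 2) * zeta m x + Complex.I / 2 * zeta (-m) x

theorem isHomSol_sqrtCos {m k : ℂ} (hk : k ^ 2 = m ^ 2) (hk' : (-k) ^ 2 = m ^ 2)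
    (h1 : -1 < k.re) (h2 : -1 < (-k).re) : IsHomSol (m ^ 2 - 1 / 4) (sqrtCos k)
    (fun x => 1 / 2 * zetaDeriv k x + 1 / 2 * zetaDeriv (-k) x) :=
  ((isHomSol_zeta hk h1).const_mul _).add ((isHomSol_zeta hk' h2).const_mul _)

theorem isHomSol_sqrtSin {m k : ℂ} (hk : k ^ 2 = m ^ 2) (hk' : (-k) ^ 2 = m ^ 2)
    (h1 : -1 < k.re) (h2 : -1 < (-k).re) : IsHomSol (m ^ 2 - 1 / 4) (sqrtSin k)
    (fun x => -(Complex.I / 2) * zetaDeriv k x + Complex.I / 2 * zetaDeriv (-k) x) :=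
  ((isHomSol_zeta hk h1).const_mul _).add ((isHomSol_zeta hk' h2).const_mul _)

theorem isRealBoundaryBasis_sqrtCos_sqrtSin {m k : ℂ} (hm : star (m ^ 2) = m ^ 2)
    (hk : k ^ 2 = m ^ 2) (hk' : (-k) ^ 2 = m ^ 2) (h1 : -1 < k.re) (h2 : -1 < (-k).re)
    (hs : star k = -k) (h0 : k ≠ 0) :
    IsRealBoundaryBasis m (isHomSol_sqrtCos hk hk' h1 h2).pair
      (isHomSol_sqrtSin hk hk' h1 h2).pair (-(Complex.I * k)) := by
  have hs' : star (-k) = -(-k) := by rw [star_neg, hs]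
  have hI : star Complex.I = -Complex.I := Complex.conj_I
  refine IsHomSol.isRealBoundaryBasis hm _ _ (neg_ne_zero.2 (mul_ne_zero Complex.I_ne_zero h0))
    (fun x hx => ?_) (fun x hx => ?_) (fun x hx => ?_)
  · rw [sqrtCos, sqrtSin]
    linear_combination (Complex.I / 2) * wronskian_zeta k hx
  · rw [sqrtCos, star_add, star_mul', star_mul', star_zeta hs hx, star_zeta hs' hx, neg_neg]
    simp
    ring
  · rw [sqrtSin, star_add, star_mul', star_mul', star_zeta hs hx, star_zeta hs' hx, neg_neg,
      star_neg, star_div₀, hI]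
    simp
    ring

theorem uImag_eq {μ : ℝ} {m : ℂ} (hm : m = Complex.I * μ) (θ : ℝ) {x : ℝ} (hx : 0 < x) :
    uImag μ θ x = (Real.cos θ : ℂ) * sqrtCos m x + (Real.sin θ : ℂ) * sqrtSin m x := by
  have h := zeta_ofReal 0 hx
  rw [Complex.ofReal_zero, add_zero] at h
  have e1 : Complex.exp (Real.log x * m) =
      Complex.cos (μ * Real.log x) + Complex.sin (μ * Real.log x) * Complex.I := by
    rw [← Complex.exp_mul_I, hm]
    congr 1
    ring
  have e2 : Complex.exp (Real.log x * -m) =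
      Complex.cos (μ * Real.log x) - Complex.sin (μ * Real.log x) * Complex.I := by
    rw [sub_eq_add_neg, ← neg_mul, ← Complex.sin_neg, ← Complex.cos_neg (μ * Real.log x),
      ← Complex.exp_mul_I, hm]
    congr 1
    ring
  rw [sqrtCos, sqrtSin, zeta_eq_zeta_zero_mul_exp m hx, zeta_eq_zeta_zero_mul_exp (-m) hx, e1, e2,
    h, uImag]
  push_cast
  linear_combination (((x ^ (1 / 2 : ℝ) : ℝ) : ℂ) * Complex.sin (μ * Real.log x) *
    Complex.sin θ) * Complex.I_sq

/-- The operator contains `ξ ζ_k`, whose conjugate is `ξ ζ_{-k}`. The sesquilinear boundary form of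
`ξ ζ_k` with itself is therefore `2 k ≠ 0`, and the operator is not even symmetric. -/
theorem not_isSelfAdjoint_Hop {m k : ℂ} (hm : star (m ^ 2) = m ^ 2) (hk : k ^ 2 = m ^ 2)
    (hk' : (-k) ^ 2 = m ^ 2) (h1 : -1 < k.re) (h2 : -1 < (-k).re) (h0 : k ≠ 0)
    (hs : star k = -k) : ¬ IsSelfAdjoint (Hop k) := by
  intro hsa
  have h := isBoundaryBasis_zeta hk hk' h1 h2 h0
  have hG := mem_Hop_graph_zeta hm hk hk' h1 h2 h0
  have hmem := (hG _).2 ⟨h.left_mem, bdry_self _⟩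
  have hz := (((isSelfAdjoint_iff_bdry hm (h.isStrictExtension hm hG).1.le).1 hsa _).1 hmem).2 _ hmem
  rw [(isHomSol_zeta hk h1).conjPair_pair hm (isHomSol_zeta hk' h2) (fun x hx => star_zeta hs hx),
    h.bdry_right_left] at hz
  exact h.ne_zero (neg_eq_zero.1 hz)

/-- The minimal and maximal operators are adjoint to each other, so neither is self-adjoint unless
they coincide. -/
theorem IsSelfAdjointExtension.isStrictExtension {m : ℂ} (hm : star (m ^ 2) = m ^ 2)
    (hne : LMin m ≠ LMax m) {T : L2 →ₗ.[ℂ] L2} (hT : IsSelfAdjointExtension m T) :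
    IsStrictExtension m T := by
  refine ⟨lt_of_le_of_ne hT.1 fun h => hne ?_, lt_of_le_of_ne (hT.le_LMax hm) fun h => hne ?_⟩
  · have hsa := hT.2
    rw [← h, LinearPMap.isSelfAdjoint_def] at hsa
    exact hsa.symm.trans (LMin_adjoint hm)
  · refine le_antisymm (LMin_le_LMax m) (LinearPMap.le_of_le_graph fun p hp => ?_)
    have hsa := (isSelfAdjoint_iff_bdry hm hT.1).1 hT.2
    rw [h] at hsa
    refine (mem_LMin_graph_iff hm).2 ⟨by rwa [LMax_graph] at hp, fun q hq => ?_⟩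
    have := ((hsa p).1 hp).2 (conjPair q) (by
      rw [LMax_graph]
      exact conjPair_mem_maxGraph hm hq)
    rwa [conjPair_conjPair] at this

end HomSchrodinger

/-! ### The main theorem -/

theorem mainTheorem8 :
    -- the case `m² ≥ 1`
    (∀ (m : ℂ) (s : ℝ), m ^ 2 = (s : ℂ) → 1 ≤ s →
      IsSelfAdjoint (LMin m) ∧ IsHomogeneous (-2) (LMin m) ∧ (-1 < m.re → Hop m = LMin m)) ∧
    -- the case `m² < 1`
    (∀ (m : ℂ) (s : ℝ), m ^ 2 = (s : ℂ) → s < 1 → HasDeficiencyIndices (LMin m) 1 1) ∧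
    -- the case `0 < m < 1`
    (∀ m : ℝ, 0 < m → m < 1 →
      (∀ θ ∈ Set.Ico 0 Real.pi, IsSelfAdjointExtension m (LExt m (uReal m θ))) ∧
      (∀ T : L2 →ₗ.[ℂ] L2, IsSelfAdjointExtension m T →
        ∃! θ : ℝ, θ ∈ Set.Ico 0 Real.pi ∧ T = LExt m (uReal m θ)) ∧
      {T : L2 →ₗ.[ℂ] L2 | IsStrictExtension m T ∧ IsHomogeneous (-2) T} = {Hop m, Hop (-m)} ∧
      Hop m ≠ Hop (-m) ∧
      Hop m = LExt m (uReal m (Real.pi / 2)) ∧ Hop (-m) = LExt m (uReal m 0) ∧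
      IsSelfAdjoint (Hop m) ∧ IsSelfAdjoint (Hop (-m))) ∧
    -- the case `m = 0`
    ((∀ θ ∈ Set.Ico 0 Real.pi, IsSelfAdjointExtension 0 (LExt 0 (uZero θ))) ∧
      (∀ T : L2 →ₗ.[ℂ] L2, IsSelfAdjointExtension 0 T →
        ∃! θ : ℝ, θ ∈ Set.Ico 0 Real.pi ∧ T = LExt 0 (uZero θ)) ∧
      {T : L2 →ₗ.[ℂ] L2 | IsStrictExtension 0 T ∧ IsHomogeneous (-2) T} = {Hop 0} ∧
      Hop 0 = LExt 0 (uZero (Real.pi / 2)) ∧ IsSelfAdjoint (Hop 0)) ∧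
    -- the case `m = iμ`, `μ > 0`
    (∀ (μ : ℝ) (m : ℂ), 0 < μ → m = Complex.I * μ →
      (∀ θ ∈ Set.Ico 0 Real.pi, IsSelfAdjointExtension m (LExt m (uImag μ θ))) ∧
      (∀ T : L2 →ₗ.[ℂ] L2, IsSelfAdjointExtension m T →
        ∃! θ : ℝ, θ ∈ Set.Ico 0 Real.pi ∧ T = LExt m (uImag μ θ)) ∧
      (∀ T : L2 →ₗ.[ℂ] L2, IsSelfAdjointExtension m T → ¬ IsHomogeneous (-2) T) ∧
      {T : L2 →ₗ.[ℂ] L2 | IsStrictExtension m T ∧ IsHomogeneous (-2) T} = {Hop m, Hop (-m)} ∧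
      Hop m ≠ Hop (-m) ∧ ¬ IsSelfAdjoint (Hop m) ∧ ¬ IsSelfAdjoint (Hop (-m))) := by
  have hzero : IsRealBoundaryBasis 0 isHomSol_sqrtLog.pair isHomSol_zeta_zero.pair (-1) :=
    isRealBoundaryBasis_sqrtLog
  refine ⟨fun m s hs h1 => ?_, fun m s hs h1 => ?_, fun m h0 h1 => ?_, ?_, fun μ m hμ hmμ => ?_⟩
  · have hkm : ((Real.sqrt s : ℝ) : ℂ) ^ 2 = m ^ 2 := by
      rw [hs, ← Complex.ofReal_pow, Real.sq_sqrt (by linarith)]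
    have heq := LMin_eq_LMax_of_one_le (Real.one_le_sqrt.2 h1) hkm
    refine ⟨?_, heq ▸ isHomogeneous_LMax m, fun _ => (Hop_eq_LMax heq).trans heq.symm⟩
    rw [LinearPMap.isSelfAdjoint_def, LMin_adjoint (star_sq_of_eq_ofReal hs), heq]
  · have hm := star_sq_of_eq_ofReal hs
    rcases lt_trichotomy s 0 with hs0 | hs0 | hs0
    -- Only `m²` is prescribed, so `m` is replaced by a chosen square root `k` of `s`, which may be
    -- `-m`.
    · set k : ℂ := Complex.I * (Real.sqrt (-s) : ℝ) with hkdef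
      have hk : k ^ 2 = m ^ 2 := by
        rw [hs, hkdef, mul_pow, Complex.I_sq, ← Complex.ofReal_pow, Real.sq_sqrt (by linarith)]
        push_cast
        ring
      have hre : k.re = 0 := by simp [hkdef]
      have hne : k ≠ 0 := mul_ne_zero Complex.I_ne_zero
        (Complex.ofReal_ne_zero.2 (Real.sqrt_pos.2 (by linarith)).ne')
      have hst : star k = -k := by simp [hkdef]
      exact (isRealBoundaryBasis_sqrtCos_sqrtSin hm hk (by rw [neg_sq, hk]) (by linarith)
        (by rw [Complex.neg_re]; linarith) hst hne).hasDeficiencyIndices (T := LExt m (sqrtCos k))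
        (IsHomSol.mem_LExt_graph _)
    · have hm0 : m = 0 := by
        rw [hs0, Complex.ofReal_zero] at hs
        exact pow_eq_zero_iff two_ne_zero |>.1 hs
      subst hm0
      exact hzero.hasDeficiencyIndices (T := LExt 0 sqrtLog) (IsHomSol.mem_LExt_graph _)
    · have hk : ((Real.sqrt s : ℝ) : ℂ) ^ 2 = m ^ 2 := by
        rw [hs, ← Complex.ofReal_pow, Real.sq_sqrt hs0.le]
      have hlt : Real.sqrt s < 1 := (Real.sqrt_lt' one_pos).2 (by linarith)
      have hpos := Real.sqrt_pos.2 hs0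
      exact (isRealBoundaryBasis_zeta hk (by rw [neg_sq, hk])
        (by rw [Complex.ofReal_re]; linarith) (by rw [Complex.neg_re, Complex.ofReal_re]; linarith)
        hpos.ne').hasDeficiencyIndices (T := LExt m (zeta (-(Real.sqrt s : ℝ))))
        (IsHomSol.mem_LExt_graph _)
  · have hk : (m : ℂ) ^ 2 = (m : ℂ) ^ 2 := rfl
    have hk' : (-(m : ℂ)) ^ 2 = (m : ℂ) ^ 2 := neg_sq _
    have r1 : -1 < (m : ℂ).re := by rw [Complex.ofReal_re]; linarith
    have r2 : -1 < (-(m : ℂ)).re := by rw [Complex.neg_re, Complex.ofReal_re]; linarith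
    have hne : (m : ℂ) ≠ 0 := Complex.ofReal_ne_zero.2 h0.ne'
    have hB := isRealBoundaryBasis_zeta hk hk' r1 r2 h0.ne'
    have hm := hB.real
    have hS := fun θ => mem_LExt_graph_of_combination (isHomSol_zeta hk' r2) (isHomSol_zeta hk r1)
      (fun x hx => uReal_eq m θ hx)
    have hsa := fun θ => hB.isSelfAdjointExtension (hS θ)
    have e1 : Hop m = LExt m (uReal m (Real.pi / 2)) := by
      refine LinearPMap.eq_of_eq_graph (SetLike.ext fun p => ?_)
      rw [mem_Hop_graph_zeta hm hk hk' r1 r2 hne, hS]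
      simp
    have e2 : Hop (-m) = LExt m (uReal m 0) := by
      refine LinearPMap.eq_of_eq_graph (SetLike.ext fun p => ?_)
      rw [mem_Hop_neg_graph_zeta hm hk hk' r1 r2 hne, hS]
      simp
    refine ⟨fun θ _ => hsa θ, fun T hT => hB.existsUnique_angle hS hT,
      setOf_homogeneous_zeta hm hk hk' r1 r2 hne, Hop_ne_Hop_neg hm hk hk' r1 r2 hne, e1, e2, ?_, ?_⟩
    · rw [e1]
      exact (hsa _).2
    · rw [e2]
      exact (hsa _).2
  · have hS := fun θ => mem_LExt_graph_of_combination isHomSol_sqrtLog isHomSol_zeta_zero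
      (fun x hx => uZero_eq θ hx)
    have hsa := fun θ => hzero.isSelfAdjointExtension (hS θ)
    have e1 : Hop 0 = LExt 0 (uZero (Real.pi / 2)) := by
      refine LinearPMap.eq_of_eq_graph (SetLike.ext fun p => ?_)
      rw [mem_Hop_zero_graph, hS]
      simp
    refine ⟨fun θ _ => hsa θ, fun T hT => hzero.existsUnique_angle hS hT,
      setOf_homogeneous_zero, e1, ?_⟩
    rw [e1]
    exact (hsa _).2
  · have hk : m ^ 2 = m ^ 2 := rfl
    have hk' : (-m) ^ 2 = m ^ 2 := neg_sq _
    have hre : m.re = 0 := by simp [hmμ]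
    have r1 : -1 < m.re := by linarith
    have r2 : -1 < (-m).re := by rw [Complex.neg_re]; linarith
    have hne : m ≠ 0 := hmμ ▸ mul_ne_zero Complex.I_ne_zero (Complex.ofReal_ne_zero.2 hμ.ne')
    have hst : star m = -m := by simp [hmμ]
    have hm : star (m ^ 2) = m ^ 2 := by rw [star_pow, hst, neg_sq]
    have hB := isRealBoundaryBasis_sqrtCos_sqrtSin hm hk hk' r1 r2 hst hne
    have hS := fun θ => mem_LExt_graph_of_combination (isHomSol_sqrtCos hk hk' r1 r2)
      (isHomSol_sqrtSin hk hk' r1 r2) (fun x hx => uImag_eq hmμ θ hx)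
    have hset := setOf_homogeneous_zeta hm hk hk' r1 r2 hne
    have n1 := not_isSelfAdjoint_Hop hm hk hk' r1 r2 hne hst
    have n2 := not_isSelfAdjoint_Hop hm hk' (by rw [neg_neg]) r2 (by rwa [neg_neg])
      (neg_ne_zero.2 hne) (by rw [star_neg, hst])
    have hstrict := (isBoundaryBasis_zeta hk hk' r1 r2 hne).isStrictExtension hm
      (mem_Hop_graph_zeta hm hk hk' r1 r2 hne)
    refine ⟨fun θ _ => hB.isSelfAdjointExtension (hS θ), fun T hT => hB.existsUnique_angle hS hT,
      fun T hT hhom => ?_, hset, Hop_ne_Hop_neg hm hk hk' r1 r2 hne, n1, n2⟩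
    -- A self-adjoint extension is strict because the minimal and maximal operators differ, so if
    -- homogeneous it is one of two operators already known not to be self-adjoint.
    have hmem : T ∈ ({Hop m, Hop (-m)} : Set (L2 →ₗ.[ℂ] L2)) :=
      hset ▸ ⟨hT.isStrictExtension hm (hstrict.1.trans hstrict.2).ne, hhom⟩
    rcases hmem with h | h
    · exact n1 (h ▸ hT.2)
    · exact n2 (h ▸ hT.2)
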